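/- **Setting.** Let $M=(\mathcal S,\mathcal A,P,r,H)$ be a finite episodic MDP with $S$ states, $A$ actions, horizon $H\ge 1$, time-homogeneous transition probabilities $P(\cdot\mid s,a)$ and mean rewards $r(s,a)$. For a deterministic policy $\pi=(\pi_1,\dots,\pi_H)$ let $V_h^\pi(s)=\mathbb E_\pi[\sum_{j=h}^H r(s_j,a_j)\mid s_h=s]$, $Q_h^\pi(s,a)=r(s,a)+\sum_{s'}P(s'\mid s,a)V_{h+1}^\pi(s')$, $V_h^*=\max_\pi V_h^\pi$, $Q_h^*=\max_\pi Q_h^\pi$, $\mathrm{gap}_h(s,a)=V_h^*(s)-Q_h^*(s,a)$, $\mathrm{gap}(s,a)=\min_h\mathrm{gap}_h(s,a)$, and let $\mathrm{gap}_{\min}$ be the smallest non-zero value of $\mathrm{gap}_h(s,a)$. In episode $k=1,2,\dots$ the environment chooses (possibly adaptively) an initial state $s_1^k$ in a set $\mathcal S_0\subseteq\mathcal S$ of possible initial states, the agent chooses a policy $\pi^k$ based on the previous episodes, and for $h=1,\dots,H$ it takes $a_h^k=\pi_h^k(s_h^k)$, receives a random reward $R_h^k$ of conditional mean $r(s_h^k,a_h^k)$,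 and $s_{h+1}^k$ is drawn from $P(\cdot\mid s_h^k,a_h^k)$. Let $\mathcal F_h^k=\sigma(s_1^1,a_1^1,R_1^1,\dots,s_h^k,a_h^k)$. The regret is $\mathrm{Reg}(K)=\sum_{k=1}^K(V_1^*(s_1^k)-V_1^{\pi^k}(s_1^k))$, and the distributional regret is $\mathrm{Reg}(K,\delta)=\inf\{x\in\mathbb R:\mathbb P(\mathrm{Reg}(K)>x)\le\delta\}$ for $\delta\in(0,1]$. **Assumptions.** (a) $0\le V_h^\pi(s)\le V_{\max}$ for all $h\in[H]$, $s$, $\pi$. (b) There are $\sigma_{\exp}:[H]\times\mathcal S\times\mathcal A\to[0,\infty)$ and $V_\alpha\ge0$ such that at every visit to a pair $(s,a)$, at whatever step, with observed reward $R$ and next state $s'$, and for every $h\in[H]$, the variable $X=R+V_{h+1}^*(s')-Q_h^*(s,a)$ is conditionally $(\sigma_{\exp}(h,s,a),V_\alpha)$-sub-exponential: given the $\sigma$-algebra $\mathcal F$ of the history up to and including the choice of the action, $\mathbb E[e^{\lambda X}\mid\mathcal F]\le e^{\sigma_{\exp}(h,s,a)^2\lambda^2/2}$ almost surely for all $|\lambda|\le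 1/V_\alpha$ (all $\lambda\in\mathbb R$ if $V_\alpha=0$). Put $W_h^\pi(s)=\mathbb E_\pi[\sum_{j=h}^H\frac12\sigma_{\exp}^2(j,s_j,a_j)\mid s_h=s]$, $\mathbb W^*=\max_{h,s,\pi}W_h^\pi(s)$, $\mathbb W^*_{\mathrm{diff}}=\max_{h,s,\pi}(W_h^\pi(s)-\min_{s'}W_h^\pi(s'))$ and $\sigma_{\max}=\max\{\max_{h,s,a}2\sigma_{\exp}(h,s,a),\sqrt{2V_\alpha V_{\max}}\}$. (c) $\sigma_{\max}^2\le 2V_{\max}^2$. **Algorithm.** EQO+ with input $(c_{1,k},c_{2,k})_k$ computes from the previous episodes the visit counts $N^k(s,a)$ and the empirical means $\hat r^k$, $\hat P^k$, sets $b^k(s,a)=\frac{c_{1,k}}{N^k(s,a)}\wedge\frac{c_{2,k}}{\sqrt{N^k(s,a)}}$, and, starting from $V_{H+1}^k=0$, $Q_h^k(s,a)=\big((\hat r^k+\hat P^kV_{h+1}^k)(s,a)_++b^k(s,a)\big)\wedge V_{\max}$ if $N^k(s,a)>0$ and $Q_h^k(s,a)=V_{\max}$ otherwise, $V_h^k(s)=\max_aQ_h^k(s,a)$;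 $\pi_h^k(s)$ is a maximizer of $Q_h^k(s,\cdot)$. Let $K\ge1$ with $KH\ge2$, $c_1>0$, $c_2\ge2$, and $$c_{1,k}=c_1V_{\max}\sqrt{\frac{k\,\Lambda_k}{SA\log KH}},\qquad c_{2,k}=c_2V_{\max}\sqrt{\log(32HSAk)},$$ where $(\Lambda_k)_{k\ge1}$ is any non-decreasing sequence with $\log(32HSA(1+\log k))\le\Lambda_k\le\log(32HSAk^2)$. Put $\ell(\delta)=\log\frac{32HSA(1+\log K)}{\delta}$. **Claim.** There is an absolute constant $C>0$ such that under (a)–(c), for every $\delta\in(0,1]$, the following hold for EQO+ with this input. 1. Let $B$ be the first step at which an action of positive gap is taken ($B=H+1$ if there is none), and let $v_{\mathrm{gap}}$ be the minimum of $\mathrm{gap}_B(s_B,a_B)$ over all policies, all initial states in $\mathcal S_0$ and all outcomes of positive probability with $B\le H$. For all functions $\overline{\mathrm{gap}}_h:\mathcal S\times\mathcal A\to(0,\infty)$ with $\mathbb E_\pi[\sum_{h=B}^H\overline{\mathrm{gap}}_h(s_h,a_h)\mid s_1=s]\le V_1^*(s)-V_1^\pi(s)$ for all $s\in\mathcal S_0$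 and all $\pi$ (effective gaps), with $\overline{\mathrm{gap}}(s,a)=\min_h\overline{\mathrm{gap}}_h(s,a)$, $$\mathrm{Reg}(K,\delta)\le V_{\max}e^{C c_2^{-2}\log\frac1\delta}+C\sum_{s,a}\frac{c_2^2V_{\max}^2\log HSAK}{\overline{\mathrm{gap}}(s,a)}+C\Big(\frac{(\mathbb W^*)^2}{v_{\mathrm{gap}}V_{\max}^2}+\frac{\mathbb W^*_{\mathrm{diff}}\vee V_\alpha^2}{V_{\max}}\Big)\frac{\ell(\delta)^2}{c_1^2\log(32HSA)}SA\log KH+C\,V_{\max}S^2A\log(KH)\,\ell(\delta).$$ 2. If moreover $\mathbb W^*\le2V_{\max}^2$ and $V_\alpha\le2V_{\max}$, then $$\mathrm{Reg}(K,\delta)\le V_{\max}e^{C c_2^{-2}\log\frac1\delta}+C\sum_{s,a}\frac{c_2^2V_{\max}^2\log HSAK}{\mathrm{gap}(s,a)\vee\frac{\mathrm{gap}_{\min}}H}+C\Big(\frac{V_{\max}^2SA\log(KH)\,\ell(\delta)^2}{c_1^2\,\mathrm{gap}_{\min}\log(32HSA)}+V_{\max}S^2A\log(KH)\,\ell(\delta)\Big).$$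 3. Under the same additional conditions, the worst-case bound $$\mathrm{Reg}(K,\delta)\le V_{\max}e^{C c_2^{-2}\log\frac1\delta}+C\Big[\Big(\frac{\log\frac1\delta}{c_1\log(32HSA)}+\frac1{c_1}+c_1\Big)V_{\max}\sqrt{KSA\,\Lambda_K\log KH}+V_{\max}S^2A\,\ell(\delta)\log(2KH)\Big]$$ holds as well, so that the same algorithm is minimax optimal up to logarithmic factors and has an instance-dependent regret of order $\log K$. (A fraction with $\mathrm{gap}_{\min}$ or $v_{\mathrm{gap}}$ in its denominator is read as $0$ if there is no non-zero gap, respectively no such outcome, and so is a fraction with a denominator that vanishes because $V_{\max}=0$.) -/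

import Mathlib

open MeasureTheory

namespace EQO

/-- A tabular episodic MDP with time-homogeneous transitions and mean rewards and horizon `H`.
`P s a s'` is the probability of moving to `s'` from `(s, a)`; time steps are `1, …, H`. -/
structure MDP (S A : Type*) [Fintype S] where
  H : ℕ
  P : S → A → S → ℝ
  P_nonneg : ∀ s a s', 0 ≤ P s a s'
  P_sum : ∀ s a, ∑ s', P s a s' = 1
  r : S → A → ℝ

/-- Deterministic policies; only the mappings `π 1, …, π H` matter. -/
abbrev Policy (S A : Type*) := ℕ → S → A

namespace MDP

variable {S A : Type*} [Fintype S]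

/-- `(P V)(s, a)`. -/
noncomputable def PV (M : MDP S A) (V : S → ℝ) (s : S) (a : A) : ℝ := ∑ s', M.P s a s' * V s'

/-- `E_π [∑_{j = h}^{h + n - 1} f j s_j a_j | s_h = s]`, computed by conditioning on the
first transition. The arguments are `n`, `h`, `s`. -/
noncomputable def expSum (M : MDP S A) (π : Policy S A) (f : ℕ → S → A → ℝ) : ℕ → ℕ → S → ℝ
  | 0, _, _ => 0
  | n + 1, h, s => f h s (π h s) + M.PV (expSum M π f n (h + 1)) s (π h s)

/-- `V_h^π(s) = E_π [∑_{j = h}^H r(s_j, a_j) | s_h = s]`. -/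
noncomputable def V (M : MDP S A) (π : Policy S A) (h : ℕ) (s : S) : ℝ :=
  M.expSum π (fun _ => M.r) (M.H + 1 - h) h s

/-- `Q_h^π(s, a)`. -/
noncomputable def Q (M : MDP S A) (π : Policy S A) (h : ℕ) (s : S) (a : A) : ℝ :=
  M.r s a + M.PV (M.V π (h + 1)) s a

/-- `V_h^*(s) = max_π V_h^π(s)`. -/
noncomputable def Vstar (M : MDP S A) (h : ℕ) (s : S) : ℝ := ⨆ π : Policy S A, M.V π h s

/-- `Q_h^*(s, a) = max_π Q_h^π(s, a)`. -/
noncomputable def Qstar (M : MDP S A) (h : ℕ) (s : S) (a : A) : ℝ := ⨆ π : Policy S A, M.Q π h s a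

/-- `gap_h(s, a) = V_h^*(s) - Q_h^*(s, a)`. -/
noncomputable def gap (M : MDP S A) (h : ℕ) (s : S) (a : A) : ℝ := M.Vstar h s - M.Qstar h s a

/-- `gap(s, a) = min_{h ∈ [H]} gap_h(s, a)`. -/
noncomputable def gapSA (M : MDP S A) (s : S) (a : A) : ℝ := ⨅ h : Set.Icc 1 M.H, M.gap h s a

/-- The minimum non-zero gap. It takes the value `0` if there is no non-zero gap. -/
noncomputable def gapMin (M : MDP S A) : ℝ :=
  sInf {g : ℝ | ∃ h ∈ Set.Icc 1 M.H, ∃ s a, g = M.gap h s a ∧ 0 < g}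

/-- Boundedness: `0 ≤ V_h^π(s) ≤ Vmax` for all `h ∈ [H]`, `s` and `π`. -/
def Bounded (M : MDP S A) (Vmax : ℝ) : Prop :=
  ∀ h ∈ Set.Icc 1 M.H, ∀ (s : S) (π : Policy S A), 0 ≤ M.V π h s ∧ M.V π h s ≤ Vmax

/-- The total variance proxy `W_h^π(s) = E_π [∑_{j = h}^H σ(j, s_j, a_j)^2 / 2 | s_h = s]`. -/
noncomputable def W (M : MDP S A) (σ : ℕ → S → A → ℝ) (π : Policy S A) (h : ℕ) (s : S) : ℝ :=
  M.expSum π (fun j s a => σ j s a ^ 2 / 2) (M.H + 1 - h) h s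

/-- `𝕎^* = max_{h ∈ [H], s, π} W_h^π(s)`. -/
noncomputable def Wstar (M : MDP S A) (σ : ℕ → S → A → ℝ) : ℝ :=
  ⨆ x : Set.Icc 1 M.H × S × Policy S A, M.W σ x.2.2 x.1 x.2.1

/-- `𝕎_diff^* = max_{h ∈ [H], s, π} (W_h^π(s) - min_{s'} W_h^π(s'))`. -/
noncomputable def Wdiff (M : MDP S A) (σ : ℕ → S → A → ℝ) : ℝ :=
  ⨆ x : Set.Icc 1 M.H × S × Policy S A,
    (M.W σ x.2.2 x.1 x.2.1 - ⨅ s' : S, M.W σ x.2.2 x.1 s')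

/-- `σ_max = (max_{h ∈ [H], s, a} 2 σ(h, s, a)) ∨ √(2 Vα Vmax)`. -/
noncomputable def sigmaMax (M : MDP S A) (σ : ℕ → S → A → ℝ) (Vα Vmax : ℝ) : ℝ :=
  max (⨆ x : Set.Icc 1 M.H × S × A, 2 * σ x.1 x.2.1 x.2.2) (√(2 * Vα * Vmax))

open Classical in
/-- `E_π [∑_{j = B}^{h + n - 1} g j s_j a_j | s_h = s]`, where `B` is the first step `j ≥ h` at
which `π` takes an action of positive gap (the sum is empty if there is no such step). -/
noncomputable def expSumFromB (M : MDP S A) (π : Policy S A) (g : ℕ → S → A → ℝ) :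
    ℕ → ℕ → S → ℝ
  | 0, _, _ => 0
  | n + 1, h, s =>
      if 0 < M.gap h s (π h s) then M.expSum π g (n + 1) h s
      else M.PV (expSumFromB M π g n (h + 1)) s (π h s)

/-- Effective gaps, for the set `S₀` of possible initial states: positive functions `g_h` with
`E_π [∑_{h = B}^H g_h(s_h, a_h) | s_1 = s] ≤ V_1^*(s) - V_1^π(s)` for all `s ∈ S₀` and `π`. -/
def IsEffectiveGap (M : MDP S A) (S₀ : Set S) (g : ℕ → S → A → ℝ) : Prop :=
  (∀ h ∈ Set.Icc 1 M.H, ∀ s a, 0 < g h s a) ∧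
    ∀ s ∈ S₀, ∀ π : Policy S A, M.expSumFromB π g M.H 1 s ≤ M.Vstar 1 s - M.V π 1 s

/-- `ReachBeforeB M S₀ π h s`: from some initial state in `S₀`, with positive probability, `π` is
in `s` at step `h` without having taken an action of positive gap at the steps before `h`. -/
inductive ReachBeforeB (M : MDP S A) (S₀ : Set S) (π : Policy S A) : ℕ → S → Prop
  | init (s : S) : s ∈ S₀ → ReachBeforeB M S₀ π 1 s
  | step (h : ℕ) (s s' : S) : ReachBeforeB M S₀ π h s → ¬ 0 < M.gap h s (π h s) →
      0 < M.P s (π h s) s' → ReachBeforeB M S₀ π (h + 1) s'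

/-- `v_gap = min_π gap_B(s_B, a_B)`, the minimum over all policies and all outcomes of positive
probability with `B ≤ H`. It takes the value `0` if there is no such outcome. -/
noncomputable def vGap (M : MDP S A) (S₀ : Set S) : ℝ :=
  sInf {g : ℝ | ∃ (π : Policy S A), ∃ h ∈ Set.Icc 1 M.H, ∃ s, M.ReachBeforeB S₀ π h s ∧
    g = M.gap h s (π h s) ∧ 0 < g}

/-- `H S A`. -/
noncomputable def size [Fintype A] (M : MDP S A) : ℝ := M.H * Fintype.card S * Fintype.card A

/-- The logarithmic factor `ℓ(δ) = log (32 H S A (1 + log K) / δ)`. -/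
noncomputable def ell [Fintype A] (M : MDP S A) (K : ℕ) (δ : ℝ) : ℝ :=
  Real.log (32 * M.size * (1 + Real.log K) / δ)

/-- `c_{1,k} = c₁ Vmax √(k Λ_k / (S A log (K H)))`. -/
noncomputable def eqoC1 [Fintype A] (M : MDP S A) (K : ℕ) (Vmax c₁ : ℝ) (Λ : ℕ → ℝ)
    (k : ℕ) : ℝ :=
  c₁ * Vmax * √(k * Λ k / (Fintype.card S * Fintype.card A * Real.log (K * M.H)))

/-- `c_{2,k} = c₂ Vmax √(log (32 H S A k))`. -/
noncomputable def hoeffdingC2 [Fintype A] (M : MDP S A) (Vmax c₂ : ℝ) (k : ℕ) : ℝ :=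
  c₂ * Vmax * √(Real.log (32 * M.size * k))

end MDP

/-- The random variables of an interaction in episodes `k = 1, 2, …`: the states `s_h^k`
(`1 ≤ h ≤ H + 1`), the rewards `R_h^k` (`1 ≤ h ≤ H`) and the policies `π^k`. -/
structure Interaction (Ω S A : Type*) where
  state : ℕ → ℕ → Ω → S
  reward : ℕ → ℕ → Ω → ℝ
  policy : ℕ → Ω → Policy S A

namespace Interaction

variable {Ω S A : Type*}

/-- `a_h^k = π_h^k(s_h^k)`. -/
def action (I : Interaction Ω S A) (k h : ℕ) (ω : Ω) : A := I.policy k ω h (I.state k h ω)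

/-- The σ-algebra of `(s_h^k, a_h^k)`. -/
@[reducible] def sigmaSA (I : Interaction Ω S A) (k h : ℕ) : MeasurableSpace Ω :=
  MeasurableSpace.comap (I.state k h) ⊤ ⊔ MeasurableSpace.comap (I.action k h) ⊤

/-- The σ-algebra of `(s_h^k, a_h^k, R_h^k)`. -/
@[reducible] def sigmaSAR (I : Interaction Ω S A) (k h : ℕ) : MeasurableSpace Ω :=
  I.sigmaSA k h ⊔ MeasurableSpace.comap (I.reward k h) inferInstance

/-- The σ-algebra of everything observed in the episodes `1, …, k - 1`. -/
@[reducible] def past (I : Interaction Ω S A) (H k : ℕ) : MeasurableSpace Ω :=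
  ⨆ i ∈ Set.Ico 1 k, (⨆ h ∈ Set.Icc 1 H, I.sigmaSAR i h) ⊔
    MeasurableSpace.comap (I.state i (H + 1)) ⊤

/-- `ℱ_h^k = σ(s_1^1, a_1^1, R_1^1, …, s_h^k, a_h^k)`. -/
@[reducible] def filt (I : Interaction Ω S A) (H k h : ℕ) : MeasurableSpace Ω :=
  I.past H k ⊔ (⨆ j ∈ Set.Ico 1 h, I.sigmaSAR k j) ⊔ I.sigmaSA k h

variable [Fintype S]

open Classical in
/-- `I` is an interaction with the MDP `M`: the policy of an episode depends on the observations
of the previous episodes only, the next state is drawn from `P(s_h^k, a_h^k)`, and the reward has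
conditional mean `r(s_h^k, a_h^k)`. The initial states are arbitrary random variables (they may be
chosen adaptively). -/
structure Follows [MeasurableSpace Ω] (I : Interaction Ω S A) (μ : Measure Ω) (M : MDP S A) :
    Prop where
  measurable_state : ∀ k, 1 ≤ k → ∀ h ∈ Set.Icc 1 (M.H + 1), Measurable[_, ⊤] (I.state k h)
  measurable_reward : ∀ k, 1 ≤ k → ∀ h ∈ Set.Icc 1 M.H, Measurable (I.reward k h)
  measurable_policy : ∀ k, 1 ≤ k → ∀ h ∈ Set.Icc 1 M.H, ∀ s,
    Measurable[I.past M.H k, ⊤] (fun ω => I.policy k ω h s)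
  integrable_reward : ∀ k, 1 ≤ k → ∀ h ∈ Set.Icc 1 M.H, Integrable (I.reward k h) μ
  mean_reward : ∀ k, 1 ≤ k → ∀ h ∈ Set.Icc 1 M.H,
    μ[I.reward k h | I.filt M.H k h] =ᵐ[μ] fun ω => M.r (I.state k h ω) (I.action k h ω)
  next_state : ∀ k, 1 ≤ k → ∀ h ∈ Set.Icc 1 M.H, ∀ s',
    μ[fun ω => if I.state k (h + 1) ω = s' then (1 : ℝ) else 0 | I.filt M.H k h] =ᵐ[μ]
      fun ω => M.P (I.state k h ω) (I.action k h ω) s'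

/-- The cumulative regret `∑_{k = 1}^K (V_1^*(s_1^k) - V_1^{π^k}(s_1^k))`. -/
noncomputable def regret (I : Interaction Ω S A) (M : MDP S A) (K : ℕ) (ω : Ω) : ℝ :=
  ∑ k ∈ Finset.Icc 1 K,
    (M.Vstar 1 (I.state k 1 ω) - M.V (I.policy k ω) 1 (I.state k 1 ω))

open Classical in
/-- The visit count `N^k(s, a)`. -/
noncomputable def count (I : Interaction Ω S A) (H k : ℕ) (ω : Ω) (s : S) (a : A) : ℝ :=
  ∑ i ∈ Finset.Ico 1 k, ∑ h ∈ Finset.Icc 1 H,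
    if I.state i h ω = s ∧ I.action i h ω = a then 1 else 0

open Classical in
/-- The empirical mean reward `r̂^k(s, a)`. -/
noncomputable def rHat (I : Interaction Ω S A) (H k : ℕ) (ω : Ω) (s : S) (a : A) : ℝ :=
  (∑ i ∈ Finset.Ico 1 k, ∑ h ∈ Finset.Icc 1 H,
    if I.state i h ω = s ∧ I.action i h ω = a then I.reward i h ω else 0) / I.count H k ω s a

open Classical in
/-- The empirical transition probability `P̂^k(s' | s, a)`. -/
noncomputable def pHat (I : Interaction Ω S A) (H k : ℕ) (ω : Ω) (s : S) (a : A) (s' : S) : ℝ :=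
  (∑ i ∈ Finset.Ico 1 k, ∑ h ∈ Finset.Icc 1 H,
    if I.state i h ω = s ∧ I.action i h ω = a ∧ I.state i (h + 1) ω = s' then 1 else 0) /
      I.count H k ω s a

/-- The bonus `b^k(s, a) = c_{1,k} / N^k(s, a) ∧ c_{2,k} / √(N^k(s, a))`. -/
noncomputable def bonus (I : Interaction Ω S A) (H : ℕ) (c₁ c₂ : ℕ → ℝ) (k : ℕ) (ω : Ω)
    (s : S) (a : A) : ℝ :=
  min (c₁ k / I.count H k ω s a) (c₂ k / √(I.count H k ω s a))

open Classical in
/-- One step of the backward recursion of episode `k`: `Q_h^k` in terms of `Vnext = V_{h+1}^k`. -/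
noncomputable def qStep (I : Interaction Ω S A) (H : ℕ) (Vmax : ℝ) (c₁ c₂ : ℕ → ℝ) (k : ℕ) (ω : Ω)
    (Vnext : S → ℝ) (s : S) (a : A) : ℝ :=
  if 0 < I.count H k ω s a then
    min (max (I.rHat H k ω s a + ∑ s', I.pHat H k ω s a s' * Vnext s') 0 +
      I.bonus H c₁ c₂ k ω s a) Vmax
  else Vmax

/-- The value estimate of episode `k` with `n` steps to go, so that `V_h^k` is the case
`n = H + 1 - h`. -/
noncomputable def vEst (I : Interaction Ω S A) (H : ℕ) (Vmax : ℝ) (c₁ c₂ : ℕ → ℝ) (k : ℕ) (ω : Ω) :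
    ℕ → S → ℝ
  | 0, _ => 0
  | n + 1, s => ⨆ a : A, I.qStep H Vmax c₁ c₂ k ω (vEst I H Vmax c₁ c₂ k ω n) s a

/-- `Q_h^k(s, a)`. -/
noncomputable def qEst (I : Interaction Ω S A) (H : ℕ) (Vmax : ℝ) (c₁ c₂ : ℕ → ℝ) (k : ℕ) (ω : Ω)
    (h : ℕ) (s : S) (a : A) : ℝ :=
  I.qStep H Vmax c₁ c₂ k ω (I.vEst H Vmax c₁ c₂ k ω (H - h)) s a

/-- The policies are those of EQO+ with input `(c_{1,k}, c_{2,k})_k`: in every episode,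
`π_h^k(s)` maximizes `Q_h^k(s, ·)`; ties may be broken in any way. -/
def RunsEQOPlus (I : Interaction Ω S A) (H : ℕ) (Vmax : ℝ) (c₁ c₂ : ℕ → ℝ) : Prop :=
  ∀ k, 1 ≤ k → ∀ ω, ∀ h ∈ Set.Icc 1 H, ∀ s a,
    I.qEst H Vmax c₁ c₂ k ω h s a ≤ I.qEst H Vmax c₁ c₂ k ω h s (I.policy k ω h s)

end Interaction

/-- `X` is `m`-conditionally `(σ, α)`-sub-exponential: `E[exp (lam X) | m] ≤ exp (σ² lam² / 2)`
almost surely for all `lam ∈ [-1/α, 1/α]` (all real `lam` if `α = 0`). -/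
def CondSubExp {Ω : Type*} {m₀ : MeasurableSpace Ω} (μ : Measure Ω) (m : MeasurableSpace Ω)
    (X σ : Ω → ℝ) (α : ℝ) : Prop :=
  ∀ lam : ℝ, α * |lam| ≤ 1 → Integrable (fun ω => Real.exp (lam * X ω)) μ ∧
    μ[fun ω => Real.exp (lam * X ω) | m] ≤ᵐ[μ] fun ω => Real.exp (σ ω ^ 2 * lam ^ 2 / 2)

/-- Conditional sub-exponentiality of the observations with variance proxy `σ` and constant `Vα`:
whenever `(s, a)` is visited, for each `h ∈ [H]`, the deviation of `R + V_{h+1}^*(s')` from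
`Q_h^*(s, a)` is conditionally `(σ(h, s, a), Vα)`-sub-exponential, where `R` and `s'` are the
reward and the next state of the visit. -/
def SubExponential {Ω S A : Type*} [MeasurableSpace Ω] [Fintype S] (I : Interaction Ω S A)
    (μ : Measure Ω) (M : MDP S A) (σ : ℕ → S → A → ℝ) (Vα : ℝ) : Prop :=
  (∀ h ∈ Set.Icc 1 M.H, ∀ s a, 0 ≤ σ h s a) ∧ 0 ≤ Vα ∧
    ∀ k, 1 ≤ k → ∀ t ∈ Set.Icc 1 M.H, ∀ h ∈ Set.Icc 1 M.H,
      CondSubExp μ (I.filt M.H k t)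
        (fun ω => I.reward k t ω + M.Vstar (h + 1) (I.state k (t + 1) ω)
          - M.Qstar h (I.state k t ω) (I.action k t ω))
        (fun ω => σ h (I.state k t ω) (I.action k t ω)) Vα

/-- The distributional regret `inf {x ∈ ℝ | ℙ(X > x) ≤ δ}`; the infimum is taken in the extended
reals since it is `-∞` for `δ = 1`. -/
noncomputable def upperQuantile {Ω : Type*} [MeasurableSpace Ω] (μ : Measure Ω) (X : Ω → ℝ)
    (δ : ℝ) : EReal :=
  sInf ((fun x : ℝ => (x : EReal)) '' {x : ℝ | μ {ω | x < X ω} ≤ ENNReal.ofReal δ})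

end EQO

/-! The analysis rests on quasi-optimism: the estimates V_h^k need not dominate V_h^*, only up to an
error controlled by the variance proxies.

Concentration. V_{h+1}^* is a fixed function, so the deviations of R + V_{h+1}^*(s') from Q_h^*(s,
a) are martingale differences. A maximal inequality at a fixed exponent θ bounds their average over
N visits by θ · (proxy) + 2ℓ / (θ N), for all episodes at once (`measure_dev_le`). With θ = 2ℓ / c_1
the last term is the bonus c_1 / N, and only θ · (proxy) is left over. Since c_{1,k} varies with k,
one θ is used per dyadic block of episodes; summability over the blocks is what the factor 1 + log k
inside ℓ provides. Exponents adapted to the count give instead a deviation of at most c_2 / √N with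
nothing left over. That bonus does not contain δ, so it is trusted only from block `firstBlock` on;
the earlier episodes cost Vmax each, which is the exponential term of the bounds.

Quasi-optimism. Backward induction with the empirical kernel needs functions Y_h that satisfy P̂
Y_{h+1} + (leftover) ≤ Y_h. Along an optimal policy, Y = 2θ W - 20 θ³ (W - min W)² works
(`quasiErr_step`): the linear part collects the proxies, the concave part pays for the variance of Y
itself, which appears when P̂ is exchanged for P. Hence V^* - V^k ≤ 2θ W^*.

Surpluses. The term (P̂ - P)(V^k - V^*) involves a random function and needs a bound uniform in the
function, Var / (8 Vmax) + O(S Vmax ℓ / N) (`sum_pHat_sub_PV_le`). The variance is absorbed by the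
potential `potF`, which is V^k - V^π plus a quadratic in V^k - V^*. So the regret of an episode is
O(θ W^*) plus the expected sum of costs depending on N only, clipped at a multiple of Vmax.

Summation. `measure_sum_costVal_gt_le` replaces expected clipped costs by observed ones, through an
exponential supermartingale built from u + u² / c. Counts are frozen during an episode, but they lag
by a factor of at most 2 except in O(S A log (K H)) episodes. The observed costs are then summed
over the successive visits to each pair.

Gaps. From step B on the regret is at least v_gap. If 6θ W^* ≤ v_gap, the quasi-optimism error is at
most half of that regret, which is then at most twice the potential. Subtracting effective gaps from
the surpluses leaves costs (16 c_2 / √N - gap)_+, whose sum over N is O(c_2² / gap). As θ² k is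
bounded, the episodes with larger θ contribute a multiple of (W^*)² / v_gap. For the worst case, the
costs are of order c_1 / N and the sum of θ Vmax² over the episodes is of order √K. -/

set_option linter.unusedSectionVars false

namespace EQO
namespace MDP

/-! ### One-step expectations, variances and backward recursions. -/

section Basic

variable {S A : Type*} [Fintype S] (M : MDP S A)

lemma PV_mono_of_pos {f g : S → ℝ} {s : S} {a : A} (h : ∀ x, 0 < M.P s a x → f x ≤ g x) :
    M.PV f s a ≤ M.PV g s a := by
  refine Finset.sum_le_sum fun x _ => ?_
  rcases (M.P_nonneg s a x).eq_or_lt with h0 | h0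
  · simp [← h0]
  · exact mul_le_mul_of_nonneg_left (h x h0) h0.le

lemma PV_mono {f g : S → ℝ} {s : S} {a : A} (h : ∀ x, f x ≤ g x) :
    M.PV f s a ≤ M.PV g s a := M.PV_mono_of_pos fun x _ => h x

lemma PV_const (c : ℝ) (s : S) (a : A) : M.PV (fun _ => c) s a = c := by
  simp [PV, ← Finset.sum_mul, M.P_sum]

lemma PV_zero (s : S) (a : A) : M.PV (fun _ => 0) s a = 0 := M.PV_const 0 s a

lemma PV_add (f g : S → ℝ) (s : S) (a : A) :
    M.PV (fun x => f x + g x) s a = M.PV f s a + M.PV g s a := by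
  simp [PV, mul_add, Finset.sum_add_distrib]

lemma PV_sub (f g : S → ℝ) (s : S) (a : A) :
    M.PV (fun x => f x - g x) s a = M.PV f s a - M.PV g s a := by
  simp [PV, mul_sub, Finset.sum_sub_distrib]

lemma PV_const_mul (c : ℝ) (f : S → ℝ) (s : S) (a : A) :
    M.PV (fun x => c * f x) s a = c * M.PV f s a := by
  simp only [PV, Finset.mul_sum]
  exact Finset.sum_congr rfl fun x _ => by ring

lemma PV_nonneg {f : S → ℝ} {s : S} {a : A} (h : ∀ x, 0 ≤ f x) : 0 ≤ M.PV f s a :=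
  Finset.sum_nonneg fun x _ => mul_nonneg (M.P_nonneg s a x) (h x)

lemma PV_le_const {f : S → ℝ} {c : ℝ} {s : S} {a : A} (h : ∀ x, f x ≤ c) : M.PV f s a ≤ c :=
  (M.PV_mono h).trans_eq (M.PV_const c s a)

lemma const_le_PV {f : S → ℝ} {c : ℝ} {s : S} {a : A} (h : ∀ x, c ≤ f x) : c ≤ M.PV f s a :=
  (M.PV_const c s a).symm.trans_le (M.PV_mono h)

lemma P_le_one (s : S) (a : A) (x : S) : M.P s a x ≤ 1 := by
  rw [← M.P_sum s a]
  exact Finset.single_le_sum (fun y _ => M.P_nonneg s a y) (Finset.mem_univ x)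

/-- The variance of `f` under `P(· | s, a)`. -/
noncomputable def var (f : S → ℝ) (s : S) (a : A) : ℝ := M.PV (fun x => (f x - M.PV f s a) ^ 2) s a

lemma var_nonneg (f : S → ℝ) (s : S) (a : A) : 0 ≤ M.var f s a := M.PV_nonneg fun _ => sq_nonneg _

lemma PV_sub_sq (f : S → ℝ) (c : ℝ) (s : S) (a : A) :
    M.PV (fun x => (f x - c) ^ 2) s a = M.var f s a + (M.PV f s a - c) ^ 2 := by
  have key : ∀ d, M.PV (fun x => (f x - d) ^ 2) s a
      = M.PV (fun x => f x ^ 2) s a - 2 * d * M.PV f s a + d ^ 2 := by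
    intro d
    have : (fun x => (f x - d) ^ 2) = fun x => (f x ^ 2 - 2 * d * f x) + d ^ 2 := by
      ext x; ring
    rw [this, M.PV_add _ (fun _ => d ^ 2), M.PV_const, M.PV_sub _ (fun x => 2 * d * f x),
      M.PV_const_mul]
  rw [var, key, key]; ring

lemma var_eq (f : S → ℝ) (s : S) (a : A) :
    M.var f s a = M.PV (fun x => f x ^ 2) s a - M.PV f s a ^ 2 := by
  have := M.PV_sub_sq f 0 s a
  simp only [sub_zero] at this
  linarith

lemma var_add_const (f : S → ℝ) (c : ℝ) (s : S) (a : A) :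
    M.var (fun x => f x + c) s a = M.var f s a := by
  unfold var
  rw [M.PV_add f (fun _ => c), M.PV_const]
  simp

/-- The mean minimizes the second moment about a point, so any convenient centre `y` may stand in
for the mean of `g`. -/
lemma var_le_of_lipschitz {f g : S → ℝ} {c : ℝ} {s : S} {a : A} {y : ℝ}
    (h : ∀ x, |g x - y| ≤ c * |f x - M.PV f s a|) :
    M.var g s a ≤ c ^ 2 * M.var f s a := by
  have h1 := M.PV_sub_sq g y s a
  have h2 : M.PV (fun x => (g x - y) ^ 2) s a ≤ c ^ 2 * M.var f s a := by
    rw [var, ← M.PV_const_mul]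
    refine M.PV_mono fun x => ?_
    have := h x
    rw [← sq_abs (g x - y), ← sq_abs (f x - _), ← mul_pow]
    gcongr
  nlinarith [sq_nonneg (M.PV g s a - y)]

lemma var_le_sq {f : S → ℝ} {c : ℝ} {s : S} {a : A} {y : ℝ} (h : ∀ x, |f x - y| ≤ c) :
    M.var f s a ≤ c ^ 2 := by
  have h1 := M.PV_sub_sq f y s a
  have h2 : M.PV (fun x => (f x - y) ^ 2) s a ≤ c ^ 2 :=
    M.PV_le_const fun x => by rw [← sq_abs]; gcongr; exact h x
  nlinarith [sq_nonneg (M.PV f s a - y)]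

lemma expSum_nonneg {π : Policy S A} {f : ℕ → S → A → ℝ} (N : ℕ)
    (hf : ∀ h ∈ Set.Icc 1 N, ∀ s a, 0 ≤ f h s a) (n h : ℕ) (s : S) (h1 : 1 ≤ h)
    (hn : h + n ≤ N + 1) : 0 ≤ M.expSum π f n h s := by
  induction n generalizing h s with
  | zero => simp [expSum]
  | succ n ih =>
    exact add_nonneg (hf h ⟨h1, by omega⟩ s _)
      (M.PV_nonneg fun x => ih (h + 1) x (by omega) (by omega))

lemma expSum_le_mul {π : Policy S A} {f : ℕ → S → A → ℝ} (N : ℕ) {c : ℝ}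
    (hf : ∀ h ∈ Set.Icc 1 N, ∀ s a, f h s a ≤ c) (n h : ℕ) (s : S) (h1 : 1 ≤ h)
    (hn : h + n ≤ N + 1) : M.expSum π f n h s ≤ n * c := by
  induction n generalizing h s with
  | zero => simp [expSum]
  | succ n ih =>
    have h2 := M.PV_le_const (s := s) (a := π h s) fun x => ih (h + 1) x (by omega) (by omega)
    have := hf h ⟨h1, by omega⟩ s (π h s)
    rw [expSum]; push_cast; linarith

lemma V_succ (π : Policy S A) {h : ℕ} (hh : h ≤ M.H) (s : S) :
    M.V π h s = M.r s (π h s) + M.PV (M.V π (h + 1)) s (π h s) := by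
  obtain ⟨n, hn⟩ : ∃ n, M.H + 1 - h = n + 1 := ⟨M.H - h, by omega⟩
  have h2 : M.H + 1 - (h + 1) = n := by omega
  unfold V
  rw [hn, expSum, h2]

lemma V_of_gt (π : Policy S A) {h : ℕ} (hh : M.H < h) (s : S) : M.V π h s = 0 := by
  have : M.H + 1 - h = 0 := by omega
  simp [V, this, expSum]

lemma W_succ (σ : ℕ → S → A → ℝ) (π : Policy S A) {h : ℕ} (hh : h ≤ M.H) (s : S) :
    M.W σ π h s = σ h s (π h s) ^ 2 / 2 + M.PV (M.W σ π (h + 1)) s (π h s) := by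
  obtain ⟨n, hn⟩ : ∃ n, M.H + 1 - h = n + 1 := ⟨M.H - h, by omega⟩
  have h2 : M.H + 1 - (h + 1) = n := by omega
  unfold W
  rw [hn, expSum, h2]

lemma W_of_gt (σ : ℕ → S → A → ℝ) (π : Policy S A) {h : ℕ} (hh : M.H < h) (s : S) :
    M.W σ π h s = 0 := by
  have : M.H + 1 - h = 0 := by omega
  simp [W, this, expSum]

lemma W_nonneg (σ : ℕ → S → A → ℝ) (π : Policy S A) {h : ℕ} (h1 : 1 ≤ h) (s : S) :
    0 ≤ M.W σ π h s := by
  rcases le_or_gt h M.H with h2 | h2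
  · exact M.expSum_nonneg M.H (fun _ _ _ _ => by positivity) _ _ _ h1 (by omega)
  · exact (M.W_of_gt σ π h2 s).ge

end Basic

/-! ### Bellman optimality by backward induction. -/

section Optimal

variable {S A : Type*} [Fintype S] [Fintype A] [Nonempty A] (M : MDP S A)

/-- The optimal value with `n` steps to go. -/
noncomputable def optV : ℕ → S → ℝ
  | 0, _ => 0
  | n + 1, s => ⨆ a : A, (M.r s a + M.PV (optV n) s a)

lemma exists_optAction (n : ℕ) (s : S) :
    ∃ a : A, ∀ b, M.r s b + M.PV (M.optV n) s b ≤ M.r s a + M.PV (M.optV n) s a :=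
  Finite.exists_max fun a => M.r s a + M.PV (M.optV n) s a

/-- An optimal policy. -/
noncomputable def optPolicy : Policy S A := fun h s => (M.exists_optAction (M.H - h) s).choose

lemma optV_succ (n : ℕ) (s : S) : ∀ h, M.H - h = n →
    M.optV (n + 1) s = M.r s (M.optPolicy h s) + M.PV (M.optV n) s (M.optPolicy h s) := by
  rintro h rfl
  have := (M.exists_optAction (M.H - h) s).choose_spec
  exact le_antisymm (ciSup_le this) (le_ciSup
    (f := fun a => M.r s a + M.PV (M.optV (M.H - h)) s a) (Set.finite_range _).bddAbove _)

lemma V_le_optV (π : Policy S A) (n : ℕ) : ∀ h s, M.H + 1 - h = n → M.V π h s ≤ M.optV n s := by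
  induction n with
  | zero => intro h s hn; rw [M.V_of_gt π (by omega)]; exact le_rfl
  | succ n ih =>
    intro h s hn
    rw [M.V_succ π (by omega)]
    exact (add_le_add_right (M.PV_mono fun x => ih (h + 1) x (by omega)) _).trans
      (le_ciSup (f := fun a => M.r s a + M.PV (M.optV n) s a) (Set.finite_range _).bddAbove (π h s))

lemma V_optPolicy (n : ℕ) : ∀ h s, M.H + 1 - h = n → M.V M.optPolicy h s = M.optV n s := by
  induction n with
  | zero => intro h s hn; rw [M.V_of_gt _ (by omega)]; rfl
  | succ n ih =>
    intro h s hn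
    rw [M.V_succ _ (by omega), M.optV_succ n s h (by omega)]
    congr 2
    exact funext fun x => ih (h + 1) x (by omega)

lemma V_le_V_optPolicy (π : Policy S A) (h : ℕ) (s : S) : M.V π h s ≤ M.V M.optPolicy h s := by
  rw [M.V_optPolicy _ h s rfl]; exact M.V_le_optV π _ h s rfl

lemma Vstar_eq (h : ℕ) : M.Vstar h = M.V M.optPolicy h := by
  ext s
  exact le_antisymm (ciSup_le fun π => M.V_le_V_optPolicy π h s)
    (le_ciSup (f := fun π => M.V π h s) ⟨_, Set.forall_mem_range.2
      fun π => M.V_le_V_optPolicy π h s⟩ M.optPolicy)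

lemma V_le_Vstar (π : Policy S A) (h : ℕ) (s : S) : M.V π h s ≤ M.Vstar h s := by
  rw [Vstar_eq]; exact M.V_le_V_optPolicy π h s

lemma Vstar_of_gt {h : ℕ} (hh : M.H < h) (s : S) : M.Vstar h s = 0 := by
  rw [Vstar_eq, V_of_gt _ _ hh]

lemma Qstar_eq (h : ℕ) (s : S) (a : A) :
    M.Qstar h s a = M.r s a + M.PV (M.Vstar (h + 1)) s a := by
  have hle : ∀ π : Policy S A, M.Q π h s a ≤ M.Q M.optPolicy h s a := fun π =>
    add_le_add_right (M.PV_mono fun x => M.V_le_V_optPolicy π (h + 1) x) _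
  rw [Vstar_eq]
  exact le_antisymm (ciSup_le hle)
    (le_ciSup (f := fun π => M.Q π h s a) ⟨_, Set.forall_mem_range.2 hle⟩ M.optPolicy)

lemma Vstar_eq_Qstar_optPolicy {h : ℕ} (hh : h ≤ M.H) (s : S) :
    M.Vstar h s = M.Qstar h s (M.optPolicy h s) := by
  rw [Qstar_eq, Vstar_eq, Vstar_eq, V_succ _ _ hh]

lemma Qstar_le_Vstar {h : ℕ} (hh : h ≤ M.H) (s : S) (a : A) : M.Qstar h s a ≤ M.Vstar h s := by
  rw [Qstar_eq, Vstar_eq, Vstar_eq, M.V_optPolicy (M.H - h + 1) h s (by omega),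
    show M.V M.optPolicy (h + 1) = M.optV (M.H - h) from
      funext fun x => M.V_optPolicy _ (h + 1) x (by omega)]
  exact le_ciSup (f := fun a => M.r s a + M.PV (M.optV (M.H - h)) s a)
    (Set.finite_range _).bddAbove a

lemma gap_nonneg {h : ℕ} (hh : h ≤ M.H) (s : S) (a : A) : 0 ≤ M.gap h s a :=
  sub_nonneg.2 (M.Qstar_le_Vstar hh s a)

/-- Iterated, this is the performance-difference identity: the regret is the expected sum of the
gaps along the policy. -/
lemma regret_succ (π : Policy S A) {h : ℕ} (hh : h ≤ M.H) (s : S) :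
    M.Vstar h s - M.V π h s = M.gap h s (π h s)
      + M.PV (fun x => M.Vstar (h + 1) x - M.V π (h + 1) x) s (π h s) := by
  rw [M.V_succ π hh, gap, Qstar_eq, PV_sub]; ring

variable {M} {Vmax : ℝ}

lemma Bounded.Vstar_nonneg (hB : M.Bounded Vmax) {h : ℕ} (h1 : 1 ≤ h) (s : S) :
    0 ≤ M.Vstar h s := by
  rcases le_or_gt h M.H with h2 | h2
  · rw [Vstar_eq]; exact (hB h ⟨h1, h2⟩ s _).1
  · exact (M.Vstar_of_gt h2 s).ge

lemma Bounded.Vstar_le (hB : M.Bounded Vmax) (hV : 0 ≤ Vmax) {h : ℕ} (h1 : 1 ≤ h) (s : S) :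
    M.Vstar h s ≤ Vmax := by
  rcases le_or_gt h M.H with h2 | h2
  · rw [Vstar_eq]; exact (hB h ⟨h1, h2⟩ s _).2
  · exact (M.Vstar_of_gt h2 s).trans_le hV

lemma Bounded.V_nonneg (hB : M.Bounded Vmax) (π : Policy S A) {h : ℕ} (h1 : 1 ≤ h) (s : S) :
    0 ≤ M.V π h s := by
  rcases le_or_gt h M.H with h2 | h2
  · exact (hB h ⟨h1, h2⟩ s _).1
  · exact (M.V_of_gt π h2 s).ge

lemma Bounded.r_nonneg (hB : M.Bounded Vmax) (hH : 1 ≤ M.H) (s : S) (a : A) : 0 ≤ M.r s a := by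
  have := (hB M.H ⟨hH, le_rfl⟩ s fun _ _ => a).1
  rw [M.V_succ _ le_rfl, show M.V (fun _ _ => a) (M.H + 1) = fun _ => 0 from
    funext fun x => M.V_of_gt _ (by omega) x, PV_zero] at this
  simpa using this

end Optimal

/-! ### Suprema of the variance proxies. -/

section VarianceProxy

variable {S A : Type*} [Fintype S] [Fintype A] (M : MDP S A) (σ : ℕ → S → A → ℝ)

lemma exists_sigma_bound : ∃ c, ∀ h ∈ Set.Icc 1 M.H, ∀ s a, σ h s a ≤ c := by
  obtain ⟨c, hc⟩ := (Set.finite_range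
    fun x : Set.Icc 1 M.H × S × A => σ x.1 x.2.1 x.2.2).bddAbove
  exact ⟨c, fun h hh s a => hc ⟨(⟨h, hh⟩, s, a), rfl⟩⟩

lemma bddAbove_W : BddAbove (Set.range fun x : Set.Icc 1 M.H × S × Policy S A =>
    M.W σ x.2.2 x.1 x.2.1) := by
  obtain ⟨c, hc⟩ := M.exists_sigma_bound fun h s a => σ h s a ^ 2 / 2
  refine ⟨M.H * |c|, Set.forall_mem_range.2 fun ⟨⟨h, h1, h2⟩, s, π⟩ => ?_⟩
  have hn : h + (M.H + 1 - h) ≤ M.H + 1 := by omega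
  have hn' : M.H + 1 - h ≤ M.H := by omega
  refine (M.expSum_le_mul M.H (c := |c|) (fun h hh s a => (hc h hh s a).trans (le_abs_self c))
    _ _ _ h1 hn).trans ?_
  gcongr

lemma W_le_Wstar (π : Policy S A) {h : ℕ} (h1 : 1 ≤ h) (s : S) (hH : 1 ≤ M.H) :
    M.W σ π h s ≤ M.Wstar σ := by
  have key : ∀ h, 1 ≤ h → h ≤ M.H → M.W σ π h s ≤ M.Wstar σ := fun h h1 h2 =>
    le_ciSup (f := fun x : Set.Icc 1 M.H × S × Policy S A => M.W σ x.2.2 x.1 x.2.1)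
      (M.bddAbove_W σ) (⟨h, h1, h2⟩, s, π)
  rcases le_or_gt h M.H with h2 | h2
  · exact key h h1 h2
  · rw [M.W_of_gt σ π h2]
    exact (M.W_nonneg σ π le_rfl s).trans (key 1 le_rfl hH)

lemma Wstar_nonneg [Nonempty S] [Nonempty A] (hH : 1 ≤ M.H) : 0 ≤ M.Wstar σ :=
  (M.W_nonneg σ (fun _ _ => Classical.arbitrary A) le_rfl (Classical.arbitrary S)).trans
    (M.W_le_Wstar σ _ le_rfl _ hH)

lemma W_sub_iInf_le_Wdiff (π : Policy S A) {h : ℕ} (h1 : 1 ≤ h) (h2 : h ≤ M.H) (s : S) :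
    M.W σ π h s - ⨅ s', M.W σ π h s' ≤ M.Wdiff σ := by
  refine le_ciSup (f := fun x : Set.Icc 1 M.H × S × Policy S A =>
    M.W σ x.2.2 x.1 x.2.1 - ⨅ s' : S, M.W σ x.2.2 x.1 s') ?_ (⟨h, h1, h2⟩, s, π)
  obtain ⟨c, hc⟩ := M.bddAbove_W σ
  refine ⟨c, Set.forall_mem_range.2 fun x => ?_⟩
  have : 0 ≤ ⨅ s' : S, M.W σ x.2.2 x.1 s' := Real.iInf_nonneg fun s' => M.W_nonneg σ _ x.1.2.1 s'
  linarith [hc ⟨x, rfl⟩]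

lemma iInf_W_le (π : Policy S A) (h : ℕ) (s : S) : ⨅ s', M.W σ π h s' ≤ M.W σ π h s :=
  ciInf_le (Set.finite_range _).bddBelow s

lemma Wdiff_nonneg [Nonempty S] [Nonempty A] (hH : 1 ≤ M.H) : 0 ≤ M.Wdiff σ :=
  (sub_nonneg.2 (M.iInf_W_le σ (fun _ _ => Classical.arbitrary A) 1 (Classical.arbitrary S))).trans
    (M.W_sub_iInf_le_Wdiff σ _ le_rfl hH _)

lemma Wdiff_le_Wstar [Nonempty S] [Nonempty A] (hH : 1 ≤ M.H) : M.Wdiff σ ≤ M.Wstar σ := by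
  have : Nonempty (Set.Icc 1 M.H) := ⟨⟨1, le_rfl, hH⟩⟩
  refine ciSup_le fun x => ?_
  have : 0 ≤ ⨅ s' : S, M.W σ x.2.2 x.1 s' := Real.iInf_nonneg fun s' => M.W_nonneg σ _ x.1.2.1 s'
  linarith [M.W_le_Wstar σ x.2.2 x.1.2.1 x.2.1 hH]

lemma two_sigma_le_sigmaMax {Vα Vmax : ℝ} {h : ℕ} (hh : h ∈ Set.Icc 1 M.H) (s : S) (a : A) :
    2 * σ h s a ≤ M.sigmaMax σ Vα Vmax :=
  (le_ciSup (f := fun x : Set.Icc 1 M.H × S × A => 2 * σ x.1 x.2.1 x.2.2)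
    (Set.finite_range _).bddAbove (⟨h, hh⟩, s, a)).trans (le_max_left _ _)

lemma sigma_sq_le {Vα Vmax : ℝ} (hσ : ∀ h ∈ Set.Icc 1 M.H, ∀ s a, 0 ≤ σ h s a)
    (hm : M.sigmaMax σ Vα Vmax ^ 2 ≤ 2 * Vmax ^ 2) {h : ℕ} (hh : h ∈ Set.Icc 1 M.H) (s : S)
    (a : A) : σ h s a ^ 2 ≤ Vmax ^ 2 / 2 := by
  have h1 := M.two_sigma_le_sigmaMax σ (Vα := Vα) (Vmax := Vmax) hh s a
  have h2 := hσ h hh s a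
  nlinarith

/-- The second entry of `sigmaMax` gives 2 Vα Vmax ≤ 2 Vmax². -/
lemma alpha_le {Vα Vmax : ℝ} (hV : 0 < Vmax) (hα : 0 ≤ Vα)
    (hm : M.sigmaMax σ Vα Vmax ^ 2 ≤ 2 * Vmax ^ 2) : Vα ≤ Vmax := by
  have h1 : √(2 * Vα * Vmax) ≤ M.sigmaMax σ Vα Vmax := le_max_right _ _
  have h2 : √(2 * Vα * Vmax) ^ 2 = 2 * Vα * Vmax := Real.sq_sqrt (by positivity)
  have h3 : √(2 * Vα * Vmax) ^ 2 ≤ M.sigmaMax σ Vα Vmax ^ 2 := by gcongr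
  by_contra! h4
  nlinarith [mul_lt_mul_of_pos_right h4 hV]

end VarianceProxy

end MDP
end EQO

namespace EQO

/-! ### Conditional exponential bounds and a maximal inequality. -/

section Maximal

open scoped ENNReal

variable {Ω : Type*} {m m₀ : MeasurableSpace Ω} {μ : Measure Ω}

/-- If `f` has smaller integrals than `g` over the sets of a sub-σ-algebra, then so it has against
all non-negative functions that are measurable with respect to the sub-σ-algebra. -/
lemma lintegral_mul_le_of_setLIntegral_le (hm : m ≤ m₀) {f g : Ω → ℝ≥0∞}
    (hf : Measurable f) (hg : Measurable g)
    (h : ∀ s, MeasurableSet[m] s → ∫⁻ ω in s, f ω ∂μ ≤ ∫⁻ ω in s, g ω ∂μ)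
    {Z : Ω → ℝ≥0∞} (hZ : Measurable[m] Z) : ∫⁻ ω, f ω * Z ω ∂μ ≤ ∫⁻ ω, g ω * Z ω ∂μ := by
  -- The hypothesis is an inequality between two measures on `m`; integrating an `m`-measurable
  -- function against both is then all that is needed.
  have h1 : (μ.withDensity f).trim hm ≤ (μ.withDensity g).trim hm := by
    refine Measure.le_iff.2 fun s hs => ?_
    rw [trim_measurableSet_eq hm hs, trim_measurableSet_eq hm hs,
      withDensity_apply _ (hm s hs), withDensity_apply _ (hm s hs)]
    exact h s hs
  have h2 := lintegral_mono' h1 (le_refl Z)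
  rw [lintegral_trim hm hZ, lintegral_trim hm hZ,
    lintegral_withDensity_eq_lintegral_mul _ hf (hZ.mono hm le_rfl),
    lintegral_withDensity_eq_lintegral_mul _ hg (hZ.mono hm le_rfl)] at h2
  exact h2

/-- `exp G` has conditional expectation at most `1` given `m`. -/
def ExpLE (μ : Measure Ω) (m : MeasurableSpace Ω) (G : Ω → ℝ) : Prop :=
  ∀ s, MeasurableSet[m] s → ∫⁻ ω in s, ENNReal.ofReal (Real.exp (G ω)) ∂μ ≤ μ s

lemma ExpLE.lintegral_mul_le (hm : m ≤ m₀) {G : Ω → ℝ} (hG : Measurable G)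
    (h : ExpLE μ m G) {Z : Ω → ℝ≥0∞} (hZ : Measurable[m] Z) :
    ∫⁻ ω, ENNReal.ofReal (Real.exp (G ω)) * Z ω ∂μ ≤ ∫⁻ ω, Z ω ∂μ := by
  have := lintegral_mul_le_of_setLIntegral_le (μ := μ) hm (g := fun _ => 1)
    hG.exp.ennreal_ofReal measurable_const (fun s hs => by simpa using h s hs) hZ
  simpa using this

/-- Convexity of exp combines two exponents whose joint law is unknown; it replaces independence at
the price of larger constants. -/
lemma ExpLE.convex_comb {G₁ G₂ : Ω → ℝ} (hm₁ : Measurable G₁)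
    (h₁ : ExpLE μ m G₁) (h₂ : ExpLE μ m G₂) {a b : ℝ} (ha : 0 ≤ a) (hb : 0 ≤ b) (hab : a + b = 1) :
    ExpLE μ m (fun ω => a * G₁ ω + b * G₂ ω) := by
  intro s hs
  calc ∫⁻ ω in s, ENNReal.ofReal (Real.exp (a * G₁ ω + b * G₂ ω)) ∂μ
      ≤ ∫⁻ ω in s, (ENNReal.ofReal a * ENNReal.ofReal (Real.exp (G₁ ω))
          + ENNReal.ofReal b * ENNReal.ofReal (Real.exp (G₂ ω))) ∂μ := by
        refine lintegral_mono fun ω => ?_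
        rw [← ENNReal.ofReal_mul ha, ← ENNReal.ofReal_mul hb,
          ← ENNReal.ofReal_add (by positivity) (by positivity)]
        exact ENNReal.ofReal_le_ofReal
          (convexOn_exp.2 (Set.mem_univ _) (Set.mem_univ _) ha hb hab)
    _ ≤ ENNReal.ofReal a * μ s + ENNReal.ofReal b * μ s := by
        rw [lintegral_add_left (hm₁.exp.ennreal_ofReal.const_mul _),
          lintegral_const_mul' _ _ ENNReal.ofReal_ne_top,
          lintegral_const_mul' _ _ ENNReal.ofReal_ne_top]
        gcongr
        · exact h₁ s hs
        · exact h₂ s hs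
    _ = μ s := by rw [← add_mul, ← ENNReal.ofReal_add ha hb, hab]; simp

lemma ExpLE.ite (hm : m ≤ m₀) {G : Ω → ℝ} {p : Ω → Prop}
    [DecidablePred p] (hp : MeasurableSet[m] {ω | p ω})
    (h : ∀ s, MeasurableSet[m] s → (∀ ω ∈ s, p ω) →
      ∫⁻ ω in s, ENNReal.ofReal (Real.exp (G ω)) ∂μ ≤ μ s) :
    ExpLE μ m (fun ω => if p ω then G ω else 0) := by
  intro s hs
  rw [← lintegral_inter_add_sdiff _ s (hm _ hp), ← measure_inter_add_sdiff s (hm _ hp)]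
  refine add_le_add ?_ ?_
  · refine le_trans (le_of_eq ?_) (h (s ∩ {ω | p ω}) (hs.inter hp) fun ω hω => hω.2)
    refine setLIntegral_congr_fun (hm _ (hs.inter hp)) fun ω hω => ?_
    have : p ω := hω.2
    simp [this]
  · refine le_of_eq ?_
    rw [setLIntegral_congr_fun (g := fun _ => 1) (hm _ (hs.diff hp)) fun ω hω => ?_]
    · simp
    · have : ¬ p ω := hω.2
      simp [this]

open Classical in
/-- Maximal inequality for the partial sums of a sequence of exponents `G` such that `exp (G t)` has
conditional expectation at most `1` given the σ-algebra `m t` of the time before. -/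
lemma measure_exists_sum_ge_le [IsProbabilityMeasure μ] {m : ℕ → MeasurableSpace Ω}
    (hm : ∀ t, m t ≤ m₀) {G : ℕ → Ω → ℝ} (hG₀ : ∀ t, Measurable (G t))
    (hG : ∀ t j, j < t → Measurable[m t] (G j)) (hexp : ∀ t, ExpLE μ (m t) (G t)) (T : ℕ) (L : ℝ) :
    μ {ω | ∃ t ≤ T, L ≤ ∑ j ∈ Finset.range t, G j ω} ≤ ENNReal.ofReal (Real.exp (-L)) := by
  -- The increments are set to zero from the first crossing of `L` on. Sums over `range t'` with `t'
  -- ≤ t` use only increments before `t`, so `p t` is known at time `t`.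
  let p : ℕ → Ω → Prop := fun t ω => ∀ t' ≤ t, ∑ j ∈ Finset.range t', G j ω < L
  let G' : ℕ → Ω → ℝ := fun t ω => if p t ω then G t ω else 0
  have hpm : ∀ t n, t ≤ n → MeasurableSet[m n] {ω | p t ω} := by
    intro t n htn
    have : {ω | p t ω} = ⋂ t' ∈ Set.Iic t, {ω | ∑ j ∈ Finset.range t', G j ω < L} := by
      ext ω; simp [p]
    rw [this]
    refine MeasurableSet.biInter (Set.to_countable _) fun t' ht' => ?_
    refine measurableSet_lt (Finset.measurable_sum _ fun j hj => hG n j ?_) measurable_const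
    have := Finset.mem_range.1 hj
    have : t' ≤ t := ht'
    omega
  have hG'm : ∀ n t, t < n → Measurable[m n] (G' t) := fun n t h =>
    Measurable.ite (hpm t n h.le) (hG n t h) measurable_const
  have hG'₀ : ∀ t, Measurable (G' t) := fun t =>
    Measurable.ite (hm t _ (hpm t t le_rfl)) (hG₀ t) measurable_const
  have hG'exp : ∀ t, ExpLE μ (m t) (G' t) := fun t =>
    ExpLE.ite (hm t) (hpm t t le_rfl) fun s hs _ => hexp t s hs
  -- The supermartingale property, in lower integrals, so that no integrability of the products is
  -- required.
  have hInt : ∀ t, ∫⁻ ω, ENNReal.ofReal (Real.exp (∑ j ∈ Finset.range t, G' j ω)) ∂μ ≤ 1 := by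
    intro t
    induction t with
    | zero => simp
    | succ t ih =>
      refine le_trans (le_of_eq ?_) (((hG'exp t).lintegral_mul_le (hm t) (hG'₀ t)
        (Z := fun ω => ENNReal.ofReal (Real.exp (∑ j ∈ Finset.range t, G' j ω))) ?_).trans ih)
      · refine lintegral_congr fun ω => ?_
        rw [Finset.sum_range_succ, add_comm, Real.exp_add, ENNReal.ofReal_mul (Real.exp_nonneg _)]
      · exact ((Finset.measurable_sum _ fun j hj =>
          hG'm t j (Finset.mem_range.1 hj)).exp).ennreal_ofReal
  have hsub : {ω | ∃ t ≤ T, L ≤ ∑ j ∈ Finset.range t, G j ω} ⊆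
      {ω | ENNReal.ofReal (Real.exp L) ≤
        ENNReal.ofReal (Real.exp (∑ j ∈ Finset.range T, G' j ω))} := by
    rintro ω ⟨t, htT, ht⟩
    refine ENNReal.ofReal_le_ofReal (Real.exp_le_exp.2 ?_)
    have hex : ∃ t, L ≤ ∑ j ∈ Finset.range t, G j ω := ⟨t, ht⟩
    -- At the first crossing `n` the stopped sum freezes, so its terminal value is still at least
    -- `L` and Markov's inequality at time `T` suffices.
    set n := Nat.find hex with hn
    have h1 : L ≤ ∑ j ∈ Finset.range n, G j ω := Nat.find_spec hex
    have h2 : ∀ t' < n, ∑ j ∈ Finset.range t', G j ω < L := fun t' h => not_le.1 (Nat.find_min hex h)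
    have hnT : n ≤ T := (Nat.find_min' hex ht).trans htT
    have h3 : ∑ j ∈ Finset.range T, G' j ω = ∑ j ∈ Finset.range n, G j ω := by
      rw [← Finset.sum_subset (Finset.range_mono hnT)]
      · refine Finset.sum_congr rfl fun j hj => if_pos fun t' ht' => h2 t' ?_
        have := Finset.mem_range.1 hj
        omega
      · intro j _ hj
        refine if_neg fun hp => not_lt.2 h1 (hp n ?_)
        simpa using hj
    rw [h3]; exact h1
  have hmk := mul_meas_ge_le_lintegral (μ := μ) (((Finset.measurable_sum (Finset.range T)
    fun j _ => hG'₀ j).exp).ennreal_ofReal) (ENNReal.ofReal (Real.exp L))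
  calc μ _ ≤ μ {ω | ENNReal.ofReal (Real.exp L) ≤
        ENNReal.ofReal (Real.exp (∑ j ∈ Finset.range T, G' j ω))} := measure_mono hsub
    _ = ENNReal.ofReal (Real.exp (-L)) * (ENNReal.ofReal (Real.exp L) *
        μ {ω | ENNReal.ofReal (Real.exp L) ≤
        ENNReal.ofReal (Real.exp (∑ j ∈ Finset.range T, G' j ω))}) := by
        rw [← mul_assoc, ← ENNReal.ofReal_mul (Real.exp_nonneg _), ← Real.exp_add]; simp
    _ ≤ ENNReal.ofReal (Real.exp (-L)) * 1 := by
        gcongr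
        refine le_trans ?_ (hInt T)
        simpa using hmk
    _ = _ := mul_one _

end Maximal

end EQO

namespace EQO

/-! ### Discrete random variables, an exponential bound and flattened time. -/

section Discrete

variable {Ω X β : Type*} {m : MeasurableSpace Ω}

lemma measurableSet_fiber {f : Ω → X} (h : Measurable[m, ⊤] f) (x : X) :
    MeasurableSet[m] {ω | f ω = x} := h (MeasurableSpace.measurableSet_top (s := {x}))

lemma measurable_top_comp [MeasurableSpace β] {f : Ω → X} (h : Measurable[m, ⊤] f) (g : X → β) :
    Measurable[m] fun ω => g (f ω) := fun B _ =>
  h (MeasurableSpace.measurableSet_top (s := g ⁻¹' B))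

/-- A countable index splits the preimage into countably many pieces on which `f` is constant; this
makes evaluation at a random state or action measurable. -/
lemma measurable_eval_discrete [Countable X] [mβ : MeasurableSpace β] {f : Ω → X}
    (h : Measurable[m, ⊤] f) {F : Ω → X → β} (hF : ∀ x, Measurable[m] fun ω => F ω x) :
    Measurable[m] fun ω => F ω (f ω) := by
  intro B hB
  have : (fun ω => F ω (f ω)) ⁻¹' B = ⋃ x, ({ω | f ω = x} ∩ (fun ω => F ω x) ⁻¹' B) := by
    ext ω; simp
  rw [this]
  exact MeasurableSet.iUnion fun x => (measurableSet_fiber h x).inter (hF x hB)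

end Discrete

lemma exp_le_one_add_sq {y : ℝ} (hy : |y| ≤ 1) : Real.exp y ≤ 1 + y + y ^ 2 := by
  have := (abs_le.1 (Real.abs_exp_sub_one_sub_id_le hy)).2
  linarith

/-- Bernstein's argument: exp y ≤ 1 + y + y² on [-1, 1], so the centred exponential moment is at
most 1 + Var ≤ exp v. -/
lemma MDP.PV_exp_le_one {S A : Type*} [Fintype S] (M : MDP S A) (f : S → ℝ) (s : S) (a : A)
    {v : ℝ} (hf : ∀ x, |f x - M.PV f s a| ≤ 1) (hv : M.var f s a ≤ v) :
    M.PV (fun x => Real.exp (f x - M.PV f s a - v)) s a ≤ 1 := by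
  have h1 : M.PV (fun x => Real.exp (f x - M.PV f s a)) s a ≤ 1 + v := by
    refine (M.PV_mono fun x => exp_le_one_add_sq (hf x)).trans ?_
    rw [M.PV_add (fun x => 1 + (f x - M.PV f s a)) (fun x => (f x - M.PV f s a) ^ 2),
      M.PV_add (fun _ => 1), M.PV_const, M.PV_sub f (fun _ => M.PV f s a), M.PV_const]
    rw [MDP.var] at hv
    linarith
  have h2 : (fun x => Real.exp (f x - M.PV f s a - v))
      = fun x => Real.exp (-v) * Real.exp (f x - M.PV f s a) := by
    ext x; rw [← Real.exp_add]; congr 1; ring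
  rw [h2, M.PV_const_mul]
  calc Real.exp (-v) * _ ≤ Real.exp (-v) * Real.exp v := by
        gcongr; exact h1.trans (by linarith [Real.add_one_le_exp v])
    _ = 1 := by rw [← Real.exp_add]; simp

/-- All time steps are put on one line: `t` is step `t % H + 1` of episode `t / H + 1`. A single
maximal inequality then serves all episodes. -/
lemma sum_Ico_Icc_eq_sum_range {H : ℕ} (hH : 1 ≤ H) (F : ℕ → ℕ → ℝ) (k : ℕ) :
    ∑ i ∈ Finset.Ico 1 (k + 1), ∑ h ∈ Finset.Icc 1 H, F i h
      = ∑ t ∈ Finset.range (k * H), F (t / H + 1) (t % H + 1) := by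
  induction k with
  | zero => simp
  | succ k ih =>
    rw [Finset.sum_Ico_succ_top (by omega), ih, add_mul, one_mul, Finset.sum_range_add]
    congr 1
    rw [← Finset.Ico_add_one_right_eq_Icc, Finset.sum_Ico_eq_sum_range]
    refine Finset.sum_congr (by simp) fun h hh => ?_
    have : h < H := Finset.mem_range.1 (by simpa using hh)
    rw [Nat.mul_comm k H, Nat.mul_add_div (by omega), Nat.mul_add_mod, Nat.div_eq_of_lt this,
      Nat.mod_eq_of_lt this, add_comm 1 h]

lemma div_mod_lex {H j t : ℕ} (h : j < t) :
    j / H + 1 < t / H + 1 ∨ (j / H + 1 = t / H + 1 ∧ j % H + 1 < t % H + 1) := by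
  have h1 := Nat.div_add_mod j H
  have h2 := Nat.div_add_mod t H
  rcases (Nat.div_le_div_right (c := H) h.le).lt_or_eq with h3 | h3
  · left; omega
  · right
    rw [h3] at h1
    omega

namespace Interaction

/-! ### Measurability with respect to the history. -/

section Measurability

variable {Ω S A : Type*} {I : Interaction Ω S A} {H : ℕ}

lemma sigmaSAR_le_past {i k h : ℕ} (hi : i ∈ Set.Ico 1 k) (hh : h ∈ Set.Icc 1 H) :
    I.sigmaSAR i h ≤ I.past H k :=
  (le_iSup₂_of_le h hh le_rfl).trans (le_sup_left.trans
    (le_iSup₂_of_le (f := fun i (_ : i ∈ Set.Ico 1 k) => (⨆ h ∈ Set.Icc 1 H, I.sigmaSAR i h) ⊔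
      MeasurableSpace.comap (I.state i (H + 1)) ⊤) i hi le_rfl))

lemma comap_last_le_past {i k : ℕ} (hi : i ∈ Set.Ico 1 k) :
    MeasurableSpace.comap (I.state i (H + 1)) ⊤ ≤ I.past H k :=
  le_sup_right.trans
    (le_iSup₂_of_le (f := fun i (_ : i ∈ Set.Ico 1 k) => (⨆ h ∈ Set.Icc 1 H, I.sigmaSAR i h) ⊔
      MeasurableSpace.comap (I.state i (H + 1)) ⊤) i hi le_rfl)

lemma past_le_filt (k h : ℕ) : I.past H k ≤ I.filt H k h := le_sup_left.trans le_sup_left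

lemma sigmaSAR_le_filt {k j h : ℕ} (hj : j ∈ Set.Ico 1 h) : I.sigmaSAR k j ≤ I.filt H k h :=
  (le_iSup₂_of_le (f := fun j (_ : j ∈ Set.Ico 1 h) => I.sigmaSAR k j) j hj le_rfl).trans
    (le_sup_right.trans le_sup_left)

lemma sigmaSA_le_filt (k h : ℕ) : I.sigmaSA k h ≤ I.filt H k h := le_sup_right

lemma sigmaSA_le_filt_of_lex {i j k h : ℕ} (hi : 1 ≤ i) (hj : j ∈ Set.Icc 1 H)
    (hlex : i < k ∨ (i = k ∧ j ≤ h)) : I.sigmaSA i j ≤ I.filt H k h := by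
  rcases hlex with hik | ⟨rfl, hjh⟩
  · exact le_sup_left.trans ((sigmaSAR_le_past ⟨hi, hik⟩ hj).trans (past_le_filt k h))
  · rcases hjh.lt_or_eq with hjh | rfl
    · exact le_sup_left.trans (sigmaSAR_le_filt ⟨hj.1, hjh⟩)
    · exact sigmaSA_le_filt i j

lemma measurable_state_filt {i j k h : ℕ} (hi : 1 ≤ i) (hj : j ∈ Set.Icc 1 H)
    (hlex : i < k ∨ (i = k ∧ j ≤ h)) : Measurable[I.filt H k h, ⊤] (I.state i j) :=
  measurable_iff_comap_le.2 (le_sup_left.trans (sigmaSA_le_filt_of_lex hi hj hlex))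

lemma measurable_action_filt {i j k h : ℕ} (hi : 1 ≤ i) (hj : j ∈ Set.Icc 1 H)
    (hlex : i < k ∨ (i = k ∧ j ≤ h)) : Measurable[I.filt H k h, ⊤] (I.action i j) :=
  measurable_iff_comap_le.2 (le_sup_right.trans (sigmaSA_le_filt_of_lex hi hj hlex))

lemma measurable_reward_filt {i j k h : ℕ} (hi : 1 ≤ i) (hj : j ∈ Set.Icc 1 H)
    (hlex : i < k ∨ (i = k ∧ j < h)) : Measurable[I.filt H k h] (I.reward i j) := by
  refine measurable_iff_comap_le.2 (le_sup_right.trans (b := I.sigmaSAR i j) ?_)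
  rcases hlex with hik | ⟨rfl, hjh⟩
  · exact (sigmaSAR_le_past ⟨hi, hik⟩ hj).trans (past_le_filt k h)
  · exact sigmaSAR_le_filt ⟨hj.1, hjh⟩

lemma measurable_next_filt {i j k h : ℕ} (hi : 1 ≤ i) (hj : j ∈ Set.Icc 1 H) (hh : h ≤ H)
    (hlex : i < k ∨ (i = k ∧ j < h)) : Measurable[I.filt H k h, ⊤] (I.state i (j + 1)) := by
  rcases hlex with hik | ⟨rfl, hjh⟩
  · rcases hj.2.lt_or_eq with hjH | rfl
    · exact measurable_state_filt hi ⟨by omega, by omega⟩ (Or.inl hik)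
    · exact measurable_iff_comap_le.2 ((comap_last_le_past ⟨hi, hik⟩).trans (past_le_filt k h))
  · exact measurable_state_filt hi ⟨by omega, by omega⟩ (Or.inr ⟨rfl, by omega⟩)

end Measurability

/-! ### Exponential bounds for rewards and transitions. -/

section Follows

variable {Ω S A : Type*} [Fintype S] [Finite A] [mΩ : MeasurableSpace Ω] {μ : Measure Ω}
  {M : MDP S A} {I : Interaction Ω S A}

lemma Follows.measurable_action_of_past_le (hI : I.Follows μ M) {k h : ℕ} (hk : 1 ≤ k)
    (hh : h ∈ Set.Icc 1 M.H) (hp : I.past M.H k ≤ mΩ) : Measurable[_, ⊤] (I.action k h) := by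
  let _ : MeasurableSpace A := ⊤
  exact measurable_eval_discrete (hI.measurable_state k hk h ⟨hh.1, by have := hh.2; omega⟩)
    (F := fun ω s => I.policy k ω h s) fun s => (hI.measurable_policy k hk h hh s).mono hp le_rfl

/-- Strong induction is needed because actions are defined through policies: those of episode `i`
are measurable only once the past of `i` is known to be a sub-σ-algebra. -/
lemma Follows.past_le (hI : I.Follows μ M) (k : ℕ) : I.past M.H k ≤ mΩ := by
  induction k using Nat.strong_induction_on with
  | _ k ih =>
    refine iSup₂_le fun i hi => sup_le (iSup₂_le fun h hh => sup_le (sup_le ?_ ?_) ?_) ?_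
    · exact measurable_iff_comap_le.1 (hI.measurable_state i hi.1 h ⟨hh.1, by have := hh.2; omega⟩)
    · exact measurable_iff_comap_le.1 (hI.measurable_action_of_past_le hi.1 hh (ih i hi.2))
    · exact measurable_iff_comap_le.1 (hI.measurable_reward i hi.1 h hh)
    · exact measurable_iff_comap_le.1 (hI.measurable_state i hi.1 (M.H + 1) ⟨by omega, le_rfl⟩)

lemma Follows.measurable_action (hI : I.Follows μ M) {k h : ℕ} (hk : 1 ≤ k)
    (hh : h ∈ Set.Icc 1 M.H) : Measurable[_, ⊤] (I.action k h) :=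
  hI.measurable_action_of_past_le hk hh (hI.past_le k)

lemma Follows.measurable_state' (hI : I.Follows μ M) {k h : ℕ} (hk : 1 ≤ k)
    (hh : h ∈ Set.Icc 1 M.H) : Measurable[_, ⊤] (I.state k h) :=
  hI.measurable_state k hk h ⟨hh.1, by have := hh.2; omega⟩

lemma Follows.measurable_next (hI : I.Follows μ M) {k h : ℕ} (hk : 1 ≤ k)
    (hh : h ∈ Set.Icc 1 M.H) : Measurable[_, ⊤] (I.state k (h + 1)) :=
  hI.measurable_state k hk (h + 1) ⟨by omega, by have := hh.2; omega⟩

lemma Follows.filt_le (hI : I.Follows μ M) {k h : ℕ} (hk : 1 ≤ k) (hh : h ∈ Set.Icc 1 M.H) :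
    I.filt M.H k h ≤ mΩ := by
  have hSA : ∀ j ∈ Set.Icc 1 M.H, I.sigmaSA k j ≤ mΩ := fun j hj => sup_le
    (measurable_iff_comap_le.1 (hI.measurable_state' hk hj))
    (measurable_iff_comap_le.1 (hI.measurable_action hk hj))
  refine sup_le (sup_le (hI.past_le k) (iSup₂_le fun j hj => ?_)) (hSA h hh)
  have hj' : j ∈ Set.Icc 1 M.H := ⟨hj.1, by have := hj.2; have := hh.2; omega⟩
  exact sup_le (hSA j hj') (measurable_iff_comap_le.1 (hI.measurable_reward k hk j hj'))

lemma measurableSet_visit {k h : ℕ} (hk : 1 ≤ k) (hh : h ∈ Set.Icc 1 M.H) (s : S) (a : A) :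
    MeasurableSet[I.filt M.H k h] {ω | I.state k h ω = s ∧ I.action k h ω = a} :=
  (measurableSet_fiber (measurable_state_filt hk hh (Or.inr ⟨rfl, le_rfl⟩)) s).inter
    (measurableSet_fiber (measurable_action_filt hk hh (Or.inr ⟨rfl, le_rfl⟩)) a)

open Classical in
-- On the event of a visit the current pair is the constant (s, a), so the random proxy becomes a
-- number that can be subtracted in the exponent.
lemma expLE_of_subExponential [IsProbabilityMeasure μ] (hI : I.Follows μ M) {σ : ℕ → S → A → ℝ}
    {Vα : ℝ} (hS : SubExponential I μ M σ Vα) {k t h : ℕ} (hk : 1 ≤ k) (ht : t ∈ Set.Icc 1 M.H)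
    (hh : h ∈ Set.Icc 1 M.H) {lam : ℝ} (hlam : Vα * |lam| ≤ 1) (s : S) (a : A) :
    ExpLE μ (I.filt M.H k t) (fun ω => if I.state k t ω = s ∧ I.action k t ω = a then
      lam * (I.reward k t ω + M.Vstar (h + 1) (I.state k (t + 1) ω) - M.Qstar h s a)
        - lam ^ 2 * σ h s a ^ 2 / 2 else 0) := by
  have hm := hI.filt_le hk ht
  refine ExpLE.ite hm (measurableSet_visit hk ht s a) fun B hB hBv => ?_
  obtain ⟨hInt, hle⟩ := hS.2.2 k hk t ht h hh lam hlam
  set X : Ω → ℝ := fun ω => I.reward k t ω + M.Vstar (h + 1) (I.state k (t + 1) ω)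
          - M.Qstar h (I.state k t ω) (I.action k t ω) with hX
  set c := lam ^ 2 * σ h s a ^ 2 / 2 with hc
  have h1 : ∫ ω in B, Real.exp (lam * X ω) ∂μ ≤ Real.exp c * μ.real B := by
    rw [← setIntegral_condExp hm hInt hB]
    calc _ ≤ ∫ ω in B, Real.exp c ∂μ := by
          refine setIntegral_mono_on_ae integrable_condExp.integrableOn
            (integrable_const _).integrableOn (hm _ hB) ?_
          filter_upwards [hle] with ω hω hωB
          refine hω.trans (le_of_eq ?_)
          rw [(hBv ω hωB).1, (hBv ω hωB).2, hc]
          congr 1; ring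
      _ = _ := by simp [mul_comm]
  calc ∫⁻ ω in B, ENNReal.ofReal (Real.exp (lam * (I.reward k t ω
        + M.Vstar (h + 1) (I.state k (t + 1) ω) - M.Qstar h s a) - c)) ∂μ
      = ∫⁻ ω in B, ENNReal.ofReal (Real.exp (-c)) * ENNReal.ofReal (Real.exp (lam * X ω)) ∂μ := by
        refine setLIntegral_congr_fun (hm _ hB) fun ω hω => ?_
        rw [← ENNReal.ofReal_mul (Real.exp_nonneg _), ← Real.exp_add, hX]
        simp only [(hBv ω hω).1, (hBv ω hω).2]
        congr 2; ring
    _ = ENNReal.ofReal (Real.exp (-c)) * ENNReal.ofReal (∫ ω in B, Real.exp (lam * X ω) ∂μ) := by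
        rw [lintegral_const_mul' _ _ ENNReal.ofReal_ne_top,
          ofReal_integral_eq_lintegral_ofReal hInt.integrableOn
            (Filter.Eventually.of_forall fun ω => Real.exp_nonneg _)]
    _ ≤ ENNReal.ofReal (Real.exp (-c)) * ENNReal.ofReal (Real.exp c * μ.real B) := by gcongr
    _ = μ B := by
        rw [← ENNReal.ofReal_mul (Real.exp_nonneg _), ← mul_assoc, ← Real.exp_add]
        simp

lemma measurable_P {k h : ℕ} (hk : 1 ≤ k)
    (hh : h ∈ Set.Icc 1 M.H) (x : S) :
    Measurable[I.filt M.H k h] fun ω => M.P (I.state k h ω) (I.action k h ω) x := by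
  have h1 := measurable_state_filt (I := I) hk hh (k := k) (h := h) (Or.inr ⟨rfl, le_rfl⟩)
  have h2 := measurable_action_filt (I := I) hk hh (k := k) (h := h) (Or.inr ⟨rfl, le_rfl⟩)
  exact measurable_eval_discrete h1 (F := fun ω s => M.P s (I.action k h ω) x)
    fun s => measurable_top_comp h2 fun a => M.P s a x

open Classical in
-- The function `φ` may be random as long as the history determines it: summing over the finitely
-- many next states turns each indicator into its conditional probability.
lemma expLE_next [IsProbabilityMeasure μ] (hI : I.Follows μ M) {k h : ℕ} (hk : 1 ≤ k)
    (hh : h ∈ Set.Icc 1 M.H) {φ : Ω → S → ℝ} (hφ : ∀ x, Measurable[I.filt M.H k h] fun ω => φ ω x)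
    (hle : ∀ ω, M.PV (fun x => Real.exp (φ ω x)) (I.state k h ω) (I.action k h ω) ≤ 1) :
    ExpLE μ (I.filt M.H k h) (fun ω => φ ω (I.state k (h + 1) ω)) := by
  have hm := hI.filt_le hk hh
  have hnext := hI.measurable_next hk hh
  have hset : ∀ x, ∀ B, MeasurableSet[I.filt M.H k h] B →
      ∫⁻ ω in B, ENNReal.ofReal (if I.state k (h + 1) ω = x then (1 : ℝ) else 0) ∂μ ≤
      ∫⁻ ω in B, ENNReal.ofReal (M.P (I.state k h ω) (I.action k h ω) x) ∂μ := by
    intro x B hB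
    have hInt : Integrable (fun ω => if I.state k (h + 1) ω = x then (1 : ℝ) else 0) μ := by
      refine Integrable.of_bound
        (measurable_top_comp hnext fun y => if y = x then (1 : ℝ) else 0).aestronglyMeasurable 1 ?_
      refine Filter.Eventually.of_forall fun ω => ?_
      split_ifs <;> simp
    have hintP : Integrable (fun ω => M.P (I.state k h ω) (I.action k h ω) x) μ := by
      refine Integrable.of_bound ((measurable_P hk hh x).mono hm le_rfl).aestronglyMeasurable 1 ?_
      refine Filter.Eventually.of_forall fun ω => ?_
      rw [Real.norm_of_nonneg (M.P_nonneg _ _ _)]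
      exact M.P_le_one _ _ _
    rw [← ofReal_integral_eq_lintegral_ofReal hInt.integrableOn
        (Filter.Eventually.of_forall fun ω => by dsimp only; split_ifs <;> simp),
      ← ofReal_integral_eq_lintegral_ofReal hintP.integrableOn
        (Filter.Eventually.of_forall fun ω => M.P_nonneg _ _ _)]
    refine ENNReal.ofReal_le_ofReal (le_of_eq ?_)
    rw [← setIntegral_condExp hm hInt hB]
    refine setIntegral_congr_ae (hm _ hB) ?_
    filter_upwards [hI.next_state k hk h hh x] with ω hω _ using hω
  intro B hB
  let Z : S → Ω → ENNReal := fun x => B.indicator fun ω => ENNReal.ofReal (Real.exp (φ ω x))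
  have hZ : ∀ x, Measurable[I.filt M.H k h] (Z x) := fun x =>
    (hφ x).exp.ennreal_ofReal.indicator hB
  have hmi : ∀ x, Measurable fun ω =>
      ENNReal.ofReal (if I.state k (h + 1) ω = x then (1 : ℝ) else 0) := fun x =>
    (measurable_top_comp hnext fun y => if y = x then (1 : ℝ) else 0).ennreal_ofReal
  have hmP : ∀ x, Measurable fun ω =>
      ENNReal.ofReal (M.P (I.state k h ω) (I.action k h ω) x) := fun x =>
    ((measurable_P hk hh x).mono hm le_rfl).ennreal_ofReal
  calc ∫⁻ ω in B, ENNReal.ofReal (Real.exp (φ ω (I.state k (h + 1) ω))) ∂μ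
      = ∫⁻ ω, ∑ x, ENNReal.ofReal (if I.state k (h + 1) ω = x then (1 : ℝ) else 0) * Z x ω ∂μ := by
        rw [← lintegral_indicator (hm _ hB)]
        refine lintegral_congr fun ω => ?_
        rw [Finset.sum_eq_single (I.state k (h + 1) ω)]
        · simp [Z, Set.indicator]
        · intro y _ hy; simp [hy.symm]
        · simp
    _ = ∑ x, ∫⁻ ω, ENNReal.ofReal (if I.state k (h + 1) ω = x then (1 : ℝ) else 0) * Z x ω ∂μ :=
        lintegral_finsetSum _ fun x _ => (hmi x).mul ((hZ x).mono hm le_rfl)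
    _ ≤ ∑ x, ∫⁻ ω, ENNReal.ofReal (M.P (I.state k h ω) (I.action k h ω) x) * Z x ω ∂μ :=
        Finset.sum_le_sum fun x _ => lintegral_mul_le_of_setLIntegral_le hm (hmi x) (hmP x)
          (hset x) (hZ x)
    _ = ∫⁻ ω, ∑ x, ENNReal.ofReal (M.P (I.state k h ω) (I.action k h ω) x) * Z x ω ∂μ :=
        (lintegral_finsetSum _ fun x _ => (hmP x).mul ((hZ x).mono hm le_rfl)).symm
    _ ≤ ∫⁻ ω, B.indicator (fun _ => 1) ω ∂μ := by
        refine lintegral_mono fun ω => ?_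
        by_cases hω : ω ∈ B
        · simp only [Z, Set.indicator_of_mem hω]
          rw [Finset.sum_congr rfl fun x _ => (ENNReal.ofReal_mul (M.P_nonneg _ _ _)).symm,
            ← ENNReal.ofReal_sum_of_nonneg fun x _ =>
              mul_nonneg (M.P_nonneg _ _ _) (Real.exp_nonneg _)]
          exact ENNReal.ofReal_le_one.2 (hle ω)
        · simp [Z, hω]
    _ = μ B := by rw [lintegral_indicator (hm _ hB)]; simp

open Classical in
/-- The sum of `Z i h` over the visits to `(s, a)` in the episodes before `k`. -/
noncomputable def visitSum (I : Interaction Ω S A) (H k : ℕ) (ω : Ω) (s : S) (a : A)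
    (Z : ℕ → ℕ → ℝ) : ℝ :=
  ∑ i ∈ Finset.Ico 1 k, ∑ h ∈ Finset.Icc 1 H,
    if I.state i h ω = s ∧ I.action i h ω = a then Z i h else 0

lemma flat_mem {H : ℕ} (hH : 1 ≤ H) (t : ℕ) : t % H + 1 ∈ Set.Icc 1 H :=
  ⟨by omega, Nat.mod_lt t (by omega)⟩

open Classical in
-- The maximal inequality makes the bound uniform in the episode without a union bound over `k`.
lemma measure_exists_visitSum_ge_le [IsProbabilityMeasure μ] (hI : I.Follows μ M) (hH : 1 ≤ M.H)
    (s : S) (a : A) {ζ : ℝ → S → ℝ} (hζ : ∀ x, Measurable fun R => ζ R x)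
    (hexp : ∀ k, 1 ≤ k → ∀ h ∈ Set.Icc 1 M.H, ExpLE μ (I.filt M.H k h) (fun ω =>
      if I.state k h ω = s ∧ I.action k h ω = a then
        ζ (I.reward k h ω) (I.state k (h + 1) ω) else 0)) (K : ℕ) (L : ℝ) :
    μ {ω | ∃ k ∈ Set.Icc 1 K, L ≤ I.visitSum M.H k ω s a
      (fun i h => ζ (I.reward i h ω) (I.state i (h + 1) ω))} ≤ ENNReal.ofReal (Real.exp (-L)) := by
  let F : ℕ → ℕ → Ω → ℝ := fun k h ω => if I.state k h ω = s ∧ I.action k h ω = a then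
        ζ (I.reward k h ω) (I.state k (h + 1) ω) else 0
  have hlow : ∀ t, 1 ≤ t / M.H + 1 := fun t => Nat.le_add_left _ _
  refine le_trans (measure_mono ?_) (measure_exists_sum_ge_le (μ := μ)
    (m := fun t => I.filt M.H (t / M.H + 1) (t % M.H + 1))
    (fun t => hI.filt_le (hlow t) (flat_mem hH t))
    (G := fun t ω => F (t / M.H + 1) (t % M.H + 1) ω) ?_ ?_
    (fun t => hexp _ (hlow t) _ (flat_mem hH t)) (K * M.H) L)
  · rintro ω ⟨k, ⟨hk1, hkK⟩, hk⟩
    -- The visits before episode `k` are those among the first (k - 1) H flattened times.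
    refine ⟨(k - 1) * M.H, Nat.mul_le_mul_right _ (by omega), hk.trans (le_of_eq ?_)⟩
    have := sum_Ico_Icc_eq_sum_range hH (fun i h => F i h ω) (k - 1)
    rw [Nat.sub_add_cancel hk1] at this
    exact this
  · intro t
    have ht := flat_mem hH t
    refine Measurable.ite (hI.filt_le (hlow t) ht _ (measurableSet_visit (hlow t) ht s a)) ?_
      measurable_const
    exact measurable_eval_discrete (hI.measurable_next (hlow t) ht)
      (F := fun ω x => ζ (I.reward (t / M.H + 1) (t % M.H + 1) ω) x)
      fun x => (hζ x).comp (hI.measurable_reward _ (hlow t) _ ht)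
  · intro t j hjt
    have ht := flat_mem hH t
    have hj := flat_mem hH j
    have hlex := div_mod_lex (H := M.H) hjt
    have hlex' : j / M.H + 1 < t / M.H + 1 ∨
      (j / M.H + 1 = t / M.H + 1 ∧ j % M.H + 1 ≤ t % M.H + 1) := by omega
    refine Measurable.ite ?_ ?_ measurable_const
    · exact (measurableSet_fiber (measurable_state_filt (hlow j) hj hlex') s).inter
        (measurableSet_fiber (measurable_action_filt (hlow j) hj hlex') a)
    · exact measurable_eval_discrete (measurable_next_filt (hlow j) hj ht.2 hlex)
        (F := fun ω x => ζ (I.reward (j / M.H + 1) (j % M.H + 1) ω) x)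
        fun x => (hζ x).comp (measurable_reward_filt (hlow j) hj hlex)

end Follows

end Interaction

end EQO

namespace EQO

namespace Interaction

/-! ### Empirical means as sums over visits. -/

section Empirical

variable {Ω S A : Type*} [Fintype S] (I : Interaction Ω S A) (H k : ℕ) (ω : Ω) (s : S) (a : A)

lemma visitSum_add (Z₁ Z₂ : ℕ → ℕ → ℝ) : I.visitSum H k ω s a (fun i h => Z₁ i h + Z₂ i h)
    = I.visitSum H k ω s a Z₁ + I.visitSum H k ω s a Z₂ := by
  simp only [visitSum, ← Finset.sum_add_distrib]
  refine Finset.sum_congr rfl fun i _ => Finset.sum_congr rfl fun h _ => ?_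
  split_ifs <;> simp

lemma visitSum_const_mul (c : ℝ) (Z : ℕ → ℕ → ℝ) : I.visitSum H k ω s a (fun i h => c * Z i h)
    = c * I.visitSum H k ω s a Z := by
  simp only [visitSum, Finset.mul_sum]
  refine Finset.sum_congr rfl fun i _ => Finset.sum_congr rfl fun h _ => ?_
  split_ifs <;> simp

lemma visitSum_sum {ι : Type*} (J : Finset ι) (Z : ι → ℕ → ℕ → ℝ) :
    I.visitSum H k ω s a (fun i h => ∑ j ∈ J, Z j i h)
      = ∑ j ∈ J, I.visitSum H k ω s a (Z j) := by
  classical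
  induction J using Finset.induction_on with
  | empty => simp [visitSum]
  | insert j J hj ih => simp only [Finset.sum_insert hj, visitSum_add, ih]

lemma visitSum_const (c : ℝ) : I.visitSum H k ω s a (fun _ _ => c) = c * I.count H k ω s a := by
  have := I.visitSum_const_mul H k ω s a c fun _ _ => 1
  simpa [visitSum, count] using this

lemma count_nonneg : 0 ≤ I.count H k ω s a :=
  Finset.sum_nonneg fun i _ => Finset.sum_nonneg fun h _ => by split_ifs <;> simp

open Classical in
lemma count_mul_pHat (hN : 0 < I.count H k ω s a) (x : S) :
    I.count H k ω s a * I.pHat H k ω s a x = I.visitSum H k ω s a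
      (fun i h => if I.state i (h + 1) ω = x then 1 else 0) := by
  rw [pHat, mul_div_cancel₀ _ hN.ne', visitSum]
  refine Finset.sum_congr rfl fun i _ => Finset.sum_congr rfl fun h _ => ?_
  simp only [← and_assoc, ite_and]

lemma count_mul_sum_pHat (hN : 0 < I.count H k ω s a) (f : S → ℝ) :
    I.count H k ω s a * ∑ x, I.pHat H k ω s a x * f x = I.visitSum H k ω s a
      (fun i h => f (I.state i (h + 1) ω)) := by
  classical
  have h1 : (fun i h => f (I.state i (h + 1) ω))
      = fun i h => ∑ x, f x * (if I.state i (h + 1) ω = x then 1 else 0) := by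
    ext i h; simp
  rw [h1, visitSum_sum, Finset.mul_sum]
  refine Finset.sum_congr rfl fun x _ => ?_
  rw [visitSum_const_mul, ← count_mul_pHat I H k ω s a hN]; ring

lemma sum_pHat (hN : 0 < I.count H k ω s a) : ∑ x, I.pHat H k ω s a x = 1 := by
  have h1 := I.count_mul_sum_pHat H k ω s a hN fun _ => 1
  rw [visitSum_const] at h1
  simp only [mul_one, one_mul] at h1
  exact mul_left_cancel₀ hN.ne' (by rw [h1, mul_one])

lemma pHat_nonneg (x : S) : 0 ≤ I.pHat H k ω s a x :=
  div_nonneg (Finset.sum_nonneg fun i _ => Finset.sum_nonneg fun h _ => by split_ifs <;> simp)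
    (I.count_nonneg H k ω s a)

lemma count_mul_rHat (hN : 0 < I.count H k ω s a) :
    I.count H k ω s a * I.rHat H k ω s a = I.visitSum H k ω s a
      (fun i h => I.reward i h ω) := by
  rw [rHat, mul_div_cancel₀ _ hN.ne', visitSum]

/-- The sum over the visits to `(s, a)` before episode `k` of `ε (R + V_{h+1}^*(s') - Q_h^*(s, a))`
plus the deviation of `Y(s')` from its mean. -/
noncomputable def dev (M : MDP S A) (ε : ℝ) (Y : S → ℝ) (h k : ℕ) (ω : Ω) (s : S) (a : A) : ℝ :=
  I.visitSum M.H k ω s a (fun i t => ε * (I.reward i t ω + M.Vstar (h + 1) (I.state i (t + 1) ω)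
    - M.Qstar h s a) + (Y (I.state i (t + 1) ω) - M.PV Y s a))

lemma dev_eq (M : MDP S A) (ε : ℝ) (Y : S → ℝ) (h : ℕ) (hN : 0 < I.count M.H k ω s a) :
    I.dev M ε Y h k ω s a = I.count M.H k ω s a *
      (ε * (I.rHat M.H k ω s a + ∑ x, I.pHat M.H k ω s a x * M.Vstar (h + 1) x - M.Qstar h s a)
        + (∑ x, I.pHat M.H k ω s a x * Y x - M.PV Y s a)) := by
  have h1 : I.dev M ε Y h k ω s a = ε * (I.visitSum M.H k ω s a (fun i t => I.reward i t ω)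
      + I.visitSum M.H k ω s a (fun i t => M.Vstar (h + 1) (I.state i (t + 1) ω))
      + -M.Qstar h s a * I.count M.H k ω s a)
      + (I.visitSum M.H k ω s a (fun i t => Y (I.state i (t + 1) ω))
      + -M.PV Y s a * I.count M.H k ω s a) := by
    simp only [dev, sub_eq_add_neg, visitSum_add, visitSum_const_mul, visitSum_const]
  rw [h1, ← count_mul_rHat I M.H k ω s a hN, ← count_mul_sum_pHat I M.H k ω s a hN,
    ← count_mul_sum_pHat I M.H k ω s a hN]
  ring

open Classical in
/-- The deviation of the number of transitions from `(s, a)` to `x` before episode `k` from the sum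
of the transition probabilities. -/
noncomputable def pdev (M : MDP S A) (x : S) (k : ℕ) (ω : Ω) (s : S) (a : A) : ℝ :=
  I.visitSum M.H k ω s a (fun i t => (if I.state i (t + 1) ω = x then 1 else 0) - M.P s a x)

lemma pdev_eq (M : MDP S A) (x : S) (hN : 0 < I.count M.H k ω s a) :
    I.pdev M x k ω s a
      = I.count M.H k ω s a * (I.pHat M.H k ω s a x - M.P s a x) := by
  simp only [pdev, sub_eq_add_neg, visitSum_add, visitSum_const]
  rw [← count_mul_pHat I M.H k ω s a hN]; ring

/-- AM-GM with the free parameter restricted to powers of 1/2: the best scale is of the order y / V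
and may be chosen after `y` is known. This is what makes the transition bound uniform over random
functions. If `y` is below the finest scale, then y ≤ 8 V / N and the crude bound d ≤ 2 ℓ is enough.
-/
lemma mul_le_of_dyadic {V y N P ℓ d : ℝ} {n : ℕ} (hV : 0 < V) (hy0 : 0 ≤ y) (hy : y ≤ 2 * V)
    (hN1 : 1 ≤ N) (hN : N ≤ 2 ^ n) (hP0 : 0 ≤ P) (hP1 : P ≤ 1) (hℓ : 1 ≤ ℓ)
    (hd : ∀ i ≤ n, d ≤ (1 / 2) ^ i * P + 2 ^ i * ℓ / N) :
    y * d ≤ P * y ^ 2 / (8 * V) + 16 * V * ℓ / N := by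
  have hN0 : 0 < N := by linarith
  by_cases hex : (1 / 2 : ℝ) ^ n ≤ y / (8 * V)
  · have hex' : ∃ i, (1 / 2 : ℝ) ^ i ≤ y / (8 * V) := ⟨n, hex⟩
    set i := Nat.find hex' with hi
    have h1 : (1 / 2 : ℝ) ^ i ≤ y / (8 * V) := Nat.find_spec hex'
    have hin : i ≤ n := Nat.find_min' hex' hex
    -- Scale 0 is excluded since y ≤ 2 V < 8 V, so the preceding scale exists, and its failure
    -- bounds y 2^i from above.
    have hi0 : i ≠ 0 := by
      intro h0
      rw [h0, pow_zero, le_div_iff₀ (by positivity)] at h1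
      linarith
    obtain ⟨j, hj⟩ := Nat.exists_eq_succ_of_ne_zero hi0
    have h2 : y / (8 * V) < (1 / 2 : ℝ) ^ j := not_le.1 (Nat.find_min hex' (m := j) (by omega))
    have h3 : y * 2 ^ i ≤ 16 * V := by
      rw [hj, pow_succ]
      rw [one_div, inv_pow, div_lt_iff₀ (by positivity), inv_mul_eq_div, lt_div_iff₀ (by positivity)]
        at h2
      linarith
    calc y * d ≤ y * ((1 / 2) ^ i * P + 2 ^ i * ℓ / N) := by gcongr; exact hd i hin
      _ = P * (y * (1 / 2) ^ i) + (y * 2 ^ i) * ℓ / N := by ring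
      _ ≤ P * (y * (y / (8 * V))) + 16 * V * ℓ / N := by gcongr
      _ = _ := by ring
  · push Not at hex
    have h1 : y ≤ 8 * V / N := by
      rw [div_lt_iff₀ (by positivity)] at hex
      calc y ≤ (1 / 2) ^ n * (8 * V) := hex.le
        _ = 8 * V / 2 ^ n := by rw [one_div, inv_pow]; ring
        _ ≤ 8 * V / N := by gcongr
    have h2 : d ≤ 2 * ℓ := by
      have := hd 0 (Nat.zero_le _)
      simp only [pow_zero, one_mul] at this
      have h3 : ℓ / N ≤ ℓ := div_le_self (by linarith) hN1
      linarith
    calc y * d ≤ y * (2 * ℓ) := by gcongr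
      _ ≤ 8 * V / N * (2 * ℓ) := by gcongr
      _ = 16 * V * ℓ / N := by ring
      _ ≤ _ := le_add_of_nonneg_left (by positivity)

/-- If the deviations of the transition frequencies are small at all dyadic scales, then
`(P̂ - P) f` is small compared to the variance of `f`, uniformly in `f`. -/
lemma sum_pHat_sub_PV_le (M : MDP S A) {V ℓ : ℝ} {n : ℕ} (hV : 0 < V) (hℓ : 1 ≤ ℓ)
    (hN1 : 1 ≤ I.count M.H k ω s a) (hN : I.count M.H k ω s a ≤ 2 ^ n)
    (hd : ∀ x, ∀ i ≤ n, |I.pdev M x k ω s a|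
      ≤ (1 / 2) ^ i * (I.count M.H k ω s a * M.P s a x) + 2 ^ i * ℓ)
    {f : S → ℝ} (hf : ∀ x, |f x - M.PV f s a| ≤ 2 * V) :
    ∑ x, I.pHat M.H k ω s a x * f x - M.PV f s a
      ≤ M.var f s a / (8 * V) + 16 * Fintype.card S * V * ℓ / I.count M.H k ω s a := by
  have hN0 : 0 < I.count M.H k ω s a := by linarith
  set N := I.count M.H k ω s a
  -- Both kernels have mass one, so `f` may be centred; the squared weights then add up to the
  -- variance.
  have h1 : ∑ x, I.pHat M.H k ω s a x * f x - M.PV f s a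
      = ∑ x, (f x - M.PV f s a) * (I.pHat M.H k ω s a x - M.P s a x) := by
    have e1 := I.sum_pHat M.H k ω s a hN0
    have e2 := M.P_sum s a
    have : ∀ x, (f x - M.PV f s a) * (I.pHat M.H k ω s a x - M.P s a x)
        = I.pHat M.H k ω s a x * f x - M.P s a x * f x - M.PV f s a * I.pHat M.H k ω s a x
          + M.PV f s a * M.P s a x := fun x => by ring
    simp only [this, Finset.sum_add_distrib, Finset.sum_sub_distrib, ← Finset.mul_sum, e1, e2]
    rw [MDP.PV]; ring
  have h2 : ∀ x, (f x - M.PV f s a) * (I.pHat M.H k ω s a x - M.P s a x)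
      ≤ M.P s a x * (f x - M.PV f s a) ^ 2 / (8 * V) + 16 * V * ℓ / N := by
    intro x
    rw [← sq_abs (f x - _)]
    refine (le_abs_self _).trans ?_
    rw [abs_mul]
    refine mul_le_of_dyadic hV (abs_nonneg _) (hf x) hN1 hN (M.P_nonneg _ _ _) (M.P_le_one _ _ _)
      hℓ fun i hi => ?_
    have h3 := hd x i hi
    rw [pdev_eq I k ω s a M x hN0, abs_mul, abs_of_pos hN0] at h3
    rw [← mul_le_mul_iff_right₀ hN0]
    calc _ ≤ _ := h3
      _ = _ := by field_simp
  rw [h1]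
  refine (Finset.sum_le_sum fun x _ => h2 x).trans (le_of_eq ?_)
  have h4 : M.var f s a = ∑ x, M.P s a x * (f x - M.PV f s a) ^ 2 := rfl
  rw [Finset.sum_add_distrib, ← Finset.sum_div, ← h4]
  simp only [Finset.sum_const, Finset.card_univ, nsmul_eq_mul]
  ring

end Empirical

/-! ### Concentration of observations and transition frequencies. -/

section Concentration

variable {Ω S A : Type*} [Fintype S] [Finite A] [mΩ : MeasurableSpace Ω] {μ : Measure Ω}
  [IsProbabilityMeasure μ] {M : MDP S A} {I : Interaction Ω S A}

/-- The observation and Y(s') share the same next state, so they are joined by convexity with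
weights 4/5 and 1/5. The exponents become (5/4) lam and 5 lam, which gives the proxies (4/5)(5/4)²
σ² / 2 = 5/8 σ² and (1/5) 5² Var Y = 5 Var Y. -/
lemma measure_dev_le (hI : I.Follows μ M) (hH : 1 ≤ M.H) {σ : ℕ → S → A → ℝ}
    {Vα : ℝ} (hS : SubExponential I μ M σ Vα) {h : ℕ} (hh : h ∈ Set.Icc 1 M.H) {lam : ℝ}
    (hlam0 : 0 ≤ lam) (hlam : 5 / 4 * lam * Vα ≤ 1) {ε : ℝ} (hε : |ε| = 1) {Y : S → ℝ} {s : S} {a : A}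
    (hY : ∀ x, 5 * lam * |Y x - M.PV Y s a| ≤ 1) (K : ℕ) (L : ℝ) :
    μ {ω | ∃ k ∈ Set.Icc 1 K, L ≤ lam * I.dev M ε Y h k ω s a
      - lam ^ 2 * (5 / 8 * σ h s a ^ 2 + 5 * M.var Y s a) * I.count M.H k ω s a}
      ≤ ENNReal.ofReal (Real.exp (-L)) := by
  classical
  have hε2 : ε ^ 2 = 1 := by rw [← sq_abs, hε, one_pow]
  refine le_trans (measure_mono ?_) (measure_exists_visitSum_ge_le hI hH s a
    (ζ := fun R x => lam * (ε * (R + M.Vstar (h + 1) x - M.Qstar h s a) + (Y x - M.PV Y s a))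
      + -(lam ^ 2 * (5 / 8 * σ h s a ^ 2 + 5 * M.var Y s a))) (fun x => by fun_prop) ?_ K L)
  · rintro ω ⟨k, hk, hL⟩
    refine ⟨k, hk, hL.trans (le_of_eq ?_)⟩
    rw [visitSum_add, visitSum_const_mul, visitSum_const, dev]; ring
  · intro k hk t ht
    have hX := expLE_of_subExponential hI hS hk ht hh (lam := 5 / 4 * lam * ε) (by
      rw [abs_mul, hε, mul_one, abs_of_nonneg (by positivity)]; linarith) s a
    have hY' : ExpLE μ (I.filt M.H k t) (fun ω => if I.state k t ω = s ∧ I.action k t ω = a then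
        5 * lam * Y (I.state k (t + 1) ω) - M.PV (fun x => 5 * lam * Y x) s a
          - (5 * lam) ^ 2 * M.var Y s a else 0) := by
      refine expLE_next hI hk ht (φ := fun ω x => if I.state k t ω = s ∧ I.action k t ω = a then
        5 * lam * Y x - M.PV (fun x => 5 * lam * Y x) s a - (5 * lam) ^ 2 * M.var Y s a else 0)
        (fun x => Measurable.ite (measurableSet_visit hk ht s a) measurable_const measurable_const)
        fun ω => ?_
      by_cases hv : I.state k t ω = s ∧ I.action k t ω = a
      · simp only [hv, and_self, if_true]
        refine M.PV_exp_le_one _ s a (fun x => ?_) ?_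
        · rw [M.PV_const_mul, ← mul_sub, abs_mul, abs_of_nonneg (by positivity)]
          exact hY x
        · refine M.var_le_of_lipschitz (y := 5 * lam * M.PV Y s a) fun x => ?_
          rw [← mul_sub, abs_mul, abs_of_nonneg (by positivity : 0 ≤ 5 * lam)]
      · simp only [hv, if_false, Real.exp_zero, M.PV_const, le_refl]
    have hmeas : Measurable fun ω => if I.state k t ω = s ∧ I.action k t ω = a then
        5 / 4 * lam * ε * (I.reward k t ω + M.Vstar (h + 1) (I.state k (t + 1) ω) - M.Qstar h s a)
        - (5 / 4 * lam * ε) ^ 2 * σ h s a ^ 2 / 2 else 0 := by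
      refine Measurable.ite (hI.filt_le hk ht _ (measurableSet_visit hk ht s a)) ?_ measurable_const
      have h1 := hI.measurable_reward k hk t ht
      have h2 := measurable_top_comp (hI.measurable_next hk ht) (M.Vstar (h + 1))
      fun_prop
    have := ExpLE.convex_comb hmeas hX hY' (a := 4 / 5) (b := 1 / 5)
      (by norm_num) (by norm_num) (by norm_num)
    convert this using 2 with ω
    split_ifs
    · rw [M.PV_const_mul, mul_pow (5 / 4 * lam), hε2]; ring
    · ring

/-- Bernstein's bound for an indicator, whose variance is at most its mean; with lam = 2^{-i} it is
the estimate at dyadic scale i. -/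
lemma measure_pdev_le (hI : I.Follows μ M) (hH : 1 ≤ M.H) {lam : ℝ} (hlam0 : 0 ≤ lam)
    (hlam : lam ≤ 1) {ε : ℝ} (hε : |ε| = 1) (x s : S) (a : A) (K : ℕ) (L : ℝ) :
    μ {ω | ∃ k ∈ Set.Icc 1 K, L ≤ lam * (ε * I.pdev M x k ω s a)
      - lam ^ 2 * M.P s a x * I.count M.H k ω s a} ≤ ENNReal.ofReal (Real.exp (-L)) := by
  classical
  have hε2 : ε ^ 2 = 1 := by rw [← sq_abs, hε, one_pow]
  have hPV : M.PV (fun y => lam * ε * if y = x then 1 else 0) s a = lam * ε * M.P s a x := by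
    rw [M.PV_const_mul]; simp [MDP.PV]
  refine le_trans (measure_mono ?_) (measure_exists_visitSum_ge_le hI hH s a
    (ζ := fun R y => lam * ε * ((if y = x then 1 else 0) - M.P s a x) + -(lam ^ 2 * M.P s a x))
    (fun x => by fun_prop) ?_ K L)
  · rintro ω ⟨k, hk, hL⟩
    refine ⟨k, hk, hL.trans (le_of_eq ?_)⟩
    rw [visitSum_add, visitSum_const_mul, visitSum_const, pdev]; ring
  · intro k hk t ht
    refine expLE_next hI hk ht (φ := fun ω y => if I.state k t ω = s ∧ I.action k t ω = a then
      lam * ε * ((if y = x then 1 else 0) - M.P s a x) + -(lam ^ 2 * M.P s a x) else 0)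
      (fun x => Measurable.ite (measurableSet_visit hk ht s a) measurable_const measurable_const)
      fun ω => ?_
    by_cases hv : I.state k t ω = s ∧ I.action k t ω = a
    · simp only [hv, and_self, if_true]
      have := M.PV_exp_le_one (fun y => lam * ε * if y = x then 1 else 0) s a
        (v := lam ^ 2 * M.P s a x) (fun y => ?_) ?_
      · rw [hPV] at this
        convert this using 4
        ring
      · rw [hPV, ← mul_sub, abs_mul, abs_mul, hε, mul_one, abs_of_nonneg hlam0]
        have h0 := M.P_nonneg s a x
        have h1 := M.P_le_one s a x
        refine mul_le_one₀ hlam (abs_nonneg _) (abs_le.2 ⟨?_, ?_⟩) <;> split_ifs <;> linarith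
      · rw [M.var_eq, hPV]
        have : (fun y => (lam * ε * if y = x then 1 else 0) ^ 2)
            = fun y => lam ^ 2 * if y = x then 1 else 0 := by
          ext y; rw [mul_pow, mul_pow, hε2]; split_ifs <;> simp
        rw [this, M.PV_const_mul]
        simp only [MDP.PV, mul_ite, mul_one, mul_zero, Finset.sum_ite_eq', Finset.mem_univ, if_true]
        nlinarith [sq_nonneg (lam * ε * M.P s a x)]
    · simp only [hv, if_false, Real.exp_zero, M.PV_const, le_refl]

end Concentration

end Interaction

end EQO

namespace EQO

/-! ### Clipped values and a quadratic potential. -/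

section Clipped

variable {S A : Type*} [Fintype S] (M : MDP S A)

/-- The value of `π` for the costs `β`, where the value from any step on is clipped at `c`. The
arguments are the number of steps to go, the step and the state. -/
noncomputable def MDP.clipVal (π : Policy S A) (β : S → A → ℝ) (c : ℝ) : ℕ → ℕ → S → ℝ
  | 0, _, _ => 0
  | n + 1, h, s => min c (β s (π h s) + M.PV (MDP.clipVal π β c n (h + 1)) s (π h s))

variable {π : Policy S A} {β : S → A → ℝ} {c : ℝ}

lemma MDP.clipVal_le (hc : 0 ≤ c) (n h : ℕ) (s : S) : M.clipVal π β c n h s ≤ c := by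
  cases n with
  | zero => exact hc
  | succ n => exact min_le_left _ _

lemma MDP.clipVal_nonneg (hc : 0 ≤ c) (hβ : ∀ s a, 0 ≤ β s a) (n h : ℕ) (s : S) :
    0 ≤ M.clipVal π β c n h s := by
  induction n generalizing h s with
  | zero => exact le_rfl
  | succ n ih => exact le_min hc (add_nonneg (hβ _ _) (M.PV_nonneg fun x => ih _ x))

lemma MDP.PV_clipVal_le (hc : 0 ≤ c) (hβ : ∀ s a, 0 ≤ β s a) (n h : ℕ) (s : S) :
    M.PV (M.clipVal π β c n (h + 1)) s (π h s) ≤ M.clipVal π β c (n + 1) h s :=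
  le_min (M.PV_le_const fun x => M.clipVal_le hc n (h + 1) x) (le_add_of_nonneg_left (hβ _ _))

/-- The convex function `u + u² / c`. -/
noncomputable def quadPot (c u : ℝ) : ℝ := u + u ^ 2 / c

lemma le_quadPot (hc : 0 < c) (u : ℝ) : u ≤ quadPot c u :=
  le_add_of_nonneg_right (by positivity)

lemma quadPot_le (hc : 0 < c) {u : ℝ} (h0 : 0 ≤ u) (hu : u ≤ c) : quadPot c u ≤ 2 * c := by
  have : u ^ 2 / c ≤ c := by rw [div_le_iff₀ hc]; nlinarith
  rw [quadPot]; linarith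

lemma quadPot_sub (hc : 0 < c) (u v : ℝ) :
    quadPot c u - quadPot c v = (u - v) * (1 + (u + v) / c) := by
  rw [quadPot, quadPot]; field_simp; ring

lemma quadPot_le_add (hc : 0 < c) {u p b : ℝ} (hu0 : 0 ≤ u) (hu : u ≤ c) (hp0 : 0 ≤ p) (hp : p ≤ c)
    (hb : 0 ≤ b) (h : u ≤ b + p) : quadPot c u ≤ quadPot c p + 3 * b := by
  have h1 := quadPot_sub hc u p
  have h2 : (u + p) / c ≤ 2 := by rw [div_le_iff₀ hc]; linarith
  have h3 : 0 ≤ (u + p) / c := by positivity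
  rcases le_total u p with h4 | h4
  · nlinarith
  · nlinarith

/-- The square in `quadPot` makes the drift from the mean equal to -Var f / c, while `quadPot` is
3-Lipschitz on [0, c]. After division by 9 c the second moment is at most 9 Var f / (9 c)², which is
exactly compensated by the drift Var f / (9 c²). Thus no variance term survives. -/
lemma MDP.PV_exp_quadPot_le_one (hc : 0 < c) {f : S → ℝ} (hf0 : ∀ x, 0 ≤ f x) (hf : ∀ x, f x ≤ c)
    (s : S) (a : A) :
    M.PV (fun x => Real.exp ((quadPot c (M.PV f s a) - quadPot c (f x)) / (9 * c))) s a ≤ 1 := by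
  set m := M.PV f s a with hm
  have hm0 : 0 ≤ m := M.PV_nonneg hf0
  have hmc : m ≤ c := M.PV_le_const hf
  have hq : ∀ x, |quadPot c m - quadPot c (f x)| ≤ 3 * |f x - m| := by
    intro x
    rw [quadPot_sub hc, abs_mul, mul_comm, abs_sub_comm m]
    have h1 : (m + f x) / c ≤ 2 := by rw [div_le_iff₀ hc]; linarith [hf x]
    have h2 : 0 ≤ (m + f x) / c := div_nonneg (add_nonneg hm0 (hf0 x)) hc.le
    gcongr
    rw [abs_le]; constructor <;> linarith
  have hd : ∀ x, |f x - m| ≤ c := fun x => abs_le.2 ⟨by linarith [hf0 x], by linarith [hf x]⟩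
  have hb : ∀ x, |(quadPot c m - quadPot c (f x)) / (9 * c)| ≤ 1 := by
    intro x
    rw [abs_div, abs_of_pos (by positivity : 0 < 9 * c), div_le_one (by positivity)]
    linarith [hq x, hd x]
  have hsq : ∀ x, ((quadPot c m - quadPot c (f x)) / (9 * c)) ^ 2
      ≤ 1 / (9 * c ^ 2) * (f x - m) ^ 2 := by
    intro x
    have : (quadPot c m - quadPot c (f x)) ^ 2 ≤ 9 * (f x - m) ^ 2 := by
      rw [← sq_abs, ← sq_abs (f x - m)]
      nlinarith [hq x, abs_nonneg (quadPot c m - quadPot c (f x)), abs_nonneg (f x - m)]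
    rw [div_pow, div_le_iff₀ (by positivity)]
    calc _ ≤ _ := this
      _ = _ := by field_simp
  have hmean : M.PV (fun x => (quadPot c m - quadPot c (f x)) / (9 * c)) s a
      = - (1 / (9 * c ^ 2) * M.var f s a) := by
    have h1 : (fun x => (quadPot c m - quadPot c (f x)) / (9 * c))
        = fun x => quadPot c m / (9 * c) - (1 / (9 * c) * f x + 1 / (9 * c ^ 2) * f x ^ 2) := by
      ext x; simp only [quadPot]; field_simp
    rw [h1, M.PV_sub (fun _ => quadPot c m / (9 * c)), M.PV_const,
      M.PV_add (fun x => 1 / (9 * c) * f x), M.PV_const_mul, M.PV_const_mul, M.var_eq, ← hm, quadPot]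
    field_simp; ring
  calc M.PV (fun x => Real.exp ((quadPot c m - quadPot c (f x)) / (9 * c))) s a
      ≤ M.PV (fun x => (1 + (quadPot c m - quadPot c (f x)) / (9 * c))
          + 1 / (9 * c ^ 2) * (f x - m) ^ 2) s a :=
        M.PV_mono fun x => (exp_le_one_add_sq (hb x)).trans (by linarith [hsq x])
    _ = 1 := by
        rw [M.PV_add (fun x => 1 + (quadPot c m - quadPot c (f x)) / (9 * c)),
          M.PV_add (fun _ => 1), M.PV_const, hmean, M.PV_const_mul, hm, ← MDP.var]
        ring

open Classical in
-- The potential is telescoped along the trajectory as long as `χ` holds. A cost `b` raises it by at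
-- most 3 b, its slope being at most 3; if `χ` fails, the remaining potential is replaced by its
-- maximum 2 c.
lemma quadPot_telescope (hc : 0 < c) {u p b : ℕ → ℝ} {χ : ℕ → Prop} {H : ℕ}
    (hu0 : ∀ j, 0 ≤ u j) (hu : ∀ j, u j ≤ c) (hp0 : ∀ j, 0 ≤ p j) (hp : ∀ j, p j ≤ c)
    (hb : ∀ j, 0 ≤ b j) (hup : ∀ j < H, u j ≤ b j + p j) (huH : u H = 0)
    (hχ : ∀ i j, i ≤ j → χ j → χ i) :
    u 0 ≤ ∑ j ∈ Finset.range H, (if χ j then quadPot c (p j) - quadPot c (u (j + 1)) else 0)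
      + 3 * ∑ j ∈ Finset.range H, (if χ j then b j else 0)
      + 2 * c * (if ∀ j < H, χ j then 0 else 1) := by
  have key : ∀ n ≤ H, quadPot c (u 0)
      ≤ ∑ j ∈ Finset.range n, (if χ j then quadPot c (p j) - quadPot c (u (j + 1)) else 0)
      + 3 * ∑ j ∈ Finset.range n, (if χ j then b j else 0)
      + (if ∀ j < n, χ j then quadPot c (u n) else 2 * c) := by
    intro n hn
    induction n with
    | zero => simp
    | succ n ih =>
      refine (ih (by omega)).trans ?_
      rw [Finset.sum_range_succ, Finset.sum_range_succ]
      by_cases h1 : ∀ j < n + 1, χ j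
      · have h2 : ∀ j < n, χ j := fun j hj => h1 j (by omega)
        rw [if_pos h1, if_pos h2, if_pos (h1 n (by omega)), if_pos (h1 n (by omega))]
        linarith [quadPot_le_add hc (hu0 n) (hu n) (hp0 n) (hp n) (hb n) (hup n (by omega))]
      · have h2 : ¬ χ n := fun h => h1 fun j hj => hχ j n (by omega) h
        rw [if_neg h1, if_neg h2, if_neg h2]
        have : (if ∀ j < n, χ j then quadPot c (u n) else 2 * c) ≤ 2 * c := by
          split_ifs
          · exact quadPot_le hc (hu0 n) (hu n)
          · exact le_rfl
        linarith
  refine (le_quadPot hc _).trans ((key H le_rfl).trans (le_of_eq ?_))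
  rw [huH]
  split_ifs <;> simp [quadPot]

end Clipped

namespace Interaction

/-! ### Visit counts and doublings. -/

section Count

variable {Ω S A : Type*} (I : Interaction Ω S A) (H : ℕ)

open Classical in
/-- The number of visits to `(s, a)` in the first `t` time steps, over all episodes. -/
noncomputable def cnt (t : ℕ) (ω : Ω) (s : S) (a : A) : ℕ :=
  ∑ j ∈ Finset.range t, if I.state (j / H + 1) (j % H + 1) ω = s ∧
    I.action (j / H + 1) (j % H + 1) ω = a then 1 else 0

lemma count_eq_cnt (hH : 1 ≤ H) (k : ℕ) (ω : Ω) (s : S) (a : A) :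
    I.count H (k + 1) ω s a = I.cnt H (k * H) ω s a := by
  rw [count, sum_Ico_Icc_eq_sum_range hH, cnt]
  push_cast
  rfl

lemma cnt_mono {t t' : ℕ} (h : t ≤ t') (ω : Ω) (s : S) (a : A) :
    I.cnt H t ω s a ≤ I.cnt H t' ω s a :=
  Finset.sum_le_sum_of_subset (Finset.range_mono h)

lemma cnt_le (t : ℕ) (ω : Ω) (s : S) (a : A) : I.cnt H t ω s a ≤ t := by
  refine (Finset.sum_le_card_nsmul _ _ 1 fun j _ => ?_).trans (by simp)
  split_ifs <;> simp

lemma count_le (hH : 1 ≤ H) (k : ℕ) (ω : Ω) (s : S) (a : A) :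
    I.count H (k + 1) ω s a ≤ k * H := by
  rw [count_eq_cnt I H hH]; exact_mod_cast I.cnt_le H _ ω s a

lemma one_le_count (hH : 1 ≤ H) {k : ℕ} (hk : 1 ≤ k) {ω : Ω} {s : S} {a : A}
    (h : 0 < I.count H k ω s a) : 1 ≤ I.count H k ω s a := by
  obtain ⟨k, rfl⟩ := Nat.exists_eq_add_of_le' hk
  rw [count_eq_cnt I H hH] at h ⊢
  exact_mod_cast h

open Classical in
lemma cnt_succ (t : ℕ) (ω : Ω) (s : S) (a : A) :
    I.cnt H (t + 1) ω s a = I.cnt H t ω s a + if I.state (t / H + 1) (t % H + 1) ω = s ∧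
      I.action (t / H + 1) (t % H + 1) ω = a then 1 else 0 := by
  rw [cnt, Finset.sum_range_succ, cnt]

/-- Successive visits to a pair see the counts 0, 1, 2, …, once each. -/
lemma sum_visits_eq [Fintype S] [Fintype A] (ψ : S → A → ℕ → ℝ) (T : ℕ) (ω : Ω) :
    ∑ t ∈ Finset.range T, ψ (I.state (t / H + 1) (t % H + 1) ω)
      (I.action (t / H + 1) (t % H + 1) ω) (I.cnt H t ω (I.state (t / H + 1) (t % H + 1) ω)
      (I.action (t / H + 1) (t % H + 1) ω))
      = ∑ s, ∑ a, ∑ n ∈ Finset.range (I.cnt H T ω s a), ψ s a n := by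
  classical
  induction T with
  | zero => simp [cnt]
  | succ T ih =>
    rw [Finset.sum_range_succ, ih]
    set s₀ := I.state (T / H + 1) (T % H + 1) ω with hs
    set a₀ := I.action (T / H + 1) (T % H + 1) ω with ha
    have h1 : ∀ s a, ∑ n ∈ Finset.range (I.cnt H (T + 1) ω s a), ψ s a n
        = ∑ n ∈ Finset.range (I.cnt H T ω s a), ψ s a n
          + if s₀ = s then (if a₀ = a then ψ s a (I.cnt H T ω s a) else 0) else 0 := by
      intro s a
      rw [cnt_succ, ← hs, ← ha]
      by_cases h1 : s₀ = s <;> by_cases h2 : a₀ = a <;> simp [h1, h2, Finset.sum_range_succ]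
    simp only [h1, Finset.sum_add_distrib]
    congr 1
    rw [Finset.sum_eq_single s₀ (fun s _ hs' => by simp [hs'.symm]) (by simp)]
    simp

/-- The count of the current pair has at most doubled since the start of the episode. -/
def NoDouble (t : ℕ) (ω : Ω) : Prop :=
  I.cnt H t ω (I.state (t / H + 1) (t % H + 1) ω) (I.action (t / H + 1) (t % H + 1) ω) + 1
    ≤ 2 * I.cnt H (t / H * H) ω (I.state (t / H + 1) (t % H + 1) ω)
      (I.action (t / H + 1) (t % H + 1) ω)

/-- There has been no doubling of a count in the current episode. -/
def NoDoubleYet (t : ℕ) (ω : Ω) : Prop := ∀ j ≤ t, t / H * H ≤ j → I.NoDouble H j ω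

open Classical in
-- The sum of log (count + 1) over the pairs never decreases and grows by at least log 2 in every
-- episode with a doubling.
lemma sum_double_le [Fintype S] [Fintype A] (hH : 1 ≤ H) (K : ℕ) (ω : Ω) :
    (∑ e ∈ Finset.range K, if ∀ j < H, I.NoDouble H (e * H + j) ω then (0 : ℝ) else 1) * Real.log 2
      ≤ ∑ s, ∑ a, Real.log (I.cnt H (K * H) ω s a + 1) := by
  induction K with
  | zero => simp [cnt]
  | succ K ih =>
    rw [Finset.sum_range_succ, add_mul]
    have hmono : ∀ s a, Real.log (I.cnt H (K * H) ω s a + 1)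
        ≤ Real.log (I.cnt H ((K + 1) * H) ω s a + 1) := fun s a => by
      gcongr; exact I.cnt_mono H (Nat.mul_le_mul_right _ (by omega)) ω s a
    split_ifs with h
    · simp only [zero_mul, add_zero]
      exact ih.trans (Finset.sum_le_sum fun s _ => Finset.sum_le_sum fun a _ => hmono s a)
    · push Not at h
      obtain ⟨j, hj, hd⟩ := h
      have hdiv : (K * H + j) / H = K := by
        rw [Nat.mul_comm, Nat.mul_add_div (by omega), Nat.div_eq_of_lt hj, add_zero]
      rw [NoDouble, hdiv, not_le] at hd
      set t := K * H + j with ht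
      set s₀ := I.state (K + 1) (t % H + 1) ω with hs
      set a₀ := I.action (K + 1) (t % H + 1) ω with ha
      have h1 : I.cnt H (t + 1) ω s₀ a₀ = I.cnt H t ω s₀ a₀ + 1 := by
        rw [cnt_succ, hdiv, if_pos ⟨rfl, rfl⟩]
      have h2 : I.cnt H (t + 1) ω s₀ a₀ ≤ I.cnt H ((K + 1) * H) ω s₀ a₀ :=
        I.cnt_mono H (by rw [ht, add_mul]; omega) ω s₀ a₀
      -- The shift by one in the definition of a doubling makes count + 1 at least double, including
      -- the first visit to a new pair.
      have h3 : 2 * (I.cnt H (K * H) ω s₀ a₀ + 1 : ℝ) ≤ I.cnt H ((K + 1) * H) ω s₀ a₀ + 1 := by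
        have : 2 * (I.cnt H (K * H) ω s₀ a₀ + 1) ≤ I.cnt H ((K + 1) * H) ω s₀ a₀ + 1 := by omega
        exact_mod_cast this
      have h4 : Real.log 2 + Real.log (I.cnt H (K * H) ω s₀ a₀ + 1)
          ≤ Real.log (I.cnt H ((K + 1) * H) ω s₀ a₀ + 1) := by
        rw [← Real.log_mul (by norm_num) (by positivity)]
        exact Real.log_le_log (by positivity) h3
      have h5 : ∀ s a, Real.log (I.cnt H (K * H) ω s a + 1)
          + (if s₀ = s then (if a₀ = a then Real.log 2 else 0) else 0)
          ≤ Real.log (I.cnt H ((K + 1) * H) ω s a + 1) := by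
        intro s a
        split_ifs with e1 e2
        · subst e1; subst e2; linarith
        · simpa using hmono s a
        · simpa using hmono s a
      have h6 := Finset.sum_le_sum (s := Finset.univ) fun s _ =>
        Finset.sum_le_sum (s := Finset.univ) fun a _ => h5 s a
      simp only [Finset.sum_add_distrib] at h6
      rw [Finset.sum_eq_single (f := fun s => ∑ a, if s₀ = s then (if a₀ = a then Real.log 2 else 0)
        else 0) s₀ (fun s _ hs' => by simp [hs'.symm]) (by simp)] at h6
      simp at h6
      linarith

end Count

end Interaction

end EQO

namespace EQO

namespace Interaction

/-! ### From expected clipped costs to observed costs. -/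

section ClippedSum

variable {Ω S A : Type*} [Fintype S] (I : Interaction Ω S A) (M : MDP S A)

open Classical in
/-- The costs of episode `k`: `φ s a N^k(s, a)`, and `c` for the pairs that were not visited. -/
noncomputable def cost (φ : S → A → ℝ → ℝ) (c : ℝ) (k : ℕ) (ω : Ω) (s : S) (a : A) : ℝ :=
  if 0 < I.count M.H k ω s a then φ s a (I.count M.H k ω s a) else c

/-- The clipped value in episode `k` of the costs of that episode. -/
noncomputable def costVal (φ : S → A → ℝ → ℝ) (c : ℝ) (k : ℕ) (ω : Ω) (n h : ℕ) (s : S) : ℝ :=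
  M.clipVal (I.policy k ω) (I.cost M φ c k ω) c n h s

variable {I M} {φ : S → A → ℝ → ℝ} {c : ℝ}

lemma cost_nonneg (hc : 0 ≤ c) (hφ0 : ∀ s a N, 0 < N → 0 ≤ φ s a N) (k : ℕ) (ω : Ω) (s : S)
    (a : A) : 0 ≤ I.cost M φ c k ω s a := by
  unfold cost; split_ifs with h
  · exact hφ0 s a _ h
  · exact hc

variable [Finite A]

lemma measurable_count_past (k : ℕ) (s : S) (a : A) :
    Measurable[I.past M.H k] fun ω => I.count M.H k ω s a := by
  refine Finset.measurable_fun_sum _ fun i hi => Finset.measurable_fun_sum _ fun h hh => ?_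
  have hi' : i ∈ Set.Ico 1 k := by simpa using hi
  have hh' : h ∈ Set.Icc 1 M.H := by simpa using hh
  have hle : I.sigmaSA i h ≤ I.past M.H k := le_sup_left.trans (sigmaSAR_le_past hi' hh')
  refine Measurable.ite ?_ measurable_const measurable_const
  exact (measurableSet_fiber (measurable_iff_comap_le.2 (le_sup_left.trans hle)) s).inter
    (measurableSet_fiber (measurable_iff_comap_le.2 (le_sup_right.trans hle)) a)

variable [mΩ : MeasurableSpace Ω] {μ : Measure Ω}

/-- Costs and policy of an episode are fixed before it starts, so the whole value function is a
legitimate predictable function for `expLE_next`. -/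
lemma measurable_costVal (hI : I.Follows μ M) (hφ : ∀ s a, Measurable (φ s a)) {k : ℕ} (hk : 1 ≤ k)
    (n h : ℕ) (h1 : 1 ≤ h) (hn : h + n ≤ M.H + 1) (s : S) :
    Measurable[I.past M.H k] fun ω => I.costVal M φ c k ω n h s := by
  induction n generalizing h s with
  | zero => exact measurable_const
  | succ n ih =>
    have hcost : ∀ a, Measurable[I.past M.H k] fun ω => I.cost M φ c k ω s a := fun a =>
      Measurable.ite (measurableSet_lt measurable_const (measurable_count_past k s a))
        ((hφ s a).comp (measurable_count_past k s a)) measurable_const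
    refine measurable_const.min (measurable_eval_discrete
      (hI.measurable_policy k hk h ⟨h1, by omega⟩ s) (F := fun ω a => I.cost M φ c k ω s a
        + M.PV (I.costVal M φ c k ω n (h + 1)) s a) fun a => (hcost a).add ?_)
    exact Finset.measurable_fun_sum _ fun x _ => (ih (h + 1) (by omega) (by omega) x).const_mul _

lemma measurable_cnt_filt {i k h : ℕ} (hk : 1 ≤ k) (hh : h ∈ Set.Icc 1 M.H)
    (hi : i ≤ (k - 1) * M.H + (h - 1)) (s : S) (a : A) :
    Measurable[I.filt M.H k h] fun ω => I.cnt M.H i ω s a := by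
  have hH : 1 ≤ M.H := hh.1.trans hh.2
  refine Finset.measurable_fun_sum _ fun j hj => ?_
  have hj' : j < (k - 1) * M.H + (h - 1) := (Finset.mem_range.1 hj).trans_le hi
  have hlex := div_mod_lex (H := M.H) hj'
  have e1 : ((k - 1) * M.H + (h - 1)) / M.H = k - 1 := by
    rw [Nat.mul_comm, Nat.mul_add_div (by omega), Nat.div_eq_of_lt, add_zero]
    have := hh.2; have := hh.1; omega
  have e2 : ((k - 1) * M.H + (h - 1)) % M.H = h - 1 := by
    rw [Nat.mul_comm, Nat.mul_add_mod, Nat.mod_eq_of_lt]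
    have := hh.2; have := hh.1; omega
  rw [e1, e2, Nat.sub_add_cancel hk, Nat.sub_add_cancel hh.1] at hlex
  have hlex' : j / M.H + 1 < k ∨ (j / M.H + 1 = k ∧ j % M.H + 1 ≤ h) := by omega
  have hj1 : 1 ≤ j / M.H + 1 := Nat.le_add_left _ _
  refine Measurable.ite ?_ measurable_const measurable_const
  exact (measurableSet_fiber (measurable_state_filt hj1 (flat_mem hH j) hlex') s).inter
    (measurableSet_fiber (measurable_action_filt hj1 (flat_mem hH j) hlex') a)

lemma measurableSet_noDouble_filt {j t : ℕ} (hH : 1 ≤ M.H) (hjt : j ≤ t) :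
    MeasurableSet[I.filt M.H (t / M.H + 1) (t % M.H + 1)] {ω | I.NoDouble M.H j ω} := by
  have ht := flat_mem hH t
  have ht1 : 1 ≤ t / M.H + 1 := Nat.le_add_left _ _
  have hj1 : 1 ≤ j / M.H + 1 := Nat.le_add_left _ _
  have hlex : j / M.H + 1 < t / M.H + 1 ∨
      (j / M.H + 1 = t / M.H + 1 ∧ j % M.H + 1 ≤ t % M.H + 1) := by
    rcases hjt.lt_or_eq with h | rfl
    · have := div_mod_lex (H := M.H) h; omega
    · exact Or.inr ⟨rfl, le_rfl⟩
  have hs := measurable_state_filt (I := I) hj1 (flat_mem hH j) hlex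
  have ha := measurable_action_filt (I := I) hj1 (flat_mem hH j) hlex
  have hcnt : ∀ i ≤ t, ∀ s a,
      Measurable[I.filt M.H (t / M.H + 1) (t % M.H + 1)] fun ω => I.cnt M.H i ω s a :=
    fun i hi s a => measurable_cnt_filt ht1 ht (hi.trans (by
      simp only [Nat.add_sub_cancel]; rw [Nat.mul_comm, Nat.div_add_mod])) s a
  have hev : ∀ i ≤ t, Measurable[I.filt M.H (t / M.H + 1) (t % M.H + 1)] fun ω =>
      I.cnt M.H i ω (I.state (j / M.H + 1) (j % M.H + 1) ω)
        (I.action (j / M.H + 1) (j % M.H + 1) ω) := fun i hi =>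
    measurable_eval_discrete hs (F := fun ω s => I.cnt M.H i ω s
      (I.action (j / M.H + 1) (j % M.H + 1) ω)) fun s => measurable_eval_discrete ha
        (F := fun ω a => I.cnt M.H i ω s a) fun a => hcnt i hi s a
  exact measurableSet_le ((hev j hjt).add_const 1)
    ((hev _ ((Nat.div_mul_le_self j M.H).trans hjt)).const_mul 2)

open Classical in
/-- The clipped values of the costs of the first `K` episodes exceed the sum of the costs
observed, up to doublings of the counts, only with small probability. -/
lemma measure_sum_costVal_gt_le [Fintype A] [IsProbabilityMeasure μ] (hI : I.Follows μ M)
    (hH : 1 ≤ M.H) (hc : 0 < c) (hφ : ∀ s a, Measurable (φ s a))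
    (hφ0 : ∀ s a N, 0 < N → 0 ≤ φ s a N)
    (hanti : ∀ s a N N', 0 < N → N ≤ N' → φ s a N' ≤ φ s a N) {K : ℕ} (hK : 2 ≤ K * M.H) (L : ℝ) :
    μ {ω | 3 * ∑ s, ∑ a, ∑ n ∈ Finset.range (K * M.H), φ s a ((n + 1) / 2)
        + 6 * c * (Fintype.card S * Fintype.card A * Real.log (K * M.H)) + 9 * c * L
        < ∑ k ∈ Finset.Icc 1 K, I.costVal M φ c k ω M.H 1 (I.state k 1 ω)}
      ≤ ENNReal.ofReal (Real.exp (-L)) := by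
  let U : ℕ → Ω → ℕ → S → ℝ := fun k ω h x => I.costVal M φ c k ω (M.H + 1 - h) h x
  have hU0 : ∀ k ω h x, 0 ≤ U k ω h x := fun k ω h x =>
    M.clipVal_nonneg hc.le (fun s a => cost_nonneg hc.le hφ0 k ω s a) _ _ _
  have hUc : ∀ k ω h x, U k ω h x ≤ c := fun k ω h x => M.clipVal_le hc.le _ _ _
  let g : ℕ → ℕ → Ω → S → ℝ := fun k h ω x => (quadPot c (M.PV (U k ω (h + 1)) (I.state k h ω)
    (I.action k h ω)) - quadPot c (U k ω (h + 1) x)) / (9 * c)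
  -- The increments are switched off once a doubling occurs in the episode. Whether this has
  -- happened is known from the current state and action, before the next state is drawn.
  let G : ℕ → Ω → ℝ := fun t ω => if I.NoDoubleYet M.H t ω then
    g (t / M.H + 1) (t % M.H + 1) ω (I.state (t / M.H + 1) (t % M.H + 1 + 1) ω) else 0
  have hlow : ∀ t, 1 ≤ t / M.H + 1 := fun t => Nat.le_add_left _ _
  have hND : ∀ j t, j ≤ t → MeasurableSet[I.filt M.H (t / M.H + 1) (t % M.H + 1)]
      {ω | I.NoDoubleYet M.H j ω} := by
    intro j t hjt
    have : {ω | I.NoDoubleYet M.H j ω} = ⋂ i ∈ {i | i ≤ j ∧ j / M.H * M.H ≤ i},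
        {ω | I.NoDouble M.H i ω} := by
      ext ω; simp [NoDoubleYet]
    rw [this]
    exact MeasurableSet.biInter (Set.to_countable _) fun i hi =>
      measurableSet_noDouble_filt hH (hi.1.trans hjt)
  have hquad : Measurable (quadPot c) := by unfold quadPot; fun_prop
  have hg : ∀ k h i j, 1 ≤ k → h ∈ Set.Icc 1 M.H → (k < i ∨ (k = i ∧ h ≤ j)) → ∀ x,
      Measurable[I.filt M.H i j] fun ω => g k h ω x := by
    intro k h i j hk hh hlex x
    have hpast : I.past M.H k ≤ I.filt M.H i j := by
      refine le_trans ?_ (past_le_filt i j)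
      refine biSup_mono fun n hn => ⟨hn.1, hn.2.trans_le ?_⟩
      omega
    have hUm : ∀ y, Measurable[I.filt M.H i j] fun ω => U k ω (h + 1) y := fun y =>
      (measurable_costVal hI hφ hk _ (h + 1) (by omega) (by have := hh.2; omega) y).mono hpast le_rfl
    have hs := measurable_state_filt (I := I) hk hh hlex
    have ha := measurable_action_filt (I := I) hk hh hlex
    refine Measurable.div_const (Measurable.sub (hquad.comp ?_) (hquad.comp (hUm x))) _
    exact measurable_eval_discrete hs (F := fun ω s => M.PV (U k ω (h + 1)) s (I.action k h ω))
      fun s => measurable_eval_discrete ha (F := fun ω a => M.PV (U k ω (h + 1)) s a)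
      fun a => Finset.measurable_fun_sum _ fun y _ => (hUm y).const_mul _
  refine le_trans (measure_mono ?_) (measure_exists_sum_ge_le (μ := μ)
    (m := fun t => I.filt M.H (t / M.H + 1) (t % M.H + 1))
    (fun t => hI.filt_le (hlow t) (flat_mem hH t)) (G := G) ?_ ?_ ?_ (K * M.H) L)
  · intro ω hω
    refine ⟨K * M.H, le_rfl, ?_⟩
    simp only [Set.mem_ofPred_eq] at hω
    have hep : ∀ e j, j < M.H → (e * M.H + j) / M.H = e ∧ (e * M.H + j) % M.H = j := by
      intro e j hj
      rw [Nat.mul_comm, Nat.mul_add_div (by omega), Nat.div_eq_of_lt hj, Nat.mul_add_mod,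
        Nat.mod_eq_of_lt hj]
      simp
    have hyet : ∀ e j, j < M.H → (I.NoDoubleYet M.H (e * M.H + j) ω ↔
        ∀ i ≤ j, I.NoDouble M.H (e * M.H + i) ω) := by
      intro e j hj
      rw [NoDoubleYet, (hep e j hj).1]
      constructor
      · exact fun h i hi => h _ (by omega) (by omega)
      · intro h i hi hi'
        have := h (i - e * M.H) (by omega)
        rwa [Nat.add_sub_cancel' hi'] at this
    let b : ℕ → ℝ := fun t => if I.NoDoubleYet M.H t ω then I.cost M φ c (t / M.H + 1) ω
      (I.state (t / M.H + 1) (t % M.H + 1) ω) (I.action (t / M.H + 1) (t % M.H + 1) ω) else 0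
    have hepisode : ∀ e, I.costVal M φ c (e + 1) ω M.H 1 (I.state (e + 1) 1 ω)
        ≤ 9 * c * ∑ j ∈ Finset.range M.H, G (e * M.H + j) ω
          + 3 * ∑ j ∈ Finset.range M.H, b (e * M.H + j)
          + 2 * c * (if ∀ j < M.H, I.NoDouble M.H (e * M.H + j) ω then 0 else 1) := by
      intro e
      have := quadPot_telescope hc (H := M.H)
        (u := fun j => U (e + 1) ω (j + 1) (I.state (e + 1) (j + 1) ω))
        (p := fun j => M.PV (U (e + 1) ω (j + 1 + 1)) (I.state (e + 1) (j + 1) ω)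
          (I.action (e + 1) (j + 1) ω))
        (b := fun j => I.cost M φ c (e + 1) ω (I.state (e + 1) (j + 1) ω)
          (I.action (e + 1) (j + 1) ω))
        (χ := fun j => ∀ i ≤ j, I.NoDouble M.H (e * M.H + i) ω)
        (fun j => hU0 _ _ _ _) (fun j => hUc _ _ _ _)
        (fun j => M.PV_nonneg fun x => hU0 _ _ _ _) (fun j => M.PV_le_const fun x => hUc _ _ _ _)
        (fun j => cost_nonneg hc.le hφ0 _ _ _ _) ?_ ?_ (fun i j hij h i' hi' => h i' (by omega))
      · refine this.trans (le_of_eq ?_)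
        congr 1
        · congr 1
          · rw [Finset.mul_sum]
            refine Finset.sum_congr rfl fun j hj => ?_
            have hj' := Finset.mem_range.1 hj
            simp only [G, g, hyet e j hj', (hep e j hj').1, (hep e j hj').2]
            split_ifs
            · rw [mul_div_cancel₀ _ (by positivity)]
            · simp
          · congr 1
            refine Finset.sum_congr rfl fun j hj => ?_
            have hj' := Finset.mem_range.1 hj
            simp only [b, hyet e j hj', (hep e j hj').1, (hep e j hj').2]
            split_ifs <;> rfl
        · congr 1
          have hiff : (∀ j < M.H, ∀ i ≤ j, I.NoDouble M.H (e * M.H + i) ω) ↔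
              ∀ j < M.H, I.NoDouble M.H (e * M.H + j) ω :=
            ⟨fun h j hj => h j hj j le_rfl, fun h j hj i hi => h i (by omega)⟩
          by_cases h : ∀ j < M.H, I.NoDouble M.H (e * M.H + j) ω
          · rw [if_pos h, if_pos (hiff.2 h)]
          · rw [if_neg h, if_neg fun h' => h (hiff.1 h')]
      · intro j hj
        have h1 : M.H + 1 - (j + 1) = (M.H + 1 - (j + 1 + 1)) + 1 := by omega
        simp only [U, costVal]
        rw [h1]
        exact min_le_right _ _
      · simp [U, costVal, MDP.clipVal]
    have hsum : ∀ F : ℕ → ℝ, ∑ e ∈ Finset.range K, ∑ j ∈ Finset.range M.H, F (e * M.H + j)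
        = ∑ t ∈ Finset.range (K * M.H), F t := by
      intro F
      generalize K = K'
      induction K' with
      | zero => simp
      | succ n ih => rw [Finset.sum_range_succ, ih, add_mul, one_mul, Finset.sum_range_add]
    have htot : ∑ k ∈ Finset.Icc 1 K, I.costVal M φ c k ω M.H 1 (I.state k 1 ω)
        ≤ 9 * c * ∑ t ∈ Finset.range (K * M.H), G t ω + 3 * ∑ t ∈ Finset.range (K * M.H), b t
          + 2 * c * ∑ e ∈ Finset.range K,
            (if ∀ j < M.H, I.NoDouble M.H (e * M.H + j) ω then 0 else 1) := by
      rw [← hsum, ← hsum, Finset.mul_sum, Finset.mul_sum, Finset.mul_sum, ← Finset.sum_add_distrib,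
        ← Finset.sum_add_distrib, ← Finset.Ico_add_one_right_eq_Icc, Finset.sum_Ico_eq_sum_range]
      simp only [Nat.add_sub_cancel]
      exact Finset.sum_le_sum fun e _ => by rw [add_comm 1 e]; exact hepisode e
    have hbsum : ∑ t ∈ Finset.range (K * M.H), b t
        ≤ ∑ s, ∑ a, ∑ n ∈ Finset.range (K * M.H), φ s a ((n + 1) / 2) := by
      calc ∑ t ∈ Finset.range (K * M.H), b t
          ≤ ∑ t ∈ Finset.range (K * M.H), (fun s a (n : ℕ) => φ s a (((n : ℝ) + 1) / 2))
            (I.state (t / M.H + 1) (t % M.H + 1) ω) (I.action (t / M.H + 1) (t % M.H + 1) ω)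
            (I.cnt M.H t ω (I.state (t / M.H + 1) (t % M.H + 1) ω)
              (I.action (t / M.H + 1) (t % M.H + 1) ω)) := by
            refine Finset.sum_le_sum fun t _ => ?_
            simp only [b]
            split_ifs with h
            · have hnd := h t le_rfl (Nat.div_mul_le_self _ _)
              rw [NoDouble] at hnd
              rw [cost, count_eq_cnt I M.H hH]
              set s₀ := I.state (t / M.H + 1) (t % M.H + 1) ω
              set a₀ := I.action (t / M.H + 1) (t % M.H + 1) ω
              have hnd' : (I.cnt M.H t ω s₀ a₀ + 1 : ℝ) ≤ 2 * I.cnt M.H (t / M.H * M.H) ω s₀ a₀ := by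
                exact_mod_cast hnd
              have hp : (0 : ℝ) < I.cnt M.H t ω s₀ a₀ + 1 := by positivity
              -- Without a doubling the count at the start of the episode is positive and at least
              -- half of the current count plus one, so the frozen cost is at most the one at (n +
              -- 1) / 2.
              rw [if_pos (by linarith)]
              exact hanti _ _ _ _ (by positivity) (by linarith)
            · exact hφ0 _ _ _ (by positivity)
        _ = ∑ s, ∑ a, ∑ n ∈ Finset.range (I.cnt M.H (K * M.H) ω s a), φ s a ((n + 1) / 2) :=
            I.sum_visits_eq M.H (fun s a (n : ℕ) => φ s a (((n : ℝ) + 1) / 2)) _ ω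
        _ ≤ _ := Finset.sum_le_sum fun s _ => Finset.sum_le_sum fun a _ =>
            Finset.sum_le_sum_of_subset_of_nonneg (Finset.range_mono (I.cnt_le M.H _ ω s a))
              fun n _ _ => hφ0 _ _ _ (by positivity)
    have hdbl : ∑ e ∈ Finset.range K,
        (if ∀ j < M.H, I.NoDouble M.H (e * M.H + j) ω then (0 : ℝ) else 1)
        ≤ 3 * (Fintype.card S * Fintype.card A * Real.log (K * M.H)) := by
      have h1 := I.sum_double_le M.H hH K ω
      have hKH : (2 : ℝ) ≤ K * M.H := by exact_mod_cast hK
      have h2 : ∑ s, ∑ a, Real.log (I.cnt M.H (K * M.H) ω s a + 1)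
          ≤ ∑ _s : S, ∑ _a : A, 2 * Real.log (K * M.H) := by
        refine Finset.sum_le_sum fun s _ => Finset.sum_le_sum fun a _ => ?_
        -- A count plus one is at most K H + 1 ≤ (K H)², as K H ≥ 2; the factor 3 above comes from 2
        -- / log 2 < 3.
        rw [show 2 * Real.log (K * M.H) = Real.log ((K * M.H) ^ 2) by
          rw [Real.log_pow]; norm_num]
        refine Real.log_le_log (by positivity) ?_
        have : (I.cnt M.H (K * M.H) ω s a : ℝ) ≤ K * M.H := by
          exact_mod_cast I.cnt_le M.H _ ω s a
        nlinarith
      have h3 : ∑ _s : S, ∑ _a : A, 2 * Real.log (K * M.H)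
          = 2 * (Fintype.card S * Fintype.card A * Real.log (K * M.H)) := by
        simp only [Finset.sum_const, Finset.card_univ, nsmul_eq_mul]; ring
      have h4 := Real.log_two_gt_d9
      have h5 : 0 ≤ (Fintype.card S * Fintype.card A * Real.log (K * M.H) : ℝ) :=
        mul_nonneg (by positivity) (Real.log_nonneg (by linarith))
      by_contra! h6
      nlinarith
    have h7 := mul_le_mul_of_nonneg_left hdbl (by positivity : 0 ≤ 2 * c)
    have h8 : 9 * c * L < 9 * c * ∑ t ∈ Finset.range (K * M.H), G t ω := by linarith
    exact (lt_of_mul_lt_mul_left h8 (by positivity)).le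
  · intro t
    have hm := hI.filt_le (hlow t) (flat_mem hH t)
    refine Measurable.ite (hm _ (hND t t le_rfl)) ?_ measurable_const
    exact measurable_eval_discrete (hI.measurable_next (hlow t) (flat_mem hH t))
      (F := fun ω x => g (t / M.H + 1) (t % M.H + 1) ω x)
      fun x => (hg _ _ _ _ (hlow t) (flat_mem hH t) (Or.inr ⟨rfl, le_rfl⟩) x).mono hm le_rfl
  · intro t j hjt
    have hlex := div_mod_lex (H := M.H) hjt
    refine Measurable.ite (hND j t hjt.le) ?_ measurable_const
    exact measurable_eval_discrete
      (measurable_next_filt (hlow j) (flat_mem hH j) (flat_mem hH t).2 hlex)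
      (F := fun ω x => g (j / M.H + 1) (j % M.H + 1) ω x)
      fun x => hg _ _ _ _ (hlow j) (flat_mem hH j) (by omega) x
  · intro t
    refine expLE_next hI (hlow t) (flat_mem hH t) (φ := fun ω x => if I.NoDoubleYet M.H t ω then
      g (t / M.H + 1) (t % M.H + 1) ω x else 0) (fun x => Measurable.ite (hND t t le_rfl)
        (hg _ _ _ _ (hlow t) (flat_mem hH t) (Or.inr ⟨rfl, le_rfl⟩) x) measurable_const) fun ω => ?_
    split_ifs
    · exact M.PV_exp_quadPot_le_one hc (fun x => hU0 _ _ _ _) (fun x => hUc _ _ _ _) _ _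
    · simp [M.PV_const]

end ClippedSum

end Interaction

end EQO

namespace EQO

namespace MDP

/-! ### The error function of quasi-optimism. -/

section QuasiErr

variable {S A : Type*} [Fintype S] [Fintype A] [Nonempty S] [Nonempty A] (M : MDP S A)
  (σ : ℕ → S → A → ℝ) (π : Policy S A) (θ : ℝ)

/-- The bound for the error of quasi-optimism. -/
noncomputable def quasiErr (h : ℕ) (s : S) : ℝ :=
  2 * θ * M.W σ π h s - 20 * θ ^ 3 * (M.W σ π h s - ⨅ s', M.W σ π h s') ^ 2

variable {M σ π θ}

lemma W_sub_iInf_mem (hH : 1 ≤ M.H) {h : ℕ} (h1 : 1 ≤ h) (s : S) :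
    0 ≤ M.W σ π h s - ⨅ s', M.W σ π h s' ∧ M.W σ π h s - ⨅ s', M.W σ π h s' ≤ M.Wdiff σ := by
  refine ⟨sub_nonneg.2 (M.iInf_W_le σ π h s), ?_⟩
  rcases le_or_gt h M.H with h2 | h2
  · exact M.W_sub_iInf_le_Wdiff σ π h1 h2 s
  · simp only [M.W_of_gt σ π h2, ciInf_const, sub_zero]
    exact M.Wdiff_nonneg σ hH

lemma cube_mul_Wdiff_le (hθ0 : 0 ≤ θ) (hθ : θ ^ 2 * M.Wdiff σ ≤ 1 / 64) :
    θ ^ 3 * M.Wdiff σ ≤ θ / 64 := by nlinarith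

lemma quasiErr_le (hθ0 : 0 ≤ θ) (hH : 1 ≤ M.H) {h : ℕ} (h1 : 1 ≤ h) (s : S) :
    M.quasiErr σ π θ h s ≤ 2 * θ * M.Wstar σ := by
  have h2 := M.W_le_Wstar σ π h1 s hH
  have h3 : 0 ≤ 20 * θ ^ 3 * (M.W σ π h s - ⨅ s', M.W σ π h s') ^ 2 := by positivity
  have h4 := mul_le_mul_of_nonneg_left h2 (by positivity : 0 ≤ 2 * θ)
  rw [quasiErr]; linarith

lemma quasiErr_nonneg (hθ0 : 0 ≤ θ) (hθ : θ ^ 2 * M.Wdiff σ ≤ 1 / 64) (hH : 1 ≤ M.H) {h : ℕ}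
    (h1 : 1 ≤ h) (s : S) : 0 ≤ M.quasiErr σ π θ h s := by
  obtain ⟨h2, h3⟩ := W_sub_iInf_mem (M := M) (σ := σ) (π := π) hH h1 s
  have h4 := cube_mul_Wdiff_le hθ0 hθ
  have h5 : 0 ≤ ⨅ s', M.W σ π h s' := Real.iInf_nonneg fun s' => M.W_nonneg σ π h1 s'
  rw [quasiErr]
  set w := M.W σ π h s - ⨅ s', M.W σ π h s' with hw
  have h6 : w ≤ M.W σ π h s := by linarith
  have h7 : 20 * θ ^ 3 * w ^ 2 ≤ 20 * (θ / 64) * w := by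
    have : θ ^ 3 * w ≤ θ / 64 := le_trans (by gcongr) h4
    nlinarith
  nlinarith

/-- Where W - min W lies in [0, `Wdiff`], the slope 2θ - 20 θ³ (w + p) of the secants stays in [-2θ,
2θ]. Since the square is taken of W - min W, the smallness condition involves `Wdiff` and not W^*.
-/
lemma abs_quasiErr_sub_le (hθ0 : 0 ≤ θ) (hθ : θ ^ 2 * M.Wdiff σ ≤ 1 / 64) (hH : 1 ≤ M.H) {h : ℕ}
    (h1 : 1 ≤ h) (x : S) {p : ℝ} (hp0 : 0 ≤ p) (hp : p ≤ M.Wdiff σ) :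
    |M.quasiErr σ π θ h x - (2 * θ * (p + ⨅ s', M.W σ π h s') - 20 * θ ^ 3 * p ^ 2)|
      ≤ 2 * θ * |M.W σ π h x - (p + ⨅ s', M.W σ π h s')| := by
  obtain ⟨h2, h3⟩ := W_sub_iInf_mem (M := M) (σ := σ) (π := π) hH h1 x
  have h4 := cube_mul_Wdiff_le hθ0 hθ
  rw [quasiErr]
  set m := ⨅ s', M.W σ π h s'
  set w := M.W σ π h x - m with hw
  have e : 2 * θ * M.W σ π h x - 20 * θ ^ 3 * w ^ 2 - (2 * θ * (p + m) - 20 * θ ^ 3 * p ^ 2)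
      = (2 * θ - 20 * θ ^ 3 * (w + p)) * (M.W σ π h x - (p + m)) := by rw [hw]; ring
  rw [e, abs_mul]
  gcongr
  have h5 : 0 ≤ θ ^ 3 * (w + p) := by positivity
  have h6 : θ ^ 3 * (w + p) ≤ θ ^ 3 * (2 * M.Wdiff σ) := by gcongr; linarith
  rw [abs_le]; constructor <;> linarith

lemma abs_quasiErr_sub_PV_le (hθ0 : 0 ≤ θ) (hθ : θ ^ 2 * M.Wdiff σ ≤ 1 / 64) (hH : 1 ≤ M.H) {h : ℕ}
    (h1 : 1 ≤ h) (x s : S) (a : A) :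
    |M.quasiErr σ π θ h x - M.PV (M.quasiErr σ π θ h) s a| ≤ 2 * θ * M.Wdiff σ := by
  have key : ∀ y, |M.quasiErr σ π θ h x - M.quasiErr σ π θ h y| ≤ 2 * θ * M.Wdiff σ := by
    intro y
    obtain ⟨h2, h3⟩ := W_sub_iInf_mem (M := M) (σ := σ) (π := π) hH h1 x
    obtain ⟨h4, h5⟩ := W_sub_iInf_mem (M := M) (σ := σ) (π := π) hH h1 y
    have := abs_quasiErr_sub_le (π := π) hθ0 hθ hH h1 x h4 h5
    rw [sub_add_cancel, ← quasiErr] at this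
    refine this.trans ?_
    gcongr
    rw [abs_le]; constructor <;> linarith
  rw [abs_le]
  constructor
  · have : M.PV (M.quasiErr σ π θ h) s a ≤ M.quasiErr σ π θ h x + 2 * θ * M.Wdiff σ :=
      M.PV_le_const fun y => by linarith [(abs_le.1 (key y)).1]
    linarith
  · have : M.quasiErr σ π θ h x - 2 * θ * M.Wdiff σ ≤ M.PV (M.quasiErr σ π θ h) s a :=
      M.const_le_PV fun y => by linarith [(abs_le.1 (key y)).2]
    linarith

/-- By the Lipschitz bound the variance of the error costs at most 5 θ (2θ)² Var W = 20 θ³ Var W,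
exactly what averaging the concave term gains. The linear part provides θ σ², of which 5/8 θ σ² pays
for the observations and at most 20/64 θ σ² for the change of the squared term between the two
steps. -/
lemma quasiErr_step (hθ0 : 0 ≤ θ) (hθ : θ ^ 2 * M.Wdiff σ ≤ 1 / 64) {h : ℕ}
    (hh : h ∈ Set.Icc 1 M.H) (s : S) :
    M.PV (M.quasiErr σ π θ (h + 1)) s (π h s) + θ * (5 / 8 * σ h s (π h s) ^ 2
      + 5 * M.var (M.quasiErr σ π θ (h + 1)) s (π h s)) ≤ M.quasiErr σ π θ h s := by
  have hH : 1 ≤ M.H := hh.1.trans hh.2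
  set a := π h s
  set W' := M.W σ π (h + 1) with hW'
  set m' := ⨅ s', M.W σ π (h + 1) s' with hm'
  set m := ⨅ s', M.W σ π h s' with hm
  set D := M.Wdiff σ
  have hmem := fun x => W_sub_iInf_mem (M := M) (σ := σ) (π := π) hH (h := h + 1) (by omega) x
  obtain ⟨hw0, hwD⟩ := W_sub_iInf_mem (M := M) (σ := σ) (π := π) hH hh.1 s
  have hWs := M.W_succ σ π hh.2 s
  have hmm : m' ≤ m := le_ciInf fun x => by
    rw [M.W_succ σ π hh.2 x]
    have : m' ≤ M.PV W' x (π h x) := M.const_le_PV fun y => M.iInf_W_le σ π (h + 1) y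
    have : 0 ≤ σ h x (π h x) ^ 2 / 2 := by positivity
    linarith
  set p := M.PV W' s a - m' with hp
  have hp0 : 0 ≤ p := sub_nonneg.2 (M.const_le_PV fun y => M.iInf_W_le σ π (h + 1) y)
  have hpD : p ≤ D := by
    have : M.PV W' s a ≤ D + m' := M.PV_le_const fun y => by linarith [(hmem y).2]
    linarith
  have hvar : M.var (M.quasiErr σ π θ (h + 1)) s a ≤ (2 * θ) ^ 2 * M.var W' s a := by
    refine M.var_le_of_lipschitz (y := 2 * θ * (p + m') - 20 * θ ^ 3 * p ^ 2) fun x => ?_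
    have := abs_quasiErr_sub_le (π := π) hθ0 hθ hH (h := h + 1) (by omega) x hp0 hpD
    have hpm : p + m' = M.PV W' s a := by rw [hp]; ring
    rw [← hm', ← hW', hpm] at this
    rwa [hpm]
  have hPV : M.PV (M.quasiErr σ π θ (h + 1)) s a
      = 2 * θ * M.PV W' s a - 20 * θ ^ 3 * (M.var W' s a + p ^ 2) := by
    have : M.quasiErr σ π θ (h + 1)
        = fun x => 2 * θ * W' x - 20 * θ ^ 3 * (W' x - m') ^ 2 := rfl
    rw [this, M.PV_sub (fun x => 2 * θ * W' x), M.PV_const_mul, M.PV_const_mul, M.PV_sub_sq]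
  have hD3 := cube_mul_Wdiff_le hθ0 hθ
  have hs2 : 0 ≤ σ h s a ^ 2 := sq_nonneg _
  have hquad : M.quasiErr σ π θ h s = 2 * θ * (σ h s a ^ 2 / 2 + M.PV W' s a)
      - 20 * θ ^ 3 * (M.W σ π h s - m) ^ 2 := by rw [← hWs, quasiErr]
  set w := M.W σ π h s - m with hw
  have hwp : w ≤ p + σ h s a ^ 2 / 2 := by rw [hw, hWs, hp]; linarith
  -- Here w - p ≤ σ² / 2 and w + p ≤ 2 D.
  have hsq : w ^ 2 - p ^ 2 ≤ σ h s a ^ 2 * D := by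
    rcases le_total w p with h1 | h1
    · nlinarith [mul_nonneg hs2 (hp0.trans hpD)]
    · nlinarith
  have hfin : θ ^ 3 * (w ^ 2 - p ^ 2) ≤ θ / 64 * σ h s a ^ 2 := by
    calc θ ^ 3 * (w ^ 2 - p ^ 2) ≤ θ ^ 3 * (σ h s a ^ 2 * D) := by gcongr
      _ = (θ ^ 3 * D) * σ h s a ^ 2 := by ring
      _ ≤ _ := by gcongr
  have hv5 := mul_le_mul_of_nonneg_left hvar hθ0
  have h0 := mul_nonneg hθ0 hs2
  rw [hPV, hquad]
  linarith

end QuasiErr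

/-! ### The surplus potential and the regret of one episode. -/

section Potential

variable {S A : Type*} [Fintype S] [Fintype A] [Nonempty A] (M : MDP S A)

/-- The difference of the estimate and the value of the policy, with a quadratic correction. -/
noncomputable def potF (V : ℝ) (Vk : ℕ → S → ℝ) (π : Policy S A) (h : ℕ) (s : S) : ℝ :=
  Vk h s - M.V π h s + (Vk h s - M.Vstar h s + V) ^ 2 / (4 * V) - V / 4

variable {M} {V : ℝ} {Vk : ℕ → S → ℝ} {π : Policy S A}

/-- Shifting V^k - V^* by V gives g with values in [0, 2 V], and the surplus E satisfies g ≤ P g' +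
E because Q^* ≤ V^*. If E ≥ 0, then g² / (4 V) exceeds (P g')² / (4 V) by at most E, so E is counted
twice and the variance enters as 2 Var / (8 V) = Var / (4 V), which completes (P g')² / (4 V) to P
g'² / (4 V). If E < 0, then g² ≤ P g'² and there is nothing to pay. -/
lemma potF_step (hV : 0 < V) (hB : M.Bounded V) (hVk0 : ∀ h s, 0 ≤ Vk h s)
    (hVk : ∀ h s, Vk h s ≤ V) {h : ℕ} (hh : h ∈ Set.Icc 1 M.H) (s : S) {B : ℝ} (hB0 : 0 ≤ B)
    (hle : Vk h s ≤ M.r s (π h s) + M.PV (Vk (h + 1)) s (π h s) + B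
      + M.var (fun x => Vk (h + 1) x - M.Vstar (h + 1) x) s (π h s) / (8 * V)) :
    M.potF V Vk π h s ≤ 2 * B + M.PV (M.potF V Vk π (h + 1)) s (π h s) := by
  set a := π h s
  set E := Vk h s - M.r s a - M.PV (Vk (h + 1)) s a with hE
  set g' : S → ℝ := fun x => Vk (h + 1) x - M.Vstar (h + 1) x + V with hg'
  have hg'0 : ∀ x, 0 ≤ g' x := fun x => by
    have := hB.Vstar_le hV.le (h := h + 1) (by omega) x
    have := hVk0 (h + 1) x
    simp only [hg']; linarith
  have hg'V : ∀ x, g' x ≤ 2 * V := fun x => by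
    have := hB.Vstar_nonneg (h := h + 1) (by omega) x
    have := hVk (h + 1) x
    simp only [hg']; linarith
  set m := M.PV g' s a with hm
  set q := M.PV (fun x => g' x ^ 2) s a with hq
  have hvar : M.var (fun x => Vk (h + 1) x - M.Vstar (h + 1) x) s a = q - m ^ 2 := by
    rw [← M.var_add_const _ V, M.var_eq]
  have hvar0 : 0 ≤ q - m ^ 2 := hvar ▸ M.var_nonneg _ _ _
  have hm0 : 0 ≤ m := M.PV_nonneg hg'0
  have hmV : m ≤ 2 * V := M.PV_le_const hg'V
  have hmeq : m = M.PV (Vk (h + 1)) s a - M.PV (M.Vstar (h + 1)) s a + V := by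
    rw [hm, hg', M.PV_add (fun x => Vk (h + 1) x - M.Vstar (h + 1) x) (fun _ => V), M.PV_const,
      M.PV_sub]
  set g := Vk h s - M.Vstar h s + V with hg
  have hg0 : 0 ≤ g := by
    have := hB.Vstar_le hV.le hh.1 s
    have := hVk0 h s
    linarith
  have hgV : g ≤ 2 * V := by
    have := hB.Vstar_nonneg hh.1 s
    have := hVk h s
    linarith
  have hgm : g ≤ m + E := by
    have := M.Qstar_le_Vstar hh.2 s a
    rw [Qstar_eq] at this
    linarith
  have hPV : M.PV (M.potF V Vk π (h + 1)) s a = M.PV (Vk (h + 1)) s a - M.PV (M.V π (h + 1)) s a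
      + q / (4 * V) - V / 4 := by
    have : M.potF V Vk π (h + 1) = fun x => (Vk (h + 1) x - M.V π (h + 1) x
        + 1 / (4 * V) * g' x ^ 2) - V / 4 := by
      ext x; simp only [potF, hg']; ring
    rw [this, M.PV_sub _ (fun _ => V / 4), M.PV_const,
      M.PV_add (fun x => Vk (h + 1) x - M.V π (h + 1) x), M.PV_sub, M.PV_const_mul]
    ring
  have hEB : E ≤ B + (q - m ^ 2) / (8 * V) := by rw [hvar] at hle; linarith
  have hVpi := M.V_succ π hh.2 s
  have hgoal : E + g ^ 2 / (4 * V) ≤ 2 * B + q / (4 * V) := by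
    rcases le_or_gt 0 E with hE0 | hE0
    · have h1 : g ^ 2 - m ^ 2 ≤ 4 * V * E := by
        rcases le_total g m with h2 | h2 <;> nlinarith
      have h2 : g ^ 2 / (4 * V) ≤ m ^ 2 / (4 * V) + E := by
        rw [div_add' _ _ _ (by positivity), div_le_div_iff_of_pos_right (by positivity)]
        linarith
      have h3 : 2 * ((q - m ^ 2) / (8 * V)) = q / (4 * V) - m ^ 2 / (4 * V) := by
        field_simp; ring
      linarith
    · have h1 : g ^ 2 ≤ q := by nlinarith
      have h2 : g ^ 2 / (4 * V) ≤ q / (4 * V) := by gcongr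
      linarith
  rw [potF, ← hg, hPV, hVpi]
  linarith

lemma potF_le (hV : 0 < V) (hB : M.Bounded V) (hVk0 : ∀ h s, 0 ≤ Vk h s)
    (hVk : ∀ h s, Vk h s ≤ V) {h : ℕ} (h1 : 1 ≤ h) (s : S) : M.potF V Vk π h s ≤ 2 * V := by
  have h2 := hB.Vstar_le hV.le h1 s
  have h3 := hB.Vstar_nonneg h1 s
  have h4 := hB.V_nonneg π h1 s
  have h5 := hVk h s
  have h6 := hVk0 h s
  have : (Vk h s - M.Vstar h s + V) ^ 2 / (4 * V) ≤ V := by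
    rw [div_le_iff₀ (by positivity)]; nlinarith
  rw [potF]; linarith

lemma potF_of_gt (hV : 0 < V) {h : ℕ} (hh : M.H < h) (s : S) (h0 : Vk h s = 0) :
    M.potF V Vk π h s = 0 := by
  rw [potF, h0, M.V_of_gt π hh, M.Vstar_of_gt hh]; field_simp; ring

/-- With D = V^* - V^k the quadratic equals V / 4 - D / 2 + D² / (4 V), so V^* - V^π = (3/2) D +
`potF` - D² / (4 V). -/
lemma regret_le_potF (hV : 0 < V) {ε : ℝ} {h : ℕ} {s : S} (hε : M.Vstar h s - Vk h s ≤ ε) :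
    M.Vstar h s - M.V π h s ≤ 3 / 2 * ε + M.potF V Vk π h s := by
  set D := M.Vstar h s - Vk h s with hD
  have h1 : M.potF V Vk π h s = (Vk h s - M.V π h s) - D / 2 + D ^ 2 / (4 * V) := by
    rw [potF, show Vk h s - M.Vstar h s + V = V - D by rw [hD]; ring]; field_simp; ring
  have h2 : 0 ≤ D ^ 2 / (4 * V) := by positivity
  rw [h1]; linarith

/-- The regret is bounded by the clipped value of the surpluses, up to the error of quasi-optimism
and a part of the surpluses that is bounded by the variance proxies. -/
lemma regret_le_clipVal (hV : 0 < V) (hB : M.Bounded V) (hVk0 : ∀ h s, 0 ≤ Vk h s)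
    (hVk : ∀ h s, Vk h s ≤ V) (hlast : ∀ h s, M.H < h → Vk h s = 0) {ε : ℝ}
    (hε : ∀ h s, 1 ≤ h → M.Vstar h s - Vk h s ≤ ε) {σ : ℕ → S → A → ℝ} {κ : ℝ} (hκ : 0 ≤ κ)
    {β : S → A → ℝ} (hβ0 : ∀ s a, 0 ≤ β s a)
    (hstep : ∀ h ∈ Set.Icc 1 M.H, ∀ s, 2 * V ≤ β s (π h s) ∨
      M.potF V Vk π h s ≤ β s (π h s) + 2 * κ * σ h s (π h s) ^ 2
        + M.PV (M.potF V Vk π (h + 1)) s (π h s)) (s : S) :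
    M.Vstar 1 s - M.V π 1 s
      ≤ 3 / 2 * ε + 4 * κ * M.W σ π 1 s + M.clipVal π β (2 * V) M.H 1 s := by
  have key : ∀ n h s, M.H + 1 - h = n → 1 ≤ h →
      M.potF V Vk π h s ≤ 4 * κ * M.W σ π h s + M.clipVal π β (2 * V) n h s := by
    intro n
    induction n with
    | zero =>
      intro h s hn h1
      rw [potF_of_gt hV (by omega) s (hlast h s (by omega)), M.W_of_gt σ π (by omega)]
      simp [clipVal]
    | succ n ih =>
      intro h s hn h1
      have hW := M.W_nonneg σ π h1 s
      have hκW : 0 ≤ 4 * κ * M.W σ π h s := by positivity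
      have hc0 : 0 ≤ M.PV (M.clipVal π β (2 * V) n (h + 1)) s (π h s) :=
        M.PV_nonneg fun x => M.clipVal_nonneg (by positivity) hβ0 _ _ _
      -- Clipping at 2 V loses nothing because the potential never exceeds 2 V.
      rw [clipVal, ← sub_le_iff_le_add', le_min_iff]
      refine ⟨by linarith [potF_le (π := π) hV hB hVk0 hVk h1 s], ?_⟩
      rcases hstep h ⟨h1, by omega⟩ s with h2 | h2
      · linarith [potF_le (π := π) hV hB hVk0 hVk h1 s]
      · have h3 := M.PV_mono (s := s) (a := π h s) fun x => ih (h + 1) x (by omega) (by omega)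
        rw [M.PV_add (fun x => 4 * κ * M.W σ π (h + 1) x), M.PV_const_mul] at h3
        rw [M.W_succ σ π (by omega)]
        linarith
  have h1 := regret_le_potF (π := π) hV (hε 1 s le_rfl)
  have h2 := key M.H 1 s (by omega) le_rfl
  linarith

lemma vGap_le_of_reach {S₀ : Set S} {h : ℕ} (hh : h ∈ Set.Icc 1 M.H) {s : S}
    (hr : M.ReachBeforeB S₀ π h s) (hg : 0 < M.gap h s (π h s)) :
    M.vGap S₀ ≤ M.gap h s (π h s) := by
  refine csInf_le ⟨0, ?_⟩ ⟨π, h, hh, s, hr, rfl, hg⟩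
  rintro x ⟨_, _, _, _, _, _, hx⟩
  exact hx.le

/-- The regret is bounded by the clipped value of the part of the surpluses that exceeds the
effective gaps, up to the error of quasi-optimism if that is large compared to the gaps. -/
lemma regret_le_clipVal_of_isEffectiveGap (hV : 0 < V) (hB : M.Bounded V)
    (hVk0 : ∀ h s, 0 ≤ Vk h s) (hVk : ∀ h s, Vk h s ≤ V) (hlast : ∀ h s, M.H < h → Vk h s = 0)
    {ε : ℝ} (hε : ∀ h s, 1 ≤ h → M.Vstar h s - Vk h s ≤ ε) {S₀ : Set S}
    {g : ℕ → S → A → ℝ} (hg : M.IsEffectiveGap S₀ g) {β : S → A → ℝ} (hβ0 : ∀ s a, 0 ≤ β s a)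
    (hstep : ∀ h ∈ Set.Icc 1 M.H, ∀ s, 8 * V ≤ β s (π h s) ∨
      4 * M.potF V Vk π h s - g h s (π h s) ≤ β s (π h s)
        + 4 * M.PV (M.potF V Vk π (h + 1)) s (π h s)) {e : ℝ} (he0 : 0 ≤ e)
    (he : M.vGap S₀ < 3 * ε → 3 * ε ≤ e) {s : S} (hs : s ∈ S₀) :
    M.Vstar 1 s - M.V π 1 s ≤ e + M.clipVal π β (8 * V) M.H 1 s := by
  have hgs : ∀ n h s, M.H + 1 - h = n → 1 ≤ h → 0 ≤ M.expSum π g n h s := fun n h s hn h1 => by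
    rcases le_or_gt h M.H with h2 | h2
    · exact M.expSum_nonneg M.H (fun h hh s a => (hg.1 h hh s a).le) _ _ _ h1 (by omega)
    · have : n = 0 := by omega
      subst this; exact le_rfl
  have hcl0 : ∀ n h s, 0 ≤ M.clipVal π β (8 * V) n h s := fun n h s =>
    M.clipVal_nonneg (by positivity) hβ0 _ _ _
  -- From the step B on, the effective gaps are subtracted from four times the surpluses, so only
  -- the excess remains as a cost.
  have hJ : ∀ n h s, M.H + 1 - h = n → 1 ≤ h →
      4 * M.potF V Vk π h s - M.expSum π g n h s ≤ M.clipVal π β (8 * V) n h s := by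
    intro n
    induction n with
    | zero =>
      intro h s hn h1
      rw [potF_of_gt hV (by omega) s (hlast h s (by omega))]
      simp [clipVal, expSum]
    | succ n ih =>
      intro h s hn h1
      have h2 := potF_le (π := π) hV hB hVk0 hVk h1 s
      have h3 := hgs (n + 1) h s hn h1
      have hc0 : 0 ≤ M.PV (M.clipVal π β (8 * V) n (h + 1)) s (π h s) :=
        M.PV_nonneg fun x => hcl0 _ _ _
      rw [clipVal, le_min_iff]
      refine ⟨by linarith, ?_⟩
      rcases hstep h ⟨h1, by omega⟩ s with h4 | h4
      · linarith
      · have h5 := M.PV_mono (s := s) (a := π h s) fun x => ih (h + 1) x (by omega) (by omega)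
        rw [M.PV_sub (fun x => 4 * M.potF V Vk π (h + 1) x), M.PV_const_mul] at h5
        rw [expSum]
        linarith
  -- Twice the regret is estimated because the effective gaps sum to at most one regret, which is
  -- moved to the other side at the end. Before B there are no gaps and the regret is simply
  -- propagated along reachable states.
  have key : ∀ n h s, M.H + 1 - h = n → 1 ≤ h → h ≤ M.H + 1 → M.ReachBeforeB S₀ π h s →
      2 * (M.Vstar h s - M.V π h s) - M.expSumFromB π g n h s
        ≤ e + M.clipVal π β (8 * V) n h s := by
    intro n
    induction n with
    | zero =>
      intro h s hn h1 h2 _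
      rw [M.V_of_gt π (by omega), M.Vstar_of_gt (by omega)]
      simpa [clipVal, expSumFromB] using he0
    | succ n ih =>
      intro h s hn h1 h2 hr
      have hh : h ∈ Set.Icc 1 M.H := ⟨h1, by omega⟩
      rw [expSumFromB]
      split_ifs with hgap
      · have hv := vGap_le_of_reach hh hr hgap
        have hR := M.regret_succ π hh.2 s
        have hR' : M.gap h s (π h s) ≤ M.Vstar h s - M.V π h s := by
          rw [hR]
          exact le_add_of_nonneg_right (M.PV_nonneg fun x => sub_nonneg.2 (M.V_le_Vstar _ _ _))
        have hRF := regret_le_potF (π := π) hV (hε h s h1)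
        have hJ' := hJ (n + 1) h s hn h1
        have hg' := hgs (n + 1) h s hn h1
        have hc' := hcl0 (n + 1) h s
        -- If 3 ε ≤ v_gap, the regret R ≥ v_gap at this state satisfies R ≤ (3/2) ε + F ≤ R / 2 + F
        -- for the potential F, so 2 R ≤ 4 F. Otherwise 2 R ≤ 3 ε + 2 F, where `e` covers 3 ε; the
        -- sign of F decides which lower bound for the clipped value is used.
        by_cases h3 : M.vGap S₀ < 3 * ε
        · have := he h3
          rcases le_total 0 (M.potF V Vk π h s) with h4 | h4 <;> linarith
        · linarith
      · have hgap0 : M.gap h s (π h s) = 0 := le_antisymm (not_lt.1 hgap) (M.gap_nonneg hh.2 s _)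
        have h3 := M.PV_mono_of_pos (s := s) (a := π h s) fun x hx =>
          ih (h + 1) x (by omega) (by omega) (by omega) (ReachBeforeB.step h s x hr hgap hx)
        rw [M.PV_sub (fun x => 2 * (M.Vstar (h + 1) x - M.V π (h + 1) x)), M.PV_const_mul,
          M.PV_add (fun _ => e), M.PV_const] at h3
        have h4 := M.PV_clipVal_le (π := π) (by positivity : 0 ≤ 8 * V) hβ0 n h s
        rw [M.regret_succ π hh.2, hgap0]
        linarith
  have h1 := key M.H 1 s (by omega) le_rfl (by omega) (ReachBeforeB.init s hs)
  have h2 := hg.2 s hs π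
  linarith

end Potential

end MDP

end EQO

namespace EQO

namespace MDP

/-! ### Gaps, and the effective gaps they produce. -/

section Gaps

variable {S A : Type*} [Fintype S] [Fintype A] [Nonempty A] {M : MDP S A} {S₀ : Set S} {V : ℝ}

lemma finite_gaps : {g : ℝ | ∃ h ∈ Set.Icc 1 M.H, ∃ s a, g = M.gap h s a ∧ 0 < g}.Finite := by
  refine (Set.finite_range fun x : Set.Icc 1 M.H × S × A => M.gap x.1 x.2.1 x.2.2).subset ?_
  rintro g ⟨h, hh, s, a, rfl, _⟩
  exact ⟨(⟨h, hh⟩, s, a), rfl⟩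

lemma vGap_set_subset : {g : ℝ | ∃ (π : Policy S A), ∃ h ∈ Set.Icc 1 M.H, ∃ s,
      M.ReachBeforeB S₀ π h s ∧ g = M.gap h s (π h s) ∧ 0 < g} ⊆
    {g : ℝ | ∃ h ∈ Set.Icc 1 M.H, ∃ s a, g = M.gap h s a ∧ 0 < g} := by
  rintro g ⟨π, h, hh, s, _, hg, hg0⟩
  exact ⟨h, hh, s, _, hg, hg0⟩

lemma vGap_nonneg : 0 ≤ M.vGap S₀ :=
  Real.sInf_nonneg fun _ ⟨_, _, _, _, _, _, hx⟩ => hx.le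

lemma vGap_mem_gaps (hv : 0 < M.vGap S₀) :
    ∃ h ∈ Set.Icc 1 M.H, ∃ s a, M.vGap S₀ = M.gap h s a ∧ 0 < M.vGap S₀ := by
  have hne : {g : ℝ | ∃ (π : Policy S A), ∃ h ∈ Set.Icc 1 M.H, ∃ s,
      M.ReachBeforeB S₀ π h s ∧ g = M.gap h s (π h s) ∧ 0 < g}.Nonempty := by
    rw [Set.nonempty_iff_ne_empty]
    intro h
    rw [vGap, h, Real.sInf_empty] at hv
    exact lt_irrefl _ hv
  exact vGap_set_subset (hne.csInf_mem (finite_gaps.subset vGap_set_subset))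

lemma gap_le (hB : M.Bounded V) (hV : 0 ≤ V) {h : ℕ} (hh : h ∈ Set.Icc 1 M.H) (s : S) (a : A) :
    M.gap h s a ≤ V := by
  have h1 := hB.Vstar_le hV hh.1 s
  have h2 := hB.r_nonneg (hh.1.trans hh.2) s a
  have h3 : 0 ≤ M.PV (M.Vstar (h + 1)) s a :=
    M.PV_nonneg fun x => hB.Vstar_nonneg (Nat.le_add_left 1 h) x
  rw [gap, Qstar_eq]; linarith

lemma vGap_le (hB : M.Bounded V) (hV : 0 ≤ V) : M.vGap S₀ ≤ V := by
  rcases (vGap_nonneg (M := M) (S₀ := S₀)).eq_or_lt with h | h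
  · rw [← h]; exact hV
  · obtain ⟨h, hh, s, a, he, _⟩ := vGap_mem_gaps h
    rw [he]; exact gap_le hB hV hh s a

/-- A finite non-empty set of positive gaps has a positive infimum, so the value 0 is the default of
an empty infimum: no positive gap is ever reached. -/
lemma regret_eq_zero_of_vGap_eq_zero (hv : M.vGap S₀ = 0) (π : Policy S A) {s : S} (hs : s ∈ S₀) :
    M.Vstar 1 s - M.V π 1 s = 0 := by
  have hno : ∀ h ∈ Set.Icc 1 M.H, ∀ s, M.ReachBeforeB S₀ π h s → ¬ 0 < M.gap h s (π h s) := by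
    intro h hh s hr hg
    have hne : {g : ℝ | ∃ (π : Policy S A), ∃ h ∈ Set.Icc 1 M.H, ∃ s,
      M.ReachBeforeB S₀ π h s ∧ g = M.gap h s (π h s) ∧ 0 < g}.Nonempty :=
      ⟨_, π, h, hh, s, hr, rfl, hg⟩
    obtain ⟨_, _, _, _, _, _, h0⟩ := hne.csInf_mem (finite_gaps.subset vGap_set_subset)
    rw [← vGap, hv] at h0
    exact lt_irrefl _ h0
  have key : ∀ n h s, M.H + 1 - h = n → 1 ≤ h → M.ReachBeforeB S₀ π h s →
      M.Vstar h s - M.V π h s ≤ 0 := by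
    intro n
    induction n with
    | zero =>
      intro h s hn h1 _
      rw [M.V_of_gt π (by omega), M.Vstar_of_gt (by omega), sub_zero]
    | succ n ih =>
      intro h s hn h1 hr
      have hg := hno h ⟨h1, by omega⟩ s hr
      have h3 := M.PV_mono_of_pos (s := s) (a := π h s) (g := fun _ => 0) fun x hx =>
          ih (h + 1) x (by omega) (by omega) (ReachBeforeB.step h s x hr hg hx)
      rw [M.PV_zero] at h3
      rw [M.regret_succ π (by omega)]
      linarith
  exact le_antisymm (key M.H 1 s (by omega) le_rfl (ReachBeforeB.init s hs))
    (sub_nonneg.2 (M.V_le_Vstar π 1 s))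

lemma gapMin_nonneg : 0 ≤ M.gapMin := Real.sInf_nonneg fun _ ⟨_, _, _, _, _, hx⟩ => hx.le

lemma gapMin_le {h : ℕ} (hh : h ∈ Set.Icc 1 M.H) {s : S} {a : A} (hg : 0 < M.gap h s a) :
    M.gapMin ≤ M.gap h s a :=
  csInf_le ⟨0, fun _ ⟨_, _, _, _, _, hx⟩ => hx.le⟩ ⟨h, hh, s, a, rfl, hg⟩

lemma gapMin_le_vGap (hv : 0 < M.vGap S₀) : M.gapMin ≤ M.vGap S₀ := by
  obtain ⟨h, hh, s, a, he, h0⟩ := vGap_mem_gaps hv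
  rw [he] at h0 ⊢
  exact gapMin_le hh h0

lemma gapMin_pos_of_vGap_pos (hv : 0 < M.vGap S₀) : 0 < M.gapMin := by
  obtain ⟨h, hh, s, a, he, h0⟩ := vGap_mem_gaps hv
  have hne : {g : ℝ | ∃ h ∈ Set.Icc 1 M.H, ∃ s a, g = M.gap h s a ∧ 0 < g}.Nonempty :=
    ⟨_, h, hh, s, a, he, h0⟩
  obtain ⟨_, _, _, _, _, h1⟩ := hne.csInf_mem finite_gaps
  exact h1

/-- The gaps, bounded below by `gapMin / H`, are effective up to the factor `1 / 2`. -/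
lemma isEffectiveGap_max (hH : 1 ≤ M.H) (hg : 0 < M.gapMin) :
    M.IsEffectiveGap S₀ (fun h s a => max (M.gap h s a) (M.gapMin / M.H) / 2) := by
  have hH' : (0 : ℝ) < M.H := by exact_mod_cast hH
  refine ⟨fun h _ s a => half_pos (lt_max_of_lt_right (by positivity)), fun s _ π => ?_⟩
  set g : ℕ → S → A → ℝ := fun h s a => max (M.gap h s a) (M.gapMin / M.H) / 2
  have h1 : ∀ n h s, M.H + 1 - h = n → 1 ≤ h → M.expSum π g n h s
      ≤ (M.Vstar h s - M.V π h s) / 2 + n * (M.gapMin / M.H / 2) := by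
    intro n
    induction n with
    | zero =>
      intro h s hn h1
      rw [M.V_of_gt π (by omega), M.Vstar_of_gt (by omega)]
      simp [expSum]
    | succ n ih =>
      intro h s hn h1
      have h3 := M.PV_mono (s := s) (a := π h s) fun x => ih (h + 1) x (by omega) (by omega)
      have h4 : M.PV (fun x => (M.Vstar (h + 1) x - M.V π (h + 1) x) / 2
          + n * (M.gapMin / M.H / 2)) s (π h s)
          = M.PV (fun x => M.Vstar (h + 1) x - M.V π (h + 1) x) s (π h s) / 2
            + n * (M.gapMin / M.H / 2) := by
        rw [M.PV_add (fun x => (M.Vstar (h + 1) x - M.V π (h + 1) x) / 2)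
          (fun _ => n * (M.gapMin / M.H / 2)), M.PV_const]
        simp only [div_eq_inv_mul (_ - _) (2 : ℝ)]
        rw [M.PV_const_mul]; ring
      -- The maximum is bounded by the sum: the halves of the gaps add up to half the regret, and
      -- the other part is at most `gapMin` / 2 over the H steps.
      have h5 : g h s (π h s) ≤ M.gap h s (π h s) / 2 + M.gapMin / M.H / 2 := by
        have h0 := M.gap_nonneg (h := h) (by omega) s (π h s)
        have h0' : 0 ≤ M.gapMin / M.H := by positivity
        have := max_le_add_of_nonneg h0 h0'
        simp only [g]; linarith
      rw [h4] at h3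
      rw [expSum, M.regret_succ π (by omega)]
      push_cast
      linarith
  have key : ∀ n h s, M.H + 1 - h = n → 1 ≤ h → M.expSumFromB π g n h s
      ≤ M.Vstar h s - M.V π h s := by
    intro n
    induction n with
    | zero =>
      intro h s hn h1
      rw [M.V_of_gt π (by omega), M.Vstar_of_gt (by omega)]
      simp [expSumFromB]
    | succ n ih =>
      intro h s hn h1'
      have hR := M.regret_succ π (h := h) (by omega) s
      have hR0 : 0 ≤ M.PV (fun x => M.Vstar (h + 1) x - M.V π (h + 1) x) s (π h s) :=
        M.PV_nonneg fun x => sub_nonneg.2 (M.V_le_Vstar _ _ _)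
      rw [expSumFromB]
      split_ifs with hgap
      · have h2 := h1 (n + 1) h s hn h1'
        have h3 := gapMin_le ⟨h1', by omega⟩ hgap
        -- At B the gap is positive, so the regret there is at least `gapMin` and this remainder is
        -- at most half of it.
        have h4 : ((n + 1 : ℕ) : ℝ) * (M.gapMin / M.H / 2) ≤ M.gapMin / 2 := by
          have : ((n + 1 : ℕ) : ℝ) ≤ M.H := by exact_mod_cast (by omega : n + 1 ≤ M.H)
          calc ((n + 1 : ℕ) : ℝ) * (M.gapMin / M.H / 2) ≤ M.H * (M.gapMin / M.H / 2) := by gcongr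
            _ = _ := by field_simp
        linarith
      · have h2 := M.PV_mono (s := s) (a := π h s) fun x => ih (h + 1) x (by omega) (by omega)
        have h3 := M.gap_nonneg (h := h) (by omega) s (π h s)
        linarith
  exact key M.H 1 s (by omega) le_rfl

lemma max_gapSA_le_iInf (hH : 1 ≤ M.H) (c : ℝ) (s : S) (a : A) :
    max (M.gapSA s a) c / 2 ≤ ⨅ h : Set.Icc 1 M.H, max (M.gap h s a) c / 2 := by
  have : Nonempty (Set.Icc 1 M.H) := ⟨⟨1, le_rfl, hH⟩⟩
  refine le_ciInf fun h => ?_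
  gcongr
  exact ciInf_le (f := fun h : Set.Icc 1 M.H => M.gap h s a) (Set.finite_range _).bddBelow h

end Gaps

end MDP

namespace Interaction

/-! ### The empirical Bellman recursion. -/

section Estimates

variable {Ω S A : Type*} [Fintype S] [Fintype A] [Nonempty A] {I : Interaction Ω S A} {M : MDP S A}
  {V : ℝ} {c₁ c₂ : ℕ → ℝ} {k : ℕ} {ω : Ω}

lemma bonus_nonneg (hc₁ : 0 ≤ c₁ k) (hc₂ : 0 ≤ c₂ k) (s : S) (a : A) :
    0 ≤ I.bonus M.H c₁ c₂ k ω s a :=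
  le_min (div_nonneg hc₁ (I.count_nonneg _ _ _ _ _)) (div_nonneg hc₂ (Real.sqrt_nonneg _))

lemma qStep_le (Vn : S → ℝ) (s : S) (a : A) : I.qStep M.H V c₁ c₂ k ω Vn s a ≤ V := by
  unfold qStep; split_ifs
  · exact min_le_right _ _
  · exact le_rfl

lemma qStep_nonneg (hV : 0 ≤ V) (hc₁ : 0 ≤ c₁ k) (hc₂ : 0 ≤ c₂ k) (Vn : S → ℝ) (s : S) (a : A) :
    0 ≤ I.qStep M.H V c₁ c₂ k ω Vn s a := by
  unfold qStep; split_ifs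
  · exact le_min (add_nonneg (le_max_right _ _) (bonus_nonneg hc₁ hc₂ s a)) hV
  · exact hV

lemma qStep_le_vEst (n : ℕ) (s : S) (a : A) :
    I.qStep M.H V c₁ c₂ k ω (I.vEst M.H V c₁ c₂ k ω n) s a ≤ I.vEst M.H V c₁ c₂ k ω (n + 1) s :=
  le_ciSup (f := fun a => I.qStep M.H V c₁ c₂ k ω (I.vEst M.H V c₁ c₂ k ω n) s a)
    (Set.finite_range _).bddAbove a

lemma vEst_le (hV : 0 ≤ V) (n : ℕ) (s : S) : I.vEst M.H V c₁ c₂ k ω n s ≤ V := by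
  cases n with
  | zero => exact hV
  | succ n => exact ciSup_le fun a => qStep_le _ s a

lemma vEst_nonneg (hV : 0 ≤ V) (hc₁ : 0 ≤ c₁ k) (hc₂ : 0 ≤ c₂ k) (n : ℕ) (s : S) :
    0 ≤ I.vEst M.H V c₁ c₂ k ω n s := by
  cases n with
  | zero => exact le_rfl
  | succ n =>
    exact (qStep_nonneg hV hc₁ hc₂ _ s (Classical.arbitrary A)).trans (qStep_le_vEst n s _)

lemma vEst_eq_of_runs (hR : I.RunsEQOPlus M.H V c₁ c₂) (hk : 1 ≤ k) {h : ℕ}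
    (hh : h ∈ Set.Icc 1 M.H) (s : S) : I.vEst M.H V c₁ c₂ k ω (M.H + 1 - h) s
      = I.qStep M.H V c₁ c₂ k ω (I.vEst M.H V c₁ c₂ k ω (M.H - h)) s (I.policy k ω h s) := by
  have : M.H + 1 - h = M.H - h + 1 := by have := hh.2; omega
  rw [this]
  exact le_antisymm (ciSup_le fun a => hR k hk ω h hh s a) (qStep_le_vEst _ _ _)

/-- Quasi-optimism: the estimates exceed the optimal values up to `Y` if one step of the recursion
does. -/
lemma Vstar_sub_vEst_le (hB : M.Bounded V) (hV : 0 ≤ V) {Y : ℕ → S → ℝ}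
    (hY : ∀ h s, 1 ≤ h → 0 ≤ Y h s)
    (hstep : ∀ h ∈ Set.Icc 1 M.H, ∀ s, 0 < I.count M.H k ω s (M.optPolicy h s) →
      I.bonus M.H c₁ c₂ k ω s (M.optPolicy h s) < V →
      M.Qstar h s (M.optPolicy h s) - (I.rHat M.H k ω s (M.optPolicy h s)
        + ∑ x, I.pHat M.H k ω s (M.optPolicy h s) x * M.Vstar (h + 1) x)
        + ∑ x, I.pHat M.H k ω s (M.optPolicy h s) x * Y (h + 1) x
        ≤ I.bonus M.H c₁ c₂ k ω s (M.optPolicy h s) + Y h s) (h : ℕ) (s : S) (h1 : 1 ≤ h) :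
    M.Vstar h s - I.vEst M.H V c₁ c₂ k ω (M.H + 1 - h) s ≤ Y h s := by
  have key : ∀ n h s, M.H + 1 - h = n → 1 ≤ h →
      M.Vstar h s - I.vEst M.H V c₁ c₂ k ω n s ≤ Y h s := by
    intro n
    induction n with
    | zero =>
      intro h s hn h1
      rw [M.Vstar_of_gt (by omega)]
      simpa [vEst] using hY h s h1
    | succ n ih =>
      intro h s hn h1
      have hh : h ∈ Set.Icc 1 M.H := ⟨h1, by omega⟩
      set a := M.optPolicy h s
      have hq := qStep_le_vEst (I := I) (M := M) (V := V) (c₁ := c₁) (c₂ := c₂) (k := k) (ω := ω)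
        n s a
      have hVs := hB.Vstar_le hV h1 s
      have hY0 := hY h s h1
      -- A clipped or unvisited estimate equals V ≥ V^* and is optimistic. Otherwise the bonus is
      -- smaller than V, which the Hoeffding bound will need.
      by_cases hclip : V ≤ I.qStep M.H V c₁ c₂ k ω (I.vEst M.H V c₁ c₂ k ω n) s a
      · linarith
      · have hN : 0 < I.count M.H k ω s a := by
          by_contra hN
          rw [qStep, if_neg hN] at hclip
          exact hclip le_rfl
        rw [qStep, if_pos hN] at hclip hq
        set emp := I.rHat M.H k ω s a
          + ∑ x, I.pHat M.H k ω s a x * I.vEst M.H V c₁ c₂ k ω n x with hemp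
        have hlt : max emp 0 + I.bonus M.H c₁ c₂ k ω s a < V := by
          by_contra hlt
          exact hclip (le_min (not_lt.1 hlt) le_rfl)
        rw [min_eq_left hlt.le] at hq
        have hb : I.bonus M.H c₁ c₂ k ω s a < V := by linarith [le_max_right emp 0]
        have h2 := hstep h hh s hN hb
        have h3 : ∑ x, I.pHat M.H k ω s a x * (M.Vstar (h + 1) x - I.vEst M.H V c₁ c₂ k ω n x)
            ≤ ∑ x, I.pHat M.H k ω s a x * Y (h + 1) x :=
          Finset.sum_le_sum fun x _ => mul_le_mul_of_nonneg_left
            (ih (h + 1) x (by omega) (by omega)) (I.pHat_nonneg _ _ _ _ _ _)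
        simp only [mul_sub, Finset.sum_sub_distrib] at h3
        have h4 := le_max_left emp 0
        rw [M.Vstar_eq_Qstar_optPolicy hh.2]
        linarith
  exact key _ h s rfl h1

/-- The surplus of the estimates in terms of the deviations of the empirical model. -/
lemma qStep_le_of_deviation (hB : M.Bounded V) {h : ℕ} (hh : h ∈ Set.Icc 1 M.H) {Vn : S → ℝ}
    (hVn : ∀ x, 0 ≤ Vn x) {s : S} {a : A} (hN : 0 < I.count M.H k ω s a) {X T : ℝ} (hX0 : 0 ≤ X)
    (hT0 : 0 ≤ T) (hX : I.rHat M.H k ω s a + ∑ x, I.pHat M.H k ω s a x * M.Vstar (h + 1) x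
      - M.Qstar h s a ≤ X)
    (hT : ∑ x, I.pHat M.H k ω s a x * (Vn x - M.Vstar (h + 1) x)
      - M.PV (fun x => Vn x - M.Vstar (h + 1) x) s a ≤ T) :
    I.qStep M.H V c₁ c₂ k ω Vn s a
      ≤ M.r s a + M.PV Vn s a + (X + I.bonus M.H c₁ c₂ k ω s a) + T := by
  have h1 := hB.r_nonneg (hh.1.trans hh.2) s a
  have h2 : 0 ≤ M.PV Vn s a := M.PV_nonneg hVn
  rw [qStep, if_pos hN]
  refine (min_le_left _ _).trans ?_
  simp only [mul_sub, Finset.sum_sub_distrib] at hT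
  rw [M.PV_sub] at hT
  rw [M.Qstar_eq] at hX
  -- The positive part is harmless, the upper bound being a sum of non-negative terms.
  have : max (I.rHat M.H k ω s a + ∑ x, I.pHat M.H k ω s a x * Vn x) 0
      ≤ M.r s a + M.PV Vn s a + X + T := max_le (by linarith) (by linarith)
  linarith

end Estimates

end Interaction

end EQO

namespace EQO

section Union

variable {Ω : Type*} {m₀ : MeasurableSpace Ω} {μ : Measure Ω}

lemma measure_biUnion_le_ofReal {ι : Type*} (J : Finset ι) {E : ι → Set Ω} {p : ι → ℝ}
    (hp : ∀ i ∈ J, 0 ≤ p i) (h : ∀ i ∈ J, μ (E i) ≤ ENNReal.ofReal (p i)) :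
    μ (⋃ i ∈ J, E i) ≤ ENNReal.ofReal (∑ i ∈ J, p i) := by
  rw [ENNReal.ofReal_sum_of_nonneg hp]
  exact (measure_biUnion_finset_le J E).trans (Finset.sum_le_sum h)

end Union

/-- The standing assumptions, for a positive range of the values. -/
structure Setup {Ω S A : Type*} [Fintype S] [Fintype A] [MeasurableSpace Ω] (μ : Measure Ω)
    (I : Interaction Ω S A) (M : MDP S A) (σ : ℕ → S → A → ℝ) (V Vα : ℝ) (K : ℕ) (c₁ c₂ : ℝ)
    (Λ : ℕ → ℝ) (δ : ℝ) : Prop where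
  two_le : 2 ≤ K * M.H
  c₁_pos : 0 < c₁
  two_le_c₂ : 2 ≤ c₂
  Λ_mono : ∀ j k, 1 ≤ j → j ≤ k → Λ j ≤ Λ k
  le_Λ : ∀ k : ℕ, 1 ≤ k → Real.log (32 * M.size * (1 + Real.log k)) ≤ Λ k
  bounded : M.Bounded V
  follows : I.Follows μ M
  subExp : SubExponential I μ M σ Vα
  sigmaMax_le : M.sigmaMax σ Vα V ^ 2 ≤ 2 * V ^ 2
  runs : I.RunsEQOPlus M.H V (M.eqoC1 K V c₁ Λ) (M.hoeffdingC2 V c₂)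
  δ_pos : 0 < δ
  δ_le : δ ≤ 1
  V_pos : 0 < V

namespace MDP

variable {S A : Type*} [Fintype S] [Fintype A] (M : MDP S A)

/-- The scale of the exponents of episode block `i`. -/
noncomputable def theta (K : ℕ) (V c₁ : ℝ) (Λ : ℕ → ℝ) (δ : ℝ) (i : ℕ) : ℝ :=
  2 * M.ell (2 ^ i) δ / M.eqoC1 K V c₁ Λ (2 ^ i)

/-- The scale `θ` is small enough for quasi-optimism. -/
def ValidScale (σ : ℕ → S → A → ℝ) (V Vα θ : ℝ) : Prop :=
  5 / 4 * θ * Vα ≤ 1 ∧ θ ^ 2 * M.Wdiff σ ≤ 1 / 64 ∧ θ * M.Wstar σ ≤ V / 16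

/-- The logarithmic factor of the Hoeffding bonus in block `i`. -/
noncomputable def logH (i : ℕ) : ℝ := Real.log (32 * M.size * 2 ^ i)

/-- The exponent for the Hoeffding bonus in block `i`, for counts between `2 ^ j` and
`2 ^ (j + 1)`. -/
noncomputable def lamH (V c₂ : ℝ) (i j : ℕ) : ℝ := c₂ * √(M.logH i) / (2 * V * √(2 ^ j))

lemma one_le_size [Nonempty S] [Nonempty A] (hH : 1 ≤ M.H) : 1 ≤ M.size := by
  have h1 : 1 ≤ Fintype.card S := Fintype.card_pos
  have h2 : 1 ≤ Fintype.card A := Fintype.card_pos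
  have : 1 ≤ M.H * Fintype.card S * Fintype.card A := Nat.mul_pos (Nat.mul_pos hH h1) h2
  rw [size]; exact_mod_cast this

/-- Exponents use 2 ℓ rather than ℓ: the square makes the probabilities summable over the blocks k =
2^i and leaves a factor for the size of the union. -/
lemma exp_neg_two_ell [Nonempty S] [Nonempty A] (hH : 1 ≤ M.H) {k : ℕ} {δ : ℝ}
    (hδ : 0 < δ) : Real.exp (-(2 * M.ell k δ)) = (δ / (32 * M.size * (1 + Real.log k))) ^ 2 := by
  have h1 := M.one_le_size hH
  have h2 : 0 ≤ Real.log k := Real.log_natCast_nonneg k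
  have h3 : 0 < 32 * M.size * (1 + Real.log k) / δ := by positivity
  rw [ell, show -(2 * Real.log (32 * M.size * (1 + Real.log k) / δ))
    = Real.log ((32 * M.size * (1 + Real.log k) / δ)⁻¹ ^ 2) by
      rw [Real.log_pow, Real.log_inv]; push_cast; ring, Real.exp_log (by positivity), inv_div]

lemma log_le_ell [Nonempty S] [Nonempty A] (hH : 1 ≤ M.H) {k : ℕ} {δ : ℝ}
    (hδ : 0 < δ) : Real.log (32 / δ) ≤ M.ell k δ := by
  have h1 := M.one_le_size hH
  have h2 : 0 ≤ Real.log k := Real.log_natCast_nonneg k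
  refine Real.log_le_log (by positivity) ?_
  gcongr
  nlinarith [mul_nonneg (by linarith : 0 ≤ M.size - 1) h2]

lemma log_thirtyTwo_ge : 3 ≤ Real.log 32 := by
  rw [show (32 : ℝ) = 2 ^ 5 by norm_num, Real.log_pow]
  have := Real.log_two_gt_d9
  norm_num; linarith

lemma three_le_ell [Nonempty S] [Nonempty A] (hH : 1 ≤ M.H) {k : ℕ} {δ : ℝ}
    (hδ : 0 < δ) (hδ1 : δ ≤ 1) : 3 ≤ M.ell k δ := by
  refine (log_thirtyTwo_ge.trans (Real.log_le_log (by norm_num) ?_)).trans (M.log_le_ell hH hδ)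
  rw [le_div_iff₀ hδ]; linarith

lemma three_le_logH [Nonempty S] [Nonempty A] (hH : 1 ≤ M.H) (i : ℕ) : 3 ≤ M.logH i := by
  have h1 := M.one_le_size hH
  have h2 : (1 : ℝ) ≤ 2 ^ i := one_le_pow₀ (by norm_num)
  refine log_thirtyTwo_ge.trans (Real.log_le_log (by norm_num) ?_)
  nlinarith [mul_nonneg (by linarith : 0 ≤ M.size - 1) (by linarith : (0 : ℝ) ≤ 2 ^ i - 1)]

end MDP

/-! ### The concentration event and its probability. -/

section GoodEvent

variable {Ω S A : Type*} [Fintype S] [Fintype A] [Nonempty S] [Nonempty A]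

open MDP

/-- The concentration event: the transition frequencies are accurate at all dyadic scales, and the
deviations of the observations are bounded in all valid blocks; the bound for the Hoeffding bonus
holds from the block `i₀` on. -/
structure Good (I : Interaction Ω S A) (M : MDP S A) (σ : ℕ → S → A → ℝ) (V Vα : ℝ) (K : ℕ)
    (c₁ c₂ : ℝ) (Λ : ℕ → ℝ) (δ : ℝ) (i₀ : ℕ) (ω : Ω) : Prop where
  trans : ∀ i ∈ Finset.range (Nat.clog 2 (K * M.H) + 1), ∀ s a x, ∀ k ∈ Set.Icc 1 K,
    |I.pdev M x k ω s a|
      ≤ (1 / 2) ^ i * (I.count M.H k ω s a * M.P s a x) + 2 ^ i * (2 * M.ell K δ)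
  scale : ∀ i ∈ Finset.range (Nat.log 2 K + 1), M.ValidScale σ V Vα (M.theta K V c₁ Λ δ i) →
    ∀ h ∈ Finset.Icc 1 M.H, ∀ s a, ∀ b : Bool, ∀ k ∈ Set.Icc 1 K,
    M.theta K V c₁ Λ δ i * I.dev M (if b then 1 else -1)
        (if b then 0 else M.quasiErr σ M.optPolicy (M.theta K V c₁ Λ δ i) (h + 1)) h k ω s a
      - M.theta K V c₁ Λ δ i ^ 2 * (5 / 8 * σ h s a ^ 2 + 5 * M.var
        (if b then 0 else M.quasiErr σ M.optPolicy (M.theta K V c₁ Λ δ i) (h + 1)) s a)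
        * I.count M.H k ω s a ≤ 2 * M.ell (2 ^ i) δ
  hoeffding : ∀ i ∈ Finset.Ico i₀ (Nat.log 2 K + 1),
    M.ValidScale σ V Vα (M.theta K V c₁ Λ δ i) →
    ∀ j ∈ Finset.range (Nat.log 2 (2 ^ (i + 1) * M.H) + 1), c₂ ^ 2 * M.logH i < 2 ^ (j + 1) →
    ∀ h ∈ Finset.Icc 1 M.H, ∀ s a, ∀ b : Bool, ∀ k ∈ Set.Icc 1 K,
    M.lamH V c₂ i j * I.dev M (if b then 1 else -1)
        (if b then 0 else M.quasiErr σ M.optPolicy (M.theta K V c₁ Λ δ i) (h + 1)) h k ω s a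
      - M.lamH V c₂ i j ^ 2 * (5 / 8 * σ h s a ^ 2 + 5 * M.var
        (if b then 0 else M.quasiErr σ M.optPolicy (M.theta K V c₁ Λ δ i) (h + 1)) s a)
        * I.count M.H k ω s a ≤ 2 / 5 * c₂ ^ 2 * M.logH i

variable [MeasurableSpace Ω] {μ : Measure Ω} [IsProbabilityMeasure μ]
  {I : Interaction Ω S A} {M : MDP S A} {σ : ℕ → S → A → ℝ} {V Vα : ℝ} {K : ℕ} {c₁ c₂ : ℝ}
  {Λ : ℕ → ℝ} {δ : ℝ}

lemma Setup.one_le_H (hs : Setup μ I M σ V Vα K c₁ c₂ Λ δ) : 1 ≤ M.H := by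
  have := hs.two_le
  by_contra h
  have : M.H = 0 := by omega
  simp_all

lemma Setup.one_le_K (hs : Setup μ I M σ V Vα K c₁ c₂ Λ δ) : 1 ≤ K := by
  have := hs.two_le
  by_contra h
  have : K = 0 := by omega
  simp_all

lemma Setup.log_pos (hs : Setup μ I M σ V Vα K c₁ c₂ Λ δ) : 0 < Real.log (K * M.H) := by
  have : (2 : ℝ) ≤ K * M.H := by exact_mod_cast hs.two_le
  exact Real.log_pos (by linarith)

lemma Setup.three_le_Λ (hs : Setup μ I M σ V Vα K c₁ c₂ Λ δ) {k : ℕ} (hk : 1 ≤ k) : 3 ≤ Λ k := by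
  refine le_trans ?_ (hs.le_Λ k hk)
  have h1 := M.one_le_size hs.one_le_H
  have h2 : 0 ≤ Real.log k := Real.log_natCast_nonneg k
  refine log_thirtyTwo_ge.trans (Real.log_le_log (by norm_num) ?_)
  nlinarith [mul_nonneg (by linarith : 0 ≤ M.size - 1) h2]

lemma Setup.eqoC1_pos (hs : Setup μ I M σ V Vα K c₁ c₂ Λ δ) {k : ℕ} (hk : 1 ≤ k) :
    0 < M.eqoC1 K V c₁ Λ k := by
  have h1 := hs.c₁_pos
  have h2 := hs.V_pos
  have h3 := hs.three_le_Λ hk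
  have h4 := hs.log_pos
  have h5 : (0 : ℝ) < Fintype.card S := by exact_mod_cast Fintype.card_pos
  have h6 : (0 : ℝ) < Fintype.card A := by exact_mod_cast Fintype.card_pos
  have h7 : (0 : ℝ) < k := by exact_mod_cast hk
  have h8 : 0 < Λ k := by linarith
  rw [eqoC1]; positivity

lemma Setup.theta_pos (hs : Setup μ I M σ V Vα K c₁ c₂ Λ δ) (i : ℕ) :
    0 < M.theta K V c₁ Λ δ i := by
  have h1 := M.three_le_ell hs.one_le_H (k := 2 ^ i) hs.δ_pos hs.δ_le
  exact div_pos (by linarith) (hs.eqoC1_pos Nat.one_le_two_pow)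

lemma Setup.Vα_nonneg (hs : Setup μ I M σ V Vα K c₁ c₂ Λ δ) : 0 ≤ Vα := hs.subExp.2.1

lemma Setup.Vα_le (hs : Setup μ I M σ V Vα K c₁ c₂ Λ δ) : Vα ≤ V :=
  M.alpha_le σ hs.V_pos hs.Vα_nonneg hs.sigmaMax_le

lemma abs_quasiErr_ite_le (hs : Setup μ I M σ V Vα K c₁ c₂ Λ δ) {i : ℕ}
    (hv : M.ValidScale σ V Vα (M.theta K V c₁ Λ δ i)) {h : ℕ} (b : Bool) (x s : S) (a : A) :
    |(if b then 0 else M.quasiErr σ M.optPolicy (M.theta K V c₁ Λ δ i) (h + 1) : S → ℝ) x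
      - M.PV (if b then 0 else M.quasiErr σ M.optPolicy (M.theta K V c₁ Λ δ i) (h + 1)) s a|
      ≤ 2 * M.theta K V c₁ Λ δ i * M.Wdiff σ := by
  have h1 := hs.theta_pos i
  have h2 := M.Wdiff_nonneg σ hs.one_le_H
  cases b with
  | true =>
    simp only [if_true]
    have : M.PV (0 : S → ℝ) s a = 0 := M.PV_zero s a
    rw [this]; simp only [Pi.zero_apply, sub_zero, abs_zero]; positivity
  | false => exact abs_quasiErr_sub_PV_le h1.le hv.2.1 hs.one_le_H (by omega) x s a

/-- The bound 3/4 keeps the exponent admissible: (5/4)(3/4) ≤ 1 for the observations, as Vα ≤ V, and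
10 (3/4) / 16 ≤ 1 for the error function, as θ W^* ≤ V / 16. -/
lemma lamH_le (hs : Setup μ I M σ V Vα K c₁ c₂ Λ δ) {i j : ℕ}
    (hj : c₂ ^ 2 * M.logH i < 2 ^ (j + 1)) : 0 ≤ M.lamH V c₂ i j ∧ M.lamH V c₂ i j * V ≤ 3 / 4 := by
  have h1 := hs.V_pos
  have h2 := hs.two_le_c₂
  have h3 := M.three_le_logH hs.one_le_H i
  have hj0 : (0 : ℝ) < 2 ^ j := by positivity
  have h4 : c₂ * √(M.logH i) ≤ 3 / 2 * √(2 ^ j) := by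
    refine abs_le_of_sq_le_sq' ?_ (by positivity) |>.2
    rw [mul_pow, mul_pow, Real.sq_sqrt (by linarith), Real.sq_sqrt hj0.le]
    rw [pow_succ (2 : ℝ) j] at hj
    linarith
  refine ⟨by rw [lamH]; positivity, ?_⟩
  rw [lamH, div_mul_eq_mul_div, div_le_iff₀ (by positivity)]
  nlinarith

lemma measure_not_trans_le (hs : Setup μ I M σ V Vα K c₁ c₂ Λ δ) :
    μ {ω | ¬ ∀ i ∈ Finset.range (Nat.clog 2 (K * M.H) + 1), ∀ s a x, ∀ k ∈ Set.Icc 1 K,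
      |I.pdev M x k ω s a|
        ≤ (1 / 2) ^ i * (I.count M.H k ω s a * M.P s a x) + 2 ^ i * (2 * M.ell K δ)}
      ≤ ENNReal.ofReal (δ / 8) := by
  classical
  let E : ℕ × (S × A × S × Bool) → Set Ω := fun q => {ω | ∃ k ∈ Set.Icc 1 K, 2 * M.ell K δ ≤
    (1 / 2) ^ q.1 * ((if q.2.2.2.2 then 1 else -1) * I.pdev M q.2.2.2.1 k ω q.2.1 q.2.2.1)
      - ((1 / 2) ^ q.1) ^ 2 * M.P q.2.1 q.2.2.1 q.2.2.2.1 * I.count M.H k ω q.2.1 q.2.2.1}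
  let J : Finset (ℕ × (S × A × S × Bool)) := Finset.range (Nat.clog 2 (K * M.H) + 1) ×ˢ Finset.univ
  have h1 : μ (⋃ q ∈ J, E q) ≤ ENNReal.ofReal (∑ q ∈ J, Real.exp (-(2 * M.ell K δ))) := by
    refine measure_biUnion_le_ofReal J (fun _ _ => Real.exp_nonneg _) fun q _ => ?_
    refine Interaction.measure_pdev_le hs.follows hs.one_le_H (by positivity)
      (pow_le_one₀ (by norm_num) (by norm_num)) ?_ _ _ _ K _
    split_ifs <;> simp
  refine (measure_mono ?_).trans (h1.trans (ENNReal.ofReal_le_ofReal ?_))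
  · intro ω hω
    simp only [Set.mem_ofPred_eq] at hω
    push Not at hω
    obtain ⟨i, hi, s, a, x, k, hk, hlt⟩ := hω
    have key : ∀ b : Bool, (1 / 2) ^ i * (I.count M.H k ω s a * M.P s a x) + 2 ^ i * (2 * M.ell K δ)
        < (if b then 1 else -1) * I.pdev M x k ω s a → ω ∈ ⋃ q ∈ J, E q := by
      intro b hb
      refine Set.mem_iUnion₂.2 ⟨(i, s, a, x, b), Finset.mem_product.2
        ⟨hi, Finset.mem_univ _⟩, k, hk, ?_⟩
      have h2 : (1 / 2 : ℝ) ^ i * 2 ^ i = 1 := by rw [← mul_pow]; norm_num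
      have h3 : (0 : ℝ) < (1 / 2) ^ i := by positivity
      have h4 := mul_lt_mul_of_pos_left hb h3
      simp only
      have h5 : (1 / 2 : ℝ) ^ i * ((1 / 2) ^ i * (I.count M.H k ω s a * M.P s a x)
          + 2 ^ i * (2 * M.ell K δ)) = ((1 / 2) ^ i) ^ 2 * M.P s a x * I.count M.H k ω s a
          + ((1 / 2 : ℝ) ^ i * 2 ^ i) * (2 * M.ell K δ) := by ring
      rw [h5, h2, one_mul] at h4
      linarith
    rcases le_total 0 (I.pdev M x k ω s a) with h0 | h0
    · rw [abs_of_nonneg h0] at hlt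
      exact key true (by simpa using hlt)
    · rw [abs_of_nonpos h0] at hlt
      exact key false (by simpa using hlt)
  · rw [Finset.sum_const, M.exp_neg_two_ell hs.one_le_H hs.δ_pos, nsmul_eq_mul]
    have hcard : J.card = (Nat.clog 2 (K * M.H) + 1) *
        (Fintype.card S * (Fintype.card A * (Fintype.card S * 2))) := by
      simp [J, Finset.card_product]
    set n := Nat.clog 2 (K * M.H)
    -- The number of scales is logarithmic in K H; log H is bounded by H so that only a logarithm of
    -- K remains.
    have hn : (n : ℝ) + 1 ≤ 4 * M.H * (1 + Real.log K) := by
      have hH1 : (1 : ℝ) ≤ M.H := by exact_mod_cast hs.one_le_H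
      have hK1 : (1 : ℝ) ≤ K := by exact_mod_cast hs.one_le_K
      have hlK := Real.log_nonneg hK1
      have hpow : (2 : ℝ) ^ (n - 1) ≤ K * M.H := by
        have := Nat.pow_pred_clog_lt_self (b := 2) (by norm_num) (x := K * M.H)
          (by have := hs.two_le; omega)
        exact_mod_cast this.le
      have hlog := Real.log_le_log (by positivity) hpow
      rw [Real.log_pow, Real.log_mul (by positivity) (by positivity)] at hlog
      have hlH : Real.log M.H ≤ M.H - 1 := Real.log_le_sub_one_of_pos (by positivity)
      have h2 := Real.log_two_gt_d9
      have hn1 : (n : ℝ) ≤ ((n - 1 : ℕ) : ℝ) + 1 := by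
        have : n ≤ n - 1 + 1 := by omega
        exact_mod_cast this
      have h3 : (0 : ℝ) ≤ ((n - 1 : ℕ) : ℝ) := by positivity
      nlinarith [mul_nonneg (by linarith : (0 : ℝ) ≤ M.H - 1) hlK]
    have hsz := M.one_le_size hs.one_le_H
    rw [hcard]
    push_cast
    have hS : (1 : ℝ) ≤ Fintype.card S := by exact_mod_cast Fintype.card_pos
    have hA : (1 : ℝ) ≤ Fintype.card A := by exact_mod_cast Fintype.card_pos
    have hH1 : (1 : ℝ) ≤ M.H := by exact_mod_cast hs.one_le_H
    have hlK : 0 ≤ Real.log K := Real.log_natCast_nonneg K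
    have hδ := hs.δ_pos
    have hδ1 := hs.δ_le
    -- The union runs over two states per action, hence S² A; this fits into (H S A)², which the
    -- square in exp (-2 ℓ) supplies.
    have hsize : (Fintype.card S : ℝ) * (Fintype.card A * (Fintype.card S * 2)) * M.H
        ≤ 2 * M.size ^ 2 := by
      rw [size]
      have : (1 : ℝ) ≤ M.H * Fintype.card A := by nlinarith
      calc (Fintype.card S : ℝ) * (Fintype.card A * (Fintype.card S * 2)) * M.H
          = 2 * (Fintype.card S ^ 2 * (M.H * Fintype.card A)) * 1 := by ring
        _ ≤ 2 * (Fintype.card S ^ 2 * (M.H * Fintype.card A)) * (M.H * Fintype.card A) := by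
            gcongr
        _ = _ := by ring
    calc ((n : ℝ) + 1) * (Fintype.card S * (Fintype.card A * (Fintype.card S * 2)))
          * (δ / (32 * M.size * (1 + Real.log K))) ^ 2
        ≤ (4 * M.H * (1 + Real.log K)) * (Fintype.card S * (Fintype.card A * (Fintype.card S * 2)))
          * (δ / (32 * M.size * (1 + Real.log K))) ^ 2 := by gcongr
      _ = 4 * (1 + Real.log K) * (Fintype.card S * (Fintype.card A * (Fintype.card S * 2)) * M.H)
          * (δ / (32 * M.size * (1 + Real.log K))) ^ 2 := by ring
      _ ≤ 4 * (1 + Real.log K) * (2 * M.size ^ 2)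
          * (δ / (32 * M.size * (1 + Real.log K))) ^ 2 := by gcongr
      _ = 1 / 128 * (δ * (δ / (1 + Real.log K))) := by
          field_simp
          norm_num
      _ ≤ 1 / 128 * (δ * 1) := by
          gcongr
          rw [div_le_one (by positivity)]; linarith
      _ ≤ δ / 8 := by linarith

lemma measure_not_scale_le (hs : Setup μ I M σ V Vα K c₁ c₂ Λ δ) :
    μ {ω | ¬ ∀ i ∈ Finset.range (Nat.log 2 K + 1), M.ValidScale σ V Vα (M.theta K V c₁ Λ δ i) →
    ∀ h ∈ Finset.Icc 1 M.H, ∀ s a, ∀ b : Bool, ∀ k ∈ Set.Icc 1 K,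
    M.theta K V c₁ Λ δ i * I.dev M (if b then 1 else -1)
        (if b then 0 else M.quasiErr σ M.optPolicy (M.theta K V c₁ Λ δ i) (h + 1)) h k ω s a
      - M.theta K V c₁ Λ δ i ^ 2 * (5 / 8 * σ h s a ^ 2 + 5 * M.var
        (if b then 0 else M.quasiErr σ M.optPolicy (M.theta K V c₁ Λ δ i) (h + 1)) s a)
        * I.count M.H k ω s a ≤ 2 * M.ell (2 ^ i) δ}
      ≤ ENNReal.ofReal (δ / 8) := by
  classical
  let E : ℕ × (ℕ × (S × A × Bool)) → Set Ω := fun q =>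
    {ω | M.ValidScale σ V Vα (M.theta K V c₁ Λ δ q.1) ∧ ∃ k ∈ Set.Icc 1 K, 2 * M.ell (2 ^ q.1) δ ≤
    M.theta K V c₁ Λ δ q.1 * I.dev M (if q.2.2.2.2 then 1 else -1)
        (if q.2.2.2.2 then 0 else M.quasiErr σ M.optPolicy (M.theta K V c₁ Λ δ q.1) (q.2.1 + 1))
          q.2.1 k ω q.2.2.1 q.2.2.2.1
      - M.theta K V c₁ Λ δ q.1 ^ 2 * (5 / 8 * σ q.2.1 q.2.2.1 q.2.2.2.1 ^ 2 + 5 * M.var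
        (if q.2.2.2.2 then 0 else M.quasiErr σ M.optPolicy (M.theta K V c₁ Λ δ q.1) (q.2.1 + 1))
          q.2.2.1 q.2.2.2.1)
        * I.count M.H k ω q.2.2.1 q.2.2.2.1}
  let J : Finset (ℕ × (ℕ × (S × A × Bool))) :=
    Finset.range (Nat.log 2 K + 1) ×ˢ (Finset.Icc 1 M.H ×ˢ Finset.univ)
  have h1 : μ (⋃ q ∈ J, E q) ≤ ENNReal.ofReal (∑ q ∈ J, Real.exp (-(2 * M.ell (2 ^ q.1) δ))) := by
    refine measure_biUnion_le_ofReal J (fun _ _ => Real.exp_nonneg _) fun q hq => ?_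
    have hh : q.2.1 ∈ Set.Icc 1 M.H := by
      have := (Finset.mem_product.1 (Finset.mem_product.1 hq).2).1
      simpa using this
    by_cases hv : M.ValidScale σ V Vα (M.theta K V c₁ Λ δ q.1)
    · simp only [E, hv, true_and]
      refine Interaction.measure_dev_le hs.follows hs.one_le_H hs.subExp hh (hs.theta_pos _).le hv.1
        ?_ (fun x => ?_) K _
      · split_ifs <;> simp
      · have h2 := abs_quasiErr_ite_le hs hv (h := q.2.1) q.2.2.2.2 x q.2.2.1 q.2.2.2.1
        have h3 := hs.theta_pos q.1
        have h4 := hv.2.1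
        calc _ ≤ 5 * M.theta K V c₁ Λ δ q.1 * (2 * M.theta K V c₁ Λ δ q.1 * M.Wdiff σ) := by gcongr
          _ = 10 * (M.theta K V c₁ Λ δ q.1 ^ 2 * M.Wdiff σ) := by ring
          _ ≤ 1 := by linarith
    · simp [E, hv]
  refine (measure_mono ?_).trans (h1.trans (ENNReal.ofReal_le_ofReal ?_))
  · intro ω hω
    simp only [Set.mem_ofPred_eq] at hω
    push Not at hω
    obtain ⟨i, hi, hv, h, hh, s, a, b, k, hk, hlt⟩ := hω
    exact Set.mem_iUnion₂.2 ⟨(i, h, s, a, b), Finset.mem_product.2 ⟨hi, Finset.mem_product.2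
      ⟨hh, Finset.mem_univ _⟩⟩, hv, k, hk, hlt.le⟩
  · have hsz := M.one_le_size hs.one_le_H
    have hδ := hs.δ_pos
    have hδ1 := hs.δ_le
    have hl2 := Real.log_two_gt_d9
    -- The probabilities decay like 1 / (i + 1)² and are dominated by a telescoping series, so the
    -- number of blocks does not enter.
    have hterm : ∀ i : ℕ, 2 * M.size * Real.exp (-(2 * M.ell (2 ^ i) δ))
        ≤ δ / 64 * (1 / ((i : ℝ) + 1) - 1 / (((i + 1 : ℕ) : ℝ) + 1)) := by
      intro i
      rw [M.exp_neg_two_ell hs.one_le_H hs.δ_pos]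
      push_cast
      rw [Real.log_pow]
      have h3 : (2 / 3 : ℝ) * (i + 1) ≤ 1 + i * Real.log 2 := by
        have : (0 : ℝ) ≤ i := by positivity
        nlinarith
      have h4 : (0 : ℝ) < 2 / 3 * (i + 1) := by positivity
      calc 2 * M.size * (δ / (32 * M.size * (1 + i * Real.log 2))) ^ 2
          ≤ 2 * M.size * (δ / (32 * M.size * (2 / 3 * (i + 1)))) ^ 2 := by gcongr
        _ = δ / 64 * ((9 / 32 * (δ / M.size)) / (i + 1) ^ 2) := by
            field_simp
            norm_num
        _ ≤ δ / 64 * (1 / 2 / (i + 1) ^ 2) := by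
            have : δ / M.size ≤ 1 := by rw [div_le_one (by positivity)]; linarith
            gcongr
            linarith
        _ ≤ δ / 64 * (1 / ((i : ℝ) + 1) - 1 / ((i : ℝ) + 1 + 1)) := by
            gcongr
            rw [div_sub_div _ _ (by positivity) (by positivity), div_div,
              div_le_div_iff₀ (by positivity) (by positivity)]
            nlinarith [(by positivity : (0 : ℝ) ≤ i)]
    have hsum : ∑ q ∈ J, Real.exp (-(2 * M.ell (2 ^ q.1) δ))
        = ∑ i ∈ Finset.range (Nat.log 2 K + 1), 2 * M.size * Real.exp (-(2 * M.ell (2 ^ i) δ)) := by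
      rw [Finset.sum_product]
      refine Finset.sum_congr rfl fun i _ => ?_
      change ∑ _y ∈ _, Real.exp (-(2 * M.ell (2 ^ i) δ)) = _
      rw [Finset.sum_const, nsmul_eq_mul, Finset.card_product]
      simp only [Nat.card_Icc, Nat.add_sub_cancel, Finset.card_univ, Fintype.card_prod,
        Fintype.card_bool, size]
      push_cast; ring
    rw [hsum]
    refine (Finset.sum_le_sum fun i _ => hterm i).trans ?_
    rw [← Finset.mul_sum, Finset.sum_range_sub' (fun i : ℕ => 1 / ((i : ℝ) + 1))]
    have : 0 ≤ 1 / (((Nat.log 2 K + 1 : ℕ) : ℝ) + 1) := by positivity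
    simp only [Nat.cast_zero, zero_add]
    nlinarith

lemma sq_le_four_mul_two_pow (m : ℕ) : m ^ 2 ≤ 4 * 2 ^ m := by
  induction m with
  | zero => norm_num
  | succ m ih =>
    rcases le_or_gt m 2 with h | h
    · interval_cases m <;> norm_num
    · rw [pow_succ 2 m]; nlinarith

/-- The first block in which the Hoeffding bonus is reliable. -/
noncomputable def firstBlock (c₂ δ : ℝ) : ℕ := ⌈40 * Real.log (1 / δ) / (c₂ ^ 2 * Real.log 2)⌉₊

/-- With n = 32 H S A 2^i and p = (2/5) c_2², each event has probability n^{-p}. At most √n count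
scales and O(H S A) pairs, steps and signs are involved, so n^{3/2 - p} ≤ δ is needed. The block is
late enough for δ ≥ n^{-p/16}, and (15/16) p ≥ 3/2 is p ≥ 8/5, that is, c_2 ≥ 2. The factor 2^{-i}
sums the blocks. -/
lemma hoeffding_union_le (hs : Setup μ I M σ V Vα K c₁ c₂ Λ δ) {i : ℕ}
    (hi : firstBlock c₂ δ ≤ i) :
    2 * M.size * ((Nat.log 2 (2 ^ (i + 1) * M.H) + 1 : ℕ) : ℝ)
      * Real.exp (-(2 / 5 * c₂ ^ 2 * M.logH i)) ≤ δ / 16 * (1 / 2) ^ i := by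
  have hsz := M.one_le_size hs.one_le_H
  have hc := hs.two_le_c₂
  have hδ := hs.δ_pos
  set n : ℝ := 32 * M.size * 2 ^ i with hn
  have hn0 : 0 < n := by positivity
  have hL : M.logH i = Real.log n := rfl
  set p := 2 / 5 * c₂ ^ 2 with hp
  have hp1 : 8 / 5 ≤ p := by nlinarith
  set m := Nat.log 2 (2 ^ (i + 1) * M.H) + 1 with hm
  have hmn : (m : ℝ) ≤ √n := by
    have h1 : (2 : ℝ) ^ m ≤ 2 * (2 ^ (i + 1) * M.H) := by
      have := Nat.pow_log_le_self 2 (x := 2 ^ (i + 1) * M.H)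
        (Nat.mul_pos (by positivity) hs.one_le_H).ne'
      rw [hm, pow_succ, mul_comm]
      gcongr
      exact_mod_cast this
    have h2 : (m : ℝ) ^ 2 ≤ 4 * 2 ^ m := by exact_mod_cast sq_le_four_mul_two_pow m
    have h3 : (M.H : ℝ) ≤ M.size := by
      have hS : (1 : ℝ) ≤ Fintype.card S := by exact_mod_cast Fintype.card_pos
      have hA : (1 : ℝ) ≤ Fintype.card A := by exact_mod_cast Fintype.card_pos
      rw [size, mul_assoc]
      exact le_mul_of_one_le_right (by positivity) (by nlinarith)
    refine Real.le_sqrt_of_sq_le (h2.trans ?_)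
    calc 4 * (2 : ℝ) ^ m ≤ 4 * (2 * (2 ^ (i + 1) * M.H)) := by gcongr
      _ = 16 * M.H * 2 ^ i := by ring
      _ ≤ n := by rw [hn]; gcongr; norm_num
  have hlog2 : 0 < Real.log 2 := Real.log_pos (by norm_num)
  have hLi : i * Real.log 2 ≤ Real.log n := by
    rw [← Real.log_pow]
    refine Real.log_le_log (by positivity) ?_
    rw [hn]; exact le_mul_of_one_le_left (by positivity) (by linarith)
  -- This is the origin of the 40 in `firstBlock`: p / 16 = c_2² / 40.
  have hLδ : Real.log (1 / δ) ≤ p / 16 * Real.log n := by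
    have h1 : 40 * Real.log (1 / δ) / (c₂ ^ 2 * Real.log 2) ≤ i :=
      (Nat.le_ceil _).trans (by exact_mod_cast hi)
    rw [div_le_iff₀ (by positivity)] at h1
    calc Real.log (1 / δ) ≤ c₂ ^ 2 / 40 * (i * Real.log 2) := by linarith
      _ ≤ c₂ ^ 2 / 40 * Real.log n := by gcongr
      _ = p / 16 * Real.log n := by rw [hp]; ring
  have hLn : 0 ≤ Real.log n := (mul_nonneg (by positivity) hlog2.le).trans hLi
  have hexp : n * √n * Real.exp (-(p * Real.log n)) ≤ δ := by
    have e1 : √n = Real.exp (1 / 2 * Real.log n) := by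
      rw [Real.sqrt_eq_rpow, Real.rpow_def_of_pos hn0, mul_comm]
    calc n * √n * Real.exp (-(p * Real.log n))
        = Real.exp (Real.log n + 1 / 2 * Real.log n + -(p * Real.log n)) := by
          rw [Real.exp_add, Real.exp_add, Real.exp_log hn0, e1]
      _ ≤ Real.exp (-Real.log (1 / δ)) := by
          refine Real.exp_le_exp.2 ?_
          nlinarith
      _ = δ := by rw [one_div, Real.log_inv, neg_neg, Real.exp_log hδ]
  have h2i : (1 / 2 : ℝ) ^ i * 2 ^ i = 1 := by rw [← mul_pow]; norm_num
  calc 2 * M.size * (m : ℝ) * Real.exp (-(p * M.logH i))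
      ≤ 2 * M.size * √n * Real.exp (-(p * M.logH i)) := by gcongr
    _ = 1 / 16 * ((1 / 2 : ℝ) ^ i * 2 ^ i) * (32 * M.size) * √n * Real.exp (-(p * M.logH i)) := by
        rw [h2i]; ring
    _ = 1 / 16 * (1 / 2) ^ i * (n * √n * Real.exp (-(p * Real.log n))) := by rw [hL, hn]; ring
    _ ≤ 1 / 16 * (1 / 2) ^ i * δ := by gcongr
    _ = _ := by ring

lemma measure_not_hoeffding_le (hs : Setup μ I M σ V Vα K c₁ c₂ Λ δ) :
    μ {ω | ¬ ∀ i ∈ Finset.Ico (firstBlock c₂ δ) (Nat.log 2 K + 1),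
    M.ValidScale σ V Vα (M.theta K V c₁ Λ δ i) →
    ∀ j ∈ Finset.range (Nat.log 2 (2 ^ (i + 1) * M.H) + 1), c₂ ^ 2 * M.logH i < 2 ^ (j + 1) →
    ∀ h ∈ Finset.Icc 1 M.H, ∀ s a, ∀ b : Bool, ∀ k ∈ Set.Icc 1 K,
    M.lamH V c₂ i j * I.dev M (if b then 1 else -1)
        (if b then 0 else M.quasiErr σ M.optPolicy (M.theta K V c₁ Λ δ i) (h + 1)) h k ω s a
      - M.lamH V c₂ i j ^ 2 * (5 / 8 * σ h s a ^ 2 + 5 * M.var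
        (if b then 0 else M.quasiErr σ M.optPolicy (M.theta K V c₁ Λ δ i) (h + 1)) s a)
        * I.count M.H k ω s a ≤ 2 / 5 * c₂ ^ 2 * M.logH i}
      ≤ ENNReal.ofReal (δ / 8) := by
  classical
  let E : (Σ _ : ℕ, ℕ × (ℕ × (S × A × Bool))) → Set Ω := fun q =>
    {ω | (M.ValidScale σ V Vα (M.theta K V c₁ Λ δ q.1) ∧ c₂ ^ 2 * M.logH q.1 < 2 ^ (q.2.1 + 1)) ∧
      ∃ k ∈ Set.Icc 1 K, 2 / 5 * c₂ ^ 2 * M.logH q.1 ≤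
    M.lamH V c₂ q.1 q.2.1 * I.dev M (if q.2.2.2.2.2 then 1 else -1)
        (if q.2.2.2.2.2 then 0 else M.quasiErr σ M.optPolicy (M.theta K V c₁ Λ δ q.1) (q.2.2.1 + 1))
          q.2.2.1 k ω q.2.2.2.1 q.2.2.2.2.1
      - M.lamH V c₂ q.1 q.2.1 ^ 2 * (5 / 8 * σ q.2.2.1 q.2.2.2.1 q.2.2.2.2.1 ^ 2 + 5 * M.var
        (if q.2.2.2.2.2 then 0 else M.quasiErr σ M.optPolicy (M.theta K V c₁ Λ δ q.1) (q.2.2.1 + 1))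
          q.2.2.2.1 q.2.2.2.2.1)
        * I.count M.H k ω q.2.2.2.1 q.2.2.2.2.1}
  let J : Finset (Σ _ : ℕ, ℕ × (ℕ × (S × A × Bool))) :=
    (Finset.Ico (firstBlock c₂ δ) (Nat.log 2 K + 1)).sigma fun i =>
      Finset.range (Nat.log 2 (2 ^ (i + 1) * M.H) + 1) ×ˢ (Finset.Icc 1 M.H ×ˢ Finset.univ)
  have h1 : μ (⋃ q ∈ J, E q)
      ≤ ENNReal.ofReal (∑ q ∈ J, Real.exp (-(2 / 5 * c₂ ^ 2 * M.logH q.1))) := by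
    refine measure_biUnion_le_ofReal J (fun _ _ => Real.exp_nonneg _) fun q hq => ?_
    have hh : q.2.2.1 ∈ Set.Icc 1 M.H := by
      have := (Finset.mem_product.1 (Finset.mem_product.1 (Finset.mem_sigma.1 hq).2).2).1
      simpa using this
    by_cases hv : M.ValidScale σ V Vα (M.theta K V c₁ Λ δ q.1) ∧
        c₂ ^ 2 * M.logH q.1 < 2 ^ (q.2.1 + 1)
    · simp only [E, hv, true_and]
      obtain ⟨hl0, hl⟩ := lamH_le hs hv.2
      refine Interaction.measure_dev_le hs.follows hs.one_le_H hs.subExp hh hl0 ?_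
        ?_ (fun x => ?_) K _
      · have := mul_le_mul_of_nonneg_left hs.Vα_le hl0
        nlinarith
      · split_ifs <;> simp
      · have h2 := abs_quasiErr_ite_le hs hv.1 (h := q.2.2.1) q.2.2.2.2.2 x q.2.2.2.1 q.2.2.2.2.1
        have h3 := hs.theta_pos q.1
        have h4 := hv.1.2.2
        have h5 : M.theta K V c₁ Λ δ q.1 * M.Wdiff σ ≤ V / 16 :=
          (mul_le_mul_of_nonneg_left (M.Wdiff_le_Wstar σ hs.one_le_H) h3.le).trans h4
        calc _ ≤ 5 * M.lamH V c₂ q.1 q.2.1 * (2 * M.theta K V c₁ Λ δ q.1 * M.Wdiff σ) := by gcongr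
          _ = 10 * M.lamH V c₂ q.1 q.2.1 * (M.theta K V c₁ Λ δ q.1 * M.Wdiff σ) := by ring
          _ ≤ 10 * M.lamH V c₂ q.1 q.2.1 * (V / 16) := by gcongr
          _ ≤ 1 := by linarith
    · simp [E, hv]
  refine (measure_mono ?_).trans (h1.trans (ENNReal.ofReal_le_ofReal ?_))
  · intro ω hω
    simp only [Set.mem_ofPred_eq] at hω
    push Not at hω
    obtain ⟨i, hi, hv, j, hj, hij, h, hh, s, a, b, k, hk, hlt⟩ := hω
    exact Set.mem_iUnion₂.2 ⟨⟨i, j, h, s, a, b⟩, Finset.mem_sigma.2 ⟨hi, Finset.mem_product.2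
      ⟨hj, Finset.mem_product.2 ⟨hh, Finset.mem_univ _⟩⟩⟩, ⟨hv, hij⟩, k, hk, hlt.le⟩
  · have hδ := hs.δ_pos
    have hsum : ∑ q ∈ J, Real.exp (-(2 / 5 * c₂ ^ 2 * M.logH q.1))
        = ∑ i ∈ Finset.Ico (firstBlock c₂ δ) (Nat.log 2 K + 1),
          2 * M.size * ((Nat.log 2 (2 ^ (i + 1) * M.H) + 1 : ℕ) : ℝ)
            * Real.exp (-(2 / 5 * c₂ ^ 2 * M.logH i)) := by
      rw [Finset.sum_sigma]
      refine Finset.sum_congr rfl fun i _ => ?_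
      change ∑ _s ∈ _, Real.exp (-(2 / 5 * c₂ ^ 2 * M.logH i)) = _
      rw [Finset.sum_const, nsmul_eq_mul, Finset.card_product, Finset.card_product]
      simp only [Nat.card_Icc, Nat.add_sub_cancel, Finset.card_univ, Fintype.card_prod,
        Fintype.card_bool, size, Finset.card_range]
      push_cast; ring
    rw [hsum]
    calc _ ≤ ∑ i ∈ Finset.Ico (firstBlock c₂ δ) (Nat.log 2 K + 1), δ / 16 * (1 / 2) ^ i :=
          Finset.sum_le_sum fun i hi => hoeffding_union_le hs (Finset.mem_Ico.1 hi).1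
      _ ≤ ∑ i ∈ Finset.range (Nat.log 2 K + 1), δ / 16 * (1 / 2) ^ i :=
          Finset.sum_le_sum_of_subset_of_nonneg
            (fun i hi => Finset.mem_range.2 (Finset.mem_Ico.1 hi).2) fun i _ _ => by positivity
      _ ≤ δ / 16 * 2 := by
          rw [← Finset.mul_sum]
          gcongr
          exact sum_geometric_two_le _
      _ = δ / 8 := by ring

/-- The concentration event has a large probability. -/
lemma measure_not_good_le (hs : Setup μ I M σ V Vα K c₁ c₂ Λ δ) :
    μ {ω | ¬ Good I M σ V Vα K c₁ c₂ Λ δ (firstBlock c₂ δ) ω} ≤ ENNReal.ofReal (δ / 2) := by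
  have hδ := hs.δ_pos
  have h1 := measure_not_trans_le hs
  have h2 := measure_not_scale_le hs
  have h3 := measure_not_hoeffding_le hs
  refine le_trans (measure_mono ?_) ((measure_union_le _ _).trans
    (add_le_add ((measure_union_le _ _).trans (add_le_add h1 h2)) h3) |>.trans ?_)
  · intro ω hω
    by_contra hc
    simp only [Set.mem_union, Set.mem_ofPred_eq, not_or, not_not] at hc
    exact hω ⟨hc.1.1, hc.1.2, hc.2⟩
  · rw [← ENNReal.ofReal_add (by positivity) (by positivity),
      ← ENNReal.ofReal_add (by positivity) (by positivity)]
    exact ENNReal.ofReal_le_ofReal (by linarith)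

end GoodEvent

end EQO

namespace EQO

/-! ### Consequences of the concentration event for one episode. -/

section Episode

open MDP

variable {Ω S A : Type*} [Fintype S] [Fintype A] [Nonempty S] [Nonempty A] [MeasurableSpace Ω]
  {μ : Measure Ω} [IsProbabilityMeasure μ] {I : Interaction Ω S A} {M : MDP S A} {σ : ℕ → S → A → ℝ} {V Vα : ℝ} {K : ℕ}
  {c₁ c₂ : ℝ} {Λ : ℕ → ℝ} {δ : ℝ}

lemma Setup.eqoC1_mono (hs : Setup μ I M σ V Vα K c₁ c₂ Λ δ) {j k : ℕ} (hj : 1 ≤ j) (hjk : j ≤ k) :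
    M.eqoC1 K V c₁ Λ j ≤ M.eqoC1 K V c₁ Λ k := by
  have h1 := hs.c₁_pos
  have h2 := hs.V_pos
  have h3 := hs.three_le_Λ hj
  have h4 := hs.log_pos
  have h5 := hs.Λ_mono j k hj hjk
  have h6 : 0 ≤ Λ k := by linarith
  rw [eqoC1, eqoC1]; gcongr

lemma Setup.hoeffdingC2_mono (hs : Setup μ I M σ V Vα K c₁ c₂ Λ δ) {j k : ℕ} (hj : 1 ≤ j)
    (hjk : j ≤ k) : M.hoeffdingC2 V c₂ j ≤ M.hoeffdingC2 V c₂ k := by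
  have h1 := hs.two_le_c₂
  have h2 := hs.V_pos
  have h3 := M.one_le_size hs.one_le_H
  have h4 : (0 : ℝ) < j := by exact_mod_cast hj
  rw [hoeffdingC2, hoeffdingC2]; gcongr

lemma Setup.hoeffdingC2_nonneg (hs : Setup μ I M σ V Vα K c₁ c₂ Λ δ) (k : ℕ) :
    0 ≤ M.hoeffdingC2 V c₂ k := by
  have h1 := hs.two_le_c₂
  have h2 := hs.V_pos
  rw [hoeffdingC2]; positivity

lemma Setup.ell_mono (hs : Setup μ I M σ V Vα K c₁ c₂ Λ δ) {j k : ℕ} (hj : 1 ≤ j) (hjk : j ≤ k) :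
    M.ell j δ ≤ M.ell k δ := by
  have h3 := M.one_le_size hs.one_le_H
  have h4 : (0 : ℝ) < j := by exact_mod_cast hj
  have h5 := hs.δ_pos
  have h6 : 0 ≤ Real.log j := Real.log_natCast_nonneg j
  rw [ell, ell]; gcongr

lemma two_pow_log_le {k : ℕ} (hk : 1 ≤ k) : 2 ^ Nat.log 2 k ≤ k := Nat.pow_log_le_self 2 (by omega)

lemma Setup.logH_le (hs : Setup μ I M σ V Vα K c₁ c₂ Λ δ) {k : ℕ} (hk : 1 ≤ k) :
    M.logH (Nat.log 2 k) ≤ Real.log (32 * M.size * k) := by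
  have h3 := M.one_le_size hs.one_le_H
  have h4 : ((2 : ℝ) ^ Nat.log 2 k) ≤ k := by exact_mod_cast two_pow_log_le hk
  rw [logH]; gcongr

/-- The sum of the variance proxies of an observation. -/
lemma Setup.proxy_le (hs : Setup μ I M σ V Vα K c₁ c₂ Λ δ) {i : ℕ}
    (hv : M.ValidScale σ V Vα (M.theta K V c₁ Λ δ i)) {h : ℕ} (hh : h ∈ Set.Icc 1 M.H) (s : S)
    (a : A) (b : Bool) :
    5 / 8 * σ h s a ^ 2 + 5 * M.var
      (if b then 0 else M.quasiErr σ M.optPolicy (M.theta K V c₁ Λ δ i) (h + 1)) s a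
      ≤ 25 / 64 * V ^ 2 := by
  have h1 := M.sigma_sq_le σ hs.subExp.1 hs.sigmaMax_le hh s a
  have hθ := hs.theta_pos i
  have h2 : 2 * M.theta K V c₁ Λ δ i * M.Wdiff σ ≤ V / 8 := by
    have := mul_le_mul_of_nonneg_left (M.Wdiff_le_Wstar σ hs.one_le_H) hθ.le
    linarith [hv.2.2]
  have h3 := M.var_le_sq (c := V / 8) (s := s) (a := a)
    fun x => (abs_quasiErr_ite_le hs hv (h := h) b x s a).trans h2
  nlinarith

section

variable {ω : Ω} {k : ℕ}

/-- Dividing the exponential bound by θ turns 2 ℓ / θ into c_1 at the start of the block, which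
monotonicity bounds by c_{1,k}. The case `b = true` (upper deviations, no Y) serves the surpluses,
`b = false` (lower deviations plus the error function) quasi-optimism. -/
lemma Good.deviation_le (hs : Setup μ I M σ V Vα K c₁ c₂ Λ δ) {i₀ : ℕ}
    (hg : Good I M σ V Vα K c₁ c₂ Λ δ i₀ ω) (hk : k ∈ Set.Icc 1 K)
    (hv : M.ValidScale σ V Vα (M.theta K V c₁ Λ δ (Nat.log 2 k))) {h : ℕ}
    (hh : h ∈ Set.Icc 1 M.H) {s : S} {a : A} (hN : 0 < I.count M.H k ω s a) (b : Bool) :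
    I.dev M (if b then 1 else -1)
        (if b then 0 else M.quasiErr σ M.optPolicy (M.theta K V c₁ Λ δ (Nat.log 2 k)) (h + 1))
        h k ω s a / I.count M.H k ω s a
      ≤ M.theta K V c₁ Λ δ (Nat.log 2 k) * (5 / 8 * σ h s a ^ 2 + 5 * M.var
        (if b then 0 else M.quasiErr σ M.optPolicy (M.theta K V c₁ Λ δ (Nat.log 2 k)) (h + 1)) s a)
        + M.eqoC1 K V c₁ Λ k / I.count M.H k ω s a := by
  have h1 := hg.scale (Nat.log 2 k)
    (Finset.mem_range.2 (Nat.lt_succ_of_le (Nat.log_mono_right hk.2))) hv h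
    (Finset.mem_Icc.2 hh) s a b k hk
  have hθ := hs.theta_pos (Nat.log 2 k)
  have hc := hs.eqoC1_pos (k := 2 ^ Nat.log 2 k) Nat.one_le_two_pow
  have hcm := hs.eqoC1_mono (k := k) (j := 2 ^ Nat.log 2 k) Nat.one_le_two_pow (two_pow_log_le hk.1)
  have h2 : 2 * M.ell (2 ^ Nat.log 2 k) δ
      = M.theta K V c₁ Λ δ (Nat.log 2 k) * M.eqoC1 K V c₁ Λ (2 ^ Nat.log 2 k) := by
    rw [theta, div_mul_cancel₀ _ hc.ne']
  rw [h2] at h1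
  set θ := M.theta K V c₁ Λ δ (Nat.log 2 k)
  set N := I.count M.H k ω s a
  set d := I.dev M (if b then 1 else -1)
    (if b then 0 else M.quasiErr σ M.optPolicy θ (h + 1)) h k ω s a
  set v := 5 / 8 * σ h s a ^ 2 + 5 * M.var
    (if b then 0 else M.quasiErr σ M.optPolicy θ (h + 1)) s a
  have h3 : θ * d ≤ θ * (θ * v * N + M.eqoC1 K V c₁ Λ (2 ^ Nat.log 2 k)) := by linarith
  have h4 := le_of_mul_le_mul_left h3 hθ
  rw [div_le_iff₀ hN, add_mul, div_mul_cancel₀ _ hN.ne']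
  linarith

/-- The exponent is tuned to the dyadic size of the count, which turns λ · (proxy) N + log term / λ
into a multiple of √N. A bonus below V forces the count to be large compared to c_2² log, and this
is what makes the exponent admissible. -/
lemma Good.deviation_le_hoeffding (hs : Setup μ I M σ V Vα K c₁ c₂ Λ δ) {i₀ : ℕ}
    (hg : Good I M σ V Vα K c₁ c₂ Λ δ i₀ ω) (hk : k ∈ Set.Icc 1 K) (hi : i₀ ≤ Nat.log 2 k)
    (hv : M.ValidScale σ V Vα (M.theta K V c₁ Λ δ (Nat.log 2 k))) {h : ℕ}
    (hh : h ∈ Set.Icc 1 M.H) {s : S} {a : A} (hN : 0 < I.count M.H k ω s a)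
    (hb : M.hoeffdingC2 V c₂ k / √(I.count M.H k ω s a) < V) (b : Bool) :
    I.dev M (if b then 1 else -1)
        (if b then 0 else M.quasiErr σ M.optPolicy (M.theta K V c₁ Λ δ (Nat.log 2 k)) (h + 1))
        h k ω s a / I.count M.H k ω s a
      ≤ M.hoeffdingC2 V c₂ k / √(I.count M.H k ω s a) := by
  set i := Nat.log 2 k with hi_def
  have hk1 : 1 ≤ k := hk.1
  have hV := hs.V_pos
  have hc2 := hs.two_le_c₂
  have hL3 := M.three_le_logH hs.one_le_H i
  have hLk := hs.logH_le hk1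
  obtain ⟨n, hn⟩ : ∃ n : ℕ, I.count M.H k ω s a = n := by
    obtain ⟨k', rfl⟩ := Nat.exists_eq_add_of_le' hk1
    exact ⟨_, I.count_eq_cnt M.H hs.one_le_H _ ω s a⟩
  have hnle : n ≤ 2 ^ (i + 1) * M.H := by
    obtain ⟨k', rfl⟩ := Nat.exists_eq_add_of_le' hk1
    have h1 := I.count_le M.H hs.one_le_H k' ω s a
    rw [hn] at h1
    have h2 : n ≤ k' * M.H := by exact_mod_cast h1
    have h3 : k' + 1 < 2 ^ (i + 1) := Nat.lt_pow_succ_log_self (by norm_num) _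
    exact h2.trans (Nat.mul_le_mul_right _ (by omega))
  have hNR : (0 : ℝ) < n := by rw [← hn]; exact hN
  have hn0 : n ≠ 0 := by rintro rfl; simp at hNR
  set j := Nat.log 2 n with hj_def
  have hj1 : (2 : ℝ) ^ j ≤ n := by exact_mod_cast Nat.pow_log_le_self 2 hn0
  have hj2 : (n : ℝ) < 2 ^ (j + 1) := by
    exact_mod_cast Nat.lt_pow_succ_log_self (by norm_num) n
  have hjr : j ∈ Finset.range (Nat.log 2 (2 ^ (i + 1) * M.H) + 1) :=
    Finset.mem_range.2 (Nat.lt_succ_of_le (Nat.log_mono_right hnle))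
  have hlarge : c₂ ^ 2 * M.logH i < 2 ^ (j + 1) := by
    refine lt_of_le_of_lt ?_ hj2
    rw [hn, hoeffdingC2, div_lt_iff₀ (by positivity)] at hb
    have h1 : c₂ * √(Real.log (32 * M.size * k)) < √n := by
      refine lt_of_mul_lt_mul_left ?_ hV.le
      linarith
    have h2 := mul_self_lt_mul_self (by positivity) h1
    rw [Real.mul_self_sqrt hNR.le, mul_mul_mul_comm, Real.mul_self_sqrt (by linarith)] at h2
    nlinarith
  have h1 := hg.hoeffding i (Finset.mem_Ico.2
    ⟨hi, Nat.lt_succ_of_le (Nat.log_mono_right hk.2)⟩) hv j hjr hlarge h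
    (Finset.mem_Icc.2 hh) s a b k hk
  have hv1 := hs.proxy_le hv hh s a b
  set v := 5 / 8 * σ h s a ^ 2 + 5 * M.var
    (if b then 0 else M.quasiErr σ M.optPolicy (M.theta K V c₁ Λ δ i) (h + 1)) s a
  set d := I.dev M (if b then 1 else -1)
    (if b then 0 else M.quasiErr σ M.optPolicy (M.theta K V c₁ Λ δ i) (h + 1)) h k ω s a
  rw [hn] at h1 ⊢
  have hsq : 0 < √(n : ℝ) := Real.sqrt_pos.2 hNR
  refine le_trans ?_ (div_le_div_of_nonneg_right (a := c₂ * V * √(M.logH i))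
    (by rw [hoeffdingC2]; gcongr) hsq.le)
  set q := √((2 : ℝ) ^ j) with hq
  set z := √(n : ℝ) with hz
  have hq0 : 0 < q := Real.sqrt_pos.2 (by positivity)
  have hqz : q ≤ z := Real.sqrt_le_sqrt hj1
  have hqq : q ^ 2 = 2 ^ j := Real.sq_sqrt (by positivity)
  have hzz : z ^ 2 = n := Real.sq_sqrt hNR.le
  have hzq : z ≤ 3 / 2 * q := by
    refine abs_le_of_sq_le_sq' ?_ (by positivity) |>.2
    rw [mul_pow, hzz, hqq]; rw [pow_succ] at hj2; nlinarith [(by positivity : (0 : ℝ) < 2 ^ j)]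
  -- The loss from rounding the count to 2^j: the inequality holds for 1 ≤ z / q ≤ 3/2, and 25/128
  -- is half of the proxy constant 25/64.
  have hkey : 25 / 128 * z ^ 2 + 4 / 5 * q ^ 2 ≤ z * q := by
    nlinarith [mul_nonneg (sub_nonneg.2 hqz) (sub_nonneg.2 hzq), mul_self_le_mul_self hq0.le hqz]
  set L := M.logH i
  set r := √L with hr
  have hrr : r ^ 2 = L := Real.sq_sqrt (by linarith)
  have hr0 : 0 < r := Real.sqrt_pos.2 (by linarith)
  have hlam : M.lamH V c₂ i j = c₂ * r / (2 * V * q) := rfl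
  have hlam0 : 0 < M.lamH V c₂ i j := by rw [hlam]; positivity
  set l := M.lamH V c₂ i j
  have hlVq : l * (2 * V * q) = c₂ * r := by rw [hlam]; field_simp
  rw [← hzz, div_le_div_iff₀ (by positivity) (by positivity)]
  have h2 : l * d ≤ l * (c₂ * V * r * z) := by
    have e1 : l * d ≤ l ^ 2 * (25 / 64 * V ^ 2) * z ^ 2 + 2 / 5 * c₂ ^ 2 * L := by
      have : l ^ 2 * v * z ^ 2 ≤ l ^ 2 * (25 / 64 * V ^ 2) * z ^ 2 := by gcongr
      rw [← hzz] at h1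
      linarith
    have e2 : l ^ 2 * (25 / 64 * V ^ 2) * z ^ 2 + 2 / 5 * c₂ ^ 2 * L
        = 2 * l ^ 2 * V ^ 2 * (25 / 128 * z ^ 2 + 4 / 5 * q ^ 2) := by
      rw [← hrr, show 2 / 5 * c₂ ^ 2 * r ^ 2 = 2 / 5 * (c₂ * r) ^ 2 by ring, ← hlVq]; ring
    have e3 : l * (c₂ * V * r * z) = 2 * l ^ 2 * V ^ 2 * (z * q) := by
      rw [show l * (c₂ * V * r * z) = l * V * z * (c₂ * r) by ring, ← hlVq]; ring
    rw [e3]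
    refine e1.trans (e2.le.trans ?_)
    gcongr
  have h3 := le_of_mul_le_mul_left h2 hlam0
  calc d * z ≤ c₂ * V * r * z * z := by gcongr
    _ = _ := by ring

/-- The error of the estimated transition probabilities. -/
lemma Good.transition_le (hs : Setup μ I M σ V Vα K c₁ c₂ Λ δ) {i₀ : ℕ}
    (hg : Good I M σ V Vα K c₁ c₂ Λ δ i₀ ω) (hk : k ∈ Set.Icc 1 K) {s : S} {a : A}
    (hN : 0 < I.count M.H k ω s a) {f : S → ℝ} (hf : ∀ x, |f x| ≤ V) :
    ∑ x, I.pHat M.H k ω s a x * f x - M.PV f s a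
      ≤ M.var f s a / (8 * V) + 32 * Fintype.card S * V * M.ell K δ / I.count M.H k ω s a := by
  have hk1 : 1 ≤ k := hk.1
  have hell := M.three_le_ell hs.one_le_H (k := K) hs.δ_pos hs.δ_le
  have h1 := I.sum_pHat_sub_PV_le k ω s a M (V := V) (ℓ := 2 * M.ell K δ)
    (n := Nat.clog 2 (K * M.H)) hs.V_pos (by linarith) (I.one_le_count M.H hs.one_le_H hk1 hN) ?_
    (fun x i hi => hg.trans i (Finset.mem_range.2 (Nat.lt_succ_of_le hi)) s a x k hk) (f := f) ?_
  · refine h1.trans (le_of_eq ?_); ring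
  · obtain ⟨k', rfl⟩ := Nat.exists_eq_add_of_le' hk1
    refine (I.count_le M.H hs.one_le_H k' ω s a).trans ?_
    have h2 : k' * M.H ≤ K * M.H := Nat.mul_le_mul_right _ (by have := hk.2; omega)
    exact_mod_cast h2.trans (Nat.le_pow_clog (by norm_num) _)
  · intro x
    have h2 := M.PV_le_const (s := s) (a := a) fun x => (abs_le.1 (hf x)).2
    have h3 := M.const_le_PV (s := s) (a := a) fun x => (abs_le.1 (hf x)).1
    have h4 := abs_le.1 (hf x)
    rw [abs_le]; constructor <;> linarith

/-- Quasi-optimism on the concentration event. -/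
lemma Good.Vstar_sub_vEst_le (hs : Setup μ I M σ V Vα K c₁ c₂ Λ δ) {i₀ : ℕ}
    (hg : Good I M σ V Vα K c₁ c₂ Λ δ i₀ ω) (hk : k ∈ Set.Icc 1 K) (hi : i₀ ≤ Nat.log 2 k)
    (hv : M.ValidScale σ V Vα (M.theta K V c₁ Λ δ (Nat.log 2 k))) (h : ℕ) (s : S) (h1 : 1 ≤ h) :
    M.Vstar h s - I.vEst M.H V (M.eqoC1 K V c₁ Λ) (M.hoeffdingC2 V c₂) k ω (M.H + 1 - h) s
      ≤ 2 * M.theta K V c₁ Λ δ (Nat.log 2 k) * M.Wstar σ := by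
  have hθ := hs.theta_pos (Nat.log 2 k)
  refine le_trans ?_ (quasiErr_le (π := M.optPolicy) hθ.le hs.one_le_H h1 s)
  refine Interaction.Vstar_sub_vEst_le hs.bounded hs.V_pos.le
    (fun h s h1 => quasiErr_nonneg hθ.le hv.2.1 hs.one_le_H h1 s) ?_ h s h1
  intro h hh s hN hb
  have h2 := quasiErr_step (π := M.optPolicy) hθ.le hv.2.1 hh s
  have h3 : I.dev M (-1) (M.quasiErr σ M.optPolicy (M.theta K V c₁ Λ δ (Nat.log 2 k)) (h + 1))
        h k ω s (M.optPolicy h s) / I.count M.H k ω s (M.optPolicy h s)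
      ≤ M.theta K V c₁ Λ δ (Nat.log 2 k) * (5 / 8 * σ h s (M.optPolicy h s) ^ 2 + 5 * M.var
        (M.quasiErr σ M.optPolicy (M.theta K V c₁ Λ δ (Nat.log 2 k)) (h + 1)) s (M.optPolicy h s))
        + I.bonus M.H (M.eqoC1 K V c₁ Λ) (M.hoeffdingC2 V c₂) k ω s (M.optPolicy h s) := by
    -- Whichever of the two bonuses is active, its own concentration bound applies; with the
    -- Hoeffding bonus the leftover is not used.
    rcases le_total (M.eqoC1 K V c₁ Λ k / I.count M.H k ω s (M.optPolicy h s))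
        (M.hoeffdingC2 V c₂ k / √(I.count M.H k ω s (M.optPolicy h s))) with hle | hle
    · rw [Interaction.bonus, min_eq_left hle]
      simpa using hg.deviation_le hs hk hv hh hN false
    · rw [Interaction.bonus, min_eq_right hle] at hb ⊢
      have h4 := hg.deviation_le_hoeffding hs hk hi hv hh hN hb false
      have h5 := M.var_nonneg
        (M.quasiErr σ M.optPolicy (M.theta K V c₁ Λ δ (Nat.log 2 k)) (h + 1)) s (M.optPolicy h s)
      refine le_trans (by simpa using h4) (le_add_of_nonneg_left (by positivity))
  rw [I.dev_eq k ω s _ M _ _ h hN, mul_div_cancel_left₀ _ hN.ne'] at h3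
  linarith

/-- The estimates of an episode, as a function of the step. -/
lemma Setup.vEst_mem (hs : Setup μ I M σ V Vα K c₁ c₂ Λ δ) (hk : 1 ≤ k) (ω : Ω) (n : ℕ) (s : S) :
    0 ≤ I.vEst M.H V (M.eqoC1 K V c₁ Λ) (M.hoeffdingC2 V c₂) k ω n s ∧
      I.vEst M.H V (M.eqoC1 K V c₁ Λ) (M.hoeffdingC2 V c₂) k ω n s ≤ V :=
  ⟨Interaction.vEst_nonneg hs.V_pos.le (hs.eqoC1_pos hk).le (hs.hoeffdingC2_nonneg k) n s,
    Interaction.vEst_le hs.V_pos.le n s⟩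

/-- One step of the potential in terms of the deviation of the observations. -/
lemma Good.potF_step (hs : Setup μ I M σ V Vα K c₁ c₂ Λ δ) {i₀ : ℕ}
    (hg : Good I M σ V Vα K c₁ c₂ Λ δ i₀ ω) (hk : k ∈ Set.Icc 1 K) {h : ℕ}
    (hh : h ∈ Set.Icc 1 M.H) (s : S) (hN : 0 < I.count M.H k ω s (I.policy k ω h s)) {X D : ℝ}
    (hX0 : 0 ≤ X) (hX : I.dev M 1 0 h k ω s (I.policy k ω h s)
      / I.count M.H k ω s (I.policy k ω h s) ≤ X)
    (hD : X + I.bonus M.H (M.eqoC1 K V c₁ Λ) (M.hoeffdingC2 V c₂) k ω s (I.policy k ω h s) ≤ D) :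
    M.potF V (fun h => I.vEst M.H V (M.eqoC1 K V c₁ Λ) (M.hoeffdingC2 V c₂) k ω (M.H + 1 - h))
        (I.policy k ω) h s
      ≤ 2 * (D + 32 * Fintype.card S * V * M.ell K δ / I.count M.H k ω s (I.policy k ω h s))
        + M.PV (M.potF V
          (fun h => I.vEst M.H V (M.eqoC1 K V c₁ Λ) (M.hoeffdingC2 V c₂) k ω (M.H + 1 - h))
          (I.policy k ω) (h + 1)) s (I.policy k ω h s) := by
  have hV := hs.V_pos
  have hell := M.three_le_ell hs.one_le_H (k := K) hs.δ_pos hs.δ_le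
  have hb0 := Interaction.bonus_nonneg (I := I) (M := M) (ω := ω) (hs.eqoC1_pos hk.1).le
    (hs.hoeffdingC2_nonneg k) s (I.policy k ω h s)
  set v := I.vEst M.H V (M.eqoC1 K V c₁ Λ) (M.hoeffdingC2 V c₂) k ω with hv_def
  set a := I.policy k ω h s
  have hmem := hs.vEst_mem hk.1 ω
  have hT : 0 ≤ 32 * Fintype.card S * V * M.ell K δ / I.count M.H k ω s a := by positivity
  refine MDP.potF_step hV hs.bounded (fun h s => (hmem _ s).1) (fun h s => (hmem _ s).2) hh s
    (by linarith) ?_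
  have hVn : ∀ x, |v (M.H - h) x - M.Vstar (h + 1) x| ≤ V := fun x => by
    have h1 := hs.bounded.Vstar_nonneg (h := h + 1) (by omega) x
    have h2 := hs.bounded.Vstar_le hV.le (h := h + 1) (by omega) x
    have h3 := hmem (M.H - h) x
    rw [abs_le]; constructor <;> linarith
  have h1 := hg.transition_le hs hk hN hVn
  have h2 : I.rHat M.H k ω s a + ∑ x, I.pHat M.H k ω s a x * M.Vstar (h + 1) x
      - M.Qstar h s a ≤ X := by
    rw [I.dev_eq k ω s a M _ _ h hN, mul_div_cancel_left₀ _ hN.ne'] at hX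
    have h0 : M.PV (0 : S → ℝ) s a = 0 := M.PV_zero s a
    rw [h0] at hX
    simpa using hX
  have h3 := Interaction.qStep_le_of_deviation (c₁ := M.eqoC1 K V c₁ Λ)
    (c₂ := M.hoeffdingC2 V c₂) hs.bounded hh (fun x => (hmem (M.H - h) x).1) hN hX0
    (add_nonneg (div_nonneg (M.var_nonneg _ _ _) (by positivity)) hT) h2 h1
  have h4 : v (M.H + 1 - h) s = I.qStep M.H V (M.eqoC1 K V c₁ Λ) (M.hoeffdingC2 V c₂) k ω
    (v (M.H - h)) s a := Interaction.vEst_eq_of_runs hs.runs hk.1 hh s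
  simp only [Nat.add_sub_add_right]
  change v (M.H + 1 - h) s ≤ M.r s a + M.PV (v (M.H - h)) s a
    + (D + 32 * Fintype.card S * V * M.ell K δ / I.count M.H k ω s a)
    + M.var (fun x => v (M.H - h) x - M.Vstar (h + 1) x) s a / (8 * V)
  rw [h4]
  linarith

/-- The regret of a valid episode in terms of the bonus of order `1 / N`. -/
lemma Good.regret_le (hs : Setup μ I M σ V Vα K c₁ c₂ Λ δ) {i₀ : ℕ}
    (hg : Good I M σ V Vα K c₁ c₂ Λ δ i₀ ω) (hk : k ∈ Set.Icc 1 K) (hi : i₀ ≤ Nat.log 2 k)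
    (hv : M.ValidScale σ V Vα (M.theta K V c₁ Λ δ (Nat.log 2 k))) (s : S) :
    M.Vstar 1 s - M.V (I.policy k ω) 1 s
      ≤ 11 / 2 * M.theta K V c₁ Λ δ (Nat.log 2 k) * M.Wstar σ
        + I.costVal M (fun _ _ N => (4 * M.eqoC1 K V c₁ Λ K
          + 64 * Fintype.card S * V * M.ell K δ) / N) (2 * V) k ω M.H 1 s := by
  have hV := hs.V_pos
  have hθ := hs.theta_pos (Nat.log 2 k)
  have hell := M.three_le_ell hs.one_le_H (k := K) hs.δ_pos hs.δ_le
  have hmem := hs.vEst_mem hk.1 ω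
  have hcK := hs.eqoC1_mono hk.1 hk.2
  have hck := hs.eqoC1_pos hk.1
  set φ : S → A → ℝ → ℝ := fun _ _ N => (4 * M.eqoC1 K V c₁ Λ K
          + 64 * Fintype.card S * V * M.ell K δ) / N with hφ
  have h1 := regret_le_clipVal (π := I.policy k ω) (σ := σ) hV hs.bounded
    (fun h s => (hmem (M.H + 1 - h) s).1) (fun h s => (hmem (M.H + 1 - h) s).2)
    (fun h s hh => by rw [Nat.sub_eq_zero_of_le hh]; rfl)
    -- The coefficient 11/2 is the sum of (3/2) · 2 from the quasi-optimism error and 4 · (5/8) from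
    -- the leftover proxies along the policy.
    (hg.Vstar_sub_vEst_le hs hk hi hv) (κ := 5 / 8 * M.theta K V c₁ Λ δ (Nat.log 2 k))
    (by positivity) (β := I.cost M φ (2 * V) k ω)
    (Interaction.cost_nonneg (by positivity) (fun s a N hN => by
      simp only [hφ]; have : 0 < M.eqoC1 K V c₁ Λ K := by linarith
      positivity) k ω) ?_ s
  · have h2 := mul_le_mul_of_nonneg_left (M.W_le_Wstar σ (I.policy k ω) le_rfl s hs.one_le_H)
      (by positivity : 0 ≤ 4 * (5 / 8 * M.theta K V c₁ Λ δ (Nat.log 2 k)))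
    rw [Interaction.costVal]
    linarith
  · intro h hh s
    by_cases hN : 0 < I.count M.H k ω s (I.policy k ω h s)
    · right
      have hd : I.dev M 1 0 h k ω s (I.policy k ω h s) / I.count M.H k ω s (I.policy k ω h s)
          ≤ M.theta K V c₁ Λ δ (Nat.log 2 k) * (5 / 8 * σ h s (I.policy k ω h s) ^ 2)
            + M.eqoC1 K V c₁ Λ k / I.count M.H k ω s (I.policy k ω h s) := by
        have h2 := hg.deviation_le hs hk hv hh hN true
        have h0 : M.var (0 : S → ℝ) s (I.policy k ω h s) = 0 := by
          refine le_antisymm ((M.var_le_sq (c := 0) (y := 0) fun x => by simp).trans_eq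
            (by norm_num)) (M.var_nonneg _ _ _)
        simpa [h0] using h2
      have h3 := hg.potF_step hs hk hh s hN (by positivity) hd
        (add_le_add le_rfl (min_le_left _ _))
      refine h3.trans ?_
      rw [Interaction.cost, if_pos hN]
      simp only [hφ]
      have h4 : M.eqoC1 K V c₁ Λ k / I.count M.H k ω s (I.policy k ω h s)
          ≤ M.eqoC1 K V c₁ Λ K / I.count M.H k ω s (I.policy k ω h s) := by gcongr
      have h5 : (4 * M.eqoC1 K V c₁ Λ K + 64 * Fintype.card S * V * M.ell K δ)
            / I.count M.H k ω s (I.policy k ω h s)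
          = 4 * (M.eqoC1 K V c₁ Λ K / I.count M.H k ω s (I.policy k ω h s))
            + 2 * (32 * Fintype.card S * V * M.ell K δ
              / I.count M.H k ω s (I.policy k ω h s)) := by ring
      rw [h5]
      linarith
    · left
      rw [Interaction.cost, if_neg hN]

/-- The regret of a valid episode in terms of the bonus of order `1 / √N`, up to effective gaps. -/
lemma Good.regret_le_of_isEffectiveGap (hs : Setup μ I M σ V Vα K c₁ c₂ Λ δ) {i₀ : ℕ}
    (hg : Good I M σ V Vα K c₁ c₂ Λ δ i₀ ω) (hk : k ∈ Set.Icc 1 K) (hi : i₀ ≤ Nat.log 2 k)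
    (hv : M.ValidScale σ V Vα (M.theta K V c₁ Λ δ (Nat.log 2 k))) {S₀ : Set S}
    {g : ℕ → S → A → ℝ} (hgap : M.IsEffectiveGap S₀ g) {e : ℝ} (he0 : 0 ≤ e)
    (he : M.vGap S₀ < 6 * M.theta K V c₁ Λ δ (Nat.log 2 k) * M.Wstar σ →
      6 * M.theta K V c₁ Λ δ (Nat.log 2 k) * M.Wstar σ ≤ e) {s : S} (hs₀ : s ∈ S₀) :
    M.Vstar 1 s - M.V (I.policy k ω) 1 s
      ≤ e + I.costVal M (fun s a N =>
        max (16 * M.hoeffdingC2 V c₂ K / √N - ⨅ h : Set.Icc 1 M.H, g h s a) 0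
          + 256 * Fintype.card S * V * M.ell K δ / N) (8 * V) k ω M.H 1 s := by
  have hV := hs.V_pos
  have hθ := hs.theta_pos (Nat.log 2 k)
  have hell := M.three_le_ell hs.one_le_H (k := K) hs.δ_pos hs.δ_le
  have hmem := hs.vEst_mem hk.1 ω
  have hcK := hs.hoeffdingC2_mono hk.1 hk.2
  have hck := hs.hoeffdingC2_nonneg k
  set φ : S → A → ℝ → ℝ := fun s a N =>
        max (16 * M.hoeffdingC2 V c₂ K / √N - ⨅ h : Set.Icc 1 M.H, g h s a) 0
          + 256 * Fintype.card S * V * M.ell K δ / N with hφ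
  refine regret_le_clipVal_of_isEffectiveGap (π := I.policy k ω) hV hs.bounded
    (fun h s => (hmem (M.H + 1 - h) s).1) (fun h s => (hmem (M.H + 1 - h) s).2)
    (fun h s hh => by rw [Nat.sub_eq_zero_of_le hh]; rfl)
    (hg.Vstar_sub_vEst_le hs hk hi hv) hgap (β := I.cost M φ (8 * V) k ω)
    (Interaction.cost_nonneg (by positivity) (fun s a N hN => by
      simp only [hφ]; positivity) k ω) ?_ he0 ?_ hs₀
  · intro h hh s
    by_cases hN : 0 < I.count M.H k ω s (I.policy k ω h s)
    · right
      rw [Interaction.cost, if_pos hN]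
      simp only [hφ]
      set a := I.policy k ω h s
      set N := I.count M.H k ω s a
      have hT : 0 ≤ 32 * Fintype.card S * V * M.ell K δ / N := by positivity
      have h3 : M.potF V (fun h => I.vEst M.H V (M.eqoC1 K V c₁ Λ) (M.hoeffdingC2 V c₂) k ω
            (M.H + 1 - h)) (I.policy k ω) h s
          ≤ 2 * (2 * (M.hoeffdingC2 V c₂ k / √N) + 32 * Fintype.card S * V * M.ell K δ / N)
          + M.PV (M.potF V
            (fun h => I.vEst M.H V (M.eqoC1 K V c₁ Λ) (M.hoeffdingC2 V c₂) k ω (M.H + 1 - h))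
            (I.policy k ω) (h + 1)) s a := by
        -- If the bonus is at least V, the concentration bound is unavailable, but the surplus is at
        -- most V and hence at most the bonus.
        by_cases hb : M.hoeffdingC2 V c₂ k / √N < V
        · have hd := hg.deviation_le_hoeffding hs hk hi hv hh hN hb true
          refine hg.potF_step hs hk hh s hN (X := M.hoeffdingC2 V c₂ k / √N) (by positivity)
            (by simpa using hd) ?_
          have : I.bonus M.H (M.eqoC1 K V c₁ Λ) (M.hoeffdingC2 V c₂) k ω s a
            ≤ M.hoeffdingC2 V c₂ k / √N := min_le_right _ _
          linarith
        · push Not at hb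
          refine MDP.potF_step hV hs.bounded (fun h s => (hmem _ s).1) (fun h s => (hmem _ s).2)
            hh s (by positivity) ?_
          have h4 := (hmem (M.H + 1 - h) s).2
          have h5 := hs.bounded.r_nonneg hs.one_le_H s a
          have h6 : 0 ≤ M.PV (I.vEst M.H V (M.eqoC1 K V c₁ Λ) (M.hoeffdingC2 V c₂) k ω
            (M.H + 1 - (h + 1))) s a := M.PV_nonneg fun x => (hmem _ x).1
          have h7 : 0 ≤ M.var (fun x => I.vEst M.H V (M.eqoC1 K V c₁ Λ) (M.hoeffdingC2 V c₂) k ω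
            (M.H + 1 - (h + 1)) x - M.Vstar (h + 1) x) s a / (8 * V) :=
            div_nonneg (M.var_nonneg _ _ _) (by positivity)
          linarith
      have hgi : (⨅ h : Set.Icc 1 M.H, g h s a) ≤ g h s a :=
        ciInf_le (f := fun h : Set.Icc 1 M.H => g h s a) (Set.finite_range _).bddBelow ⟨h, hh⟩
      have h4 : M.hoeffdingC2 V c₂ k / √N ≤ M.hoeffdingC2 V c₂ K / √N := by gcongr
      have h5 := le_max_left (16 * M.hoeffdingC2 V c₂ K / √N - ⨅ h : Set.Icc 1 M.H, g h s a) 0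
      rw [mul_div_assoc] at h5
      have h6 : 256 * Fintype.card S * V * M.ell K δ / N
        = 8 * (32 * Fintype.card S * V * M.ell K δ / N) := by ring
      rw [h6, mul_div_assoc]
      linarith
    · left
      rw [Interaction.cost, if_neg hN]
  · intro h
    have : 3 * (2 * M.theta K V c₁ Λ δ (Nat.log 2 k) * M.Wstar σ)
      = 6 * M.theta K V c₁ Λ δ (Nat.log 2 k) * M.Wstar σ := by ring
    rw [this] at h ⊢
    exact he h

end

end Episode

end EQO

namespace EQO

/-! ### Elementary sums over episodes and counts. -/

section Sums

lemma sum_Icc_ite_lt_le (K : ℕ) {x v : ℝ} (hx : 0 ≤ x) (hv : 0 ≤ v) :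
    ∑ k ∈ Finset.Icc 1 K, (if (k : ℝ) < x then v else 0) ≤ v * x := by
  rw [← Finset.sum_filter, Finset.sum_const, nsmul_eq_mul, mul_comm]
  gcongr
  have hsub : (Finset.Icc 1 K).filter (fun k : ℕ => (k : ℝ) < x) ⊆ Finset.Icc 1 ⌊x⌋₊ := by
    intro k hk
    obtain ⟨h1, h2⟩ := Finset.mem_filter.1 hk
    exact Finset.mem_Icc.2 ⟨(Finset.mem_Icc.1 h1).1, Nat.le_floor h2.le⟩
  have h1 := Finset.card_le_card hsub
  rw [Nat.card_Icc, Nat.add_sub_cancel] at h1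
  exact (Nat.cast_le.2 h1).trans (Nat.floor_le hx)

lemma sum_Icc_inv_sqrt_le (n : ℕ) : ∑ k ∈ Finset.Icc 1 n, 1 / √(k : ℝ) ≤ 2 * √n := by
  induction n with
  | zero => simp
  | succ n ih =>
    rw [Finset.sum_Icc_succ_top (by omega)]
    have h0 : 0 < √((n + 1 : ℕ) : ℝ) := Real.sqrt_pos.2 (by positivity)
    have h1 : 1 / √((n + 1 : ℕ) : ℝ) ≤ 2 * (√((n + 1 : ℕ) : ℝ) - √n) := by
      rw [div_le_iff₀ h0]
      have e1 := Real.mul_self_sqrt (by positivity : (0 : ℝ) ≤ ((n + 1 : ℕ) : ℝ))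
      have e2 := Real.mul_self_sqrt (by positivity : (0 : ℝ) ≤ n)
      push_cast at e1 e2 ⊢
      nlinarith [mul_self_nonneg (√((n : ℝ) + 1) - √n)]
    linarith

/-- Only k < (a / v)² contributes, so the sum is O(a √m) with √m ≤ a / v and does not depend on K.
-/
lemma sum_Icc_ite_div_sqrt_le (K : ℕ) {a v : ℝ} (ha : 0 ≤ a) (hv : 0 < v) :
    ∑ k ∈ Finset.Icc 1 K, (if v < a / √(k : ℝ) then a / √(k : ℝ) else 0) ≤ 2 * a ^ 2 / v := by
  rw [← Finset.sum_filter]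
  set m := ⌊(a / v) ^ 2⌋₊
  have hsub : (Finset.Icc 1 K).filter (fun k : ℕ => v < a / √(k : ℝ)) ⊆ Finset.Icc 1 m := by
    intro k hk
    obtain ⟨h1, h2⟩ := Finset.mem_filter.1 hk
    have hk1 := (Finset.mem_Icc.1 h1).1
    refine Finset.mem_Icc.2 ⟨hk1, Nat.le_floor ?_⟩
    have hk0 : (0 : ℝ) < k := by exact_mod_cast hk1
    have h3 : √(k : ℝ) ≤ a / v := by
      rw [lt_div_iff₀ (Real.sqrt_pos.2 hk0)] at h2
      rw [le_div_iff₀ hv]; linarith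
    calc (k : ℝ) = √k ^ 2 := (Real.sq_sqrt hk0.le).symm
      _ ≤ _ := by gcongr
  have hm : √(m : ℝ) ≤ a / v := by
    rw [Real.sqrt_le_left (by positivity)]
    exact Nat.floor_le (by positivity)
  calc _ ≤ ∑ k ∈ Finset.Icc 1 m, a / √(k : ℝ) :=
        Finset.sum_le_sum_of_subset_of_nonneg hsub fun _ _ _ => by positivity
    _ = a * ∑ k ∈ Finset.Icc 1 m, 1 / √(k : ℝ) := by
        rw [Finset.mul_sum]; exact Finset.sum_congr rfl fun _ _ => by ring
    _ ≤ a * (2 * (a / v)) := by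
        gcongr
        exact (sum_Icc_inv_sqrt_le m).trans (by gcongr)
    _ = _ := by ring

lemma sum_range_succ_eq_sum_Icc (f : ℕ → ℝ) (m : ℕ) :
    ∑ n ∈ Finset.range m, f (n + 1) = ∑ k ∈ Finset.Icc 1 m, f k := by
  induction m with
  | zero => simp
  | succ m ih => rw [Finset.sum_range_succ, ih, Finset.sum_Icc_succ_top (by omega)]

lemma sum_range_max_le (m : ℕ) {a g : ℝ} (ha : 0 ≤ a) (hg : 0 < g) :
    ∑ n ∈ Finset.range m, max (a / √(((n : ℝ) + 1) / 2) - g) 0 ≤ 4 * a ^ 2 / g := by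
  have h1 : ∀ n : ℕ, max (a / √(((n : ℝ) + 1) / 2) - g) 0
      ≤ (fun k : ℕ => if g < a * √2 / √(k : ℝ) then a * √2 / √(k : ℝ) else 0) (n + 1) := by
    intro n
    have e : a / √(((n : ℝ) + 1) / 2) = a * √2 / √((n + 1 : ℕ) : ℝ) := by
      rw [Real.sqrt_div (by positivity), div_div_eq_mul_div]; push_cast; rfl
    have h0 : 0 ≤ a * √2 / √((n + 1 : ℕ) : ℝ) := by positivity
    rw [e]
    simp only
    split_ifs with h
    · exact max_le (by linarith) h0
    · exact max_le (by linarith) le_rfl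
  refine (Finset.sum_le_sum fun n _ => h1 n).trans ?_
  rw [sum_range_succ_eq_sum_Icc fun k : ℕ =>
    if g < a * √2 / √(k : ℝ) then a * √2 / √(k : ℝ) else 0]
  refine (sum_Icc_ite_div_sqrt_le m (by positivity) hg).trans (le_of_eq ?_)
  rw [mul_pow, Real.sq_sqrt (by norm_num)]; ring

lemma sum_range_div_half_le {m : ℕ} (hm : 2 ≤ m) {b : ℝ} (hb : 0 ≤ b) :
    ∑ n ∈ Finset.range m, b / (((n : ℝ) + 1) / 2) ≤ 5 * b * Real.log m := by
  have h1 : ∑ n ∈ Finset.range m, 1 / ((n : ℝ) + 1) ≤ 1 + Real.log m := by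
    have := harmonic_le_one_add_log m
    rw [harmonic] at this
    push_cast at this
    simpa [one_div] using this
  have h2 : Real.log 2 ≤ Real.log m := Real.log_le_log (by norm_num) (by exact_mod_cast hm)
  have h3 := Real.log_two_gt_d9
  calc ∑ n ∈ Finset.range m, b / (((n : ℝ) + 1) / 2)
      = 2 * b * ∑ n ∈ Finset.range m, 1 / ((n : ℝ) + 1) := by
        rw [Finset.mul_sum]
        refine Finset.sum_congr rfl fun n _ => ?_
        field_simp
    _ ≤ 2 * b * (5 / 2 * Real.log m) := by
        gcongr
        linarith
    _ = _ := by ring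

lemma two_pow_firstBlock_le {c₂ δ : ℝ} (hδ : 0 < δ) (hδ1 : δ ≤ 1) :
    (2 : ℝ) ^ firstBlock c₂ δ ≤ Real.exp (80 * (1 / c₂ ^ 2 * Real.log (1 / δ))) + 1 := by
  have hl : 0 ≤ Real.log (1 / δ) := Real.log_nonneg (by rw [le_div_iff₀ hδ]; linarith)
  have h2 : 0 < Real.log 2 := Real.log_pos (by norm_num)
  set x := Real.exp (40 * (1 / c₂ ^ 2 * Real.log (1 / δ))) with hx
  have h3 : (2 : ℝ) ^ firstBlock c₂ δ ≤ 2 * x := by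
    have h4 : (firstBlock c₂ δ : ℝ) ≤ 40 * Real.log (1 / δ) / (c₂ ^ 2 * Real.log 2) + 1 :=
      (Nat.ceil_lt_add_one (by positivity)).le
    rw [← Real.rpow_natCast, Real.rpow_def_of_pos (by norm_num),
      show 2 * x = Real.exp (Real.log 2 + 40 * (1 / c₂ ^ 2 * Real.log (1 / δ))) by
        rw [Real.exp_add, Real.exp_log (by norm_num)], Real.exp_le_exp]
    calc Real.log 2 * (firstBlock c₂ δ : ℝ)
        ≤ Real.log 2 * (40 * Real.log (1 / δ) / (c₂ ^ 2 * Real.log 2) + 1) := by gcongr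
      _ = Real.log 2 * (40 * Real.log (1 / δ) / (c₂ ^ 2 * Real.log 2)) + Real.log 2 := by ring
      _ = _ := by field_simp; ring
  have h5 : Real.exp (80 * (1 / c₂ ^ 2 * Real.log (1 / δ))) = x ^ 2 := by
    rw [hx, ← Real.exp_nat_mul]; congr 1; push_cast; ring
  rw [h5]
  -- The rounding in the ceiling costs a factor 2, traded for a larger constant in the exponent by 2
  -- x ≤ x² + 1.
  nlinarith [sq_nonneg (x - 1)]

end Sums

/-! ### The decay of the scale θ over the episodes. -/

section Scales

open MDP

variable {Ω S A : Type*} [Fintype S] [Fintype A] [Nonempty S] [Nonempty A] [MeasurableSpace Ω]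
  {μ : Measure Ω} [IsProbabilityMeasure μ] {I : Interaction Ω S A} {M : MDP S A}
  {σ : ℕ → S → A → ℝ} {V Vα : ℝ} {K : ℕ} {c₁ c₂ : ℝ} {Λ : ℕ → ℝ} {δ : ℝ}

lemma Setup.log_size_le_Λ (hs : Setup μ I M σ V Vα K c₁ c₂ Λ δ) {k : ℕ} (hk : 1 ≤ k) :
    Real.log (32 * M.size) ≤ Λ k := by
  refine le_trans ?_ (hs.le_Λ k hk)
  have h1 := M.one_le_size hs.one_le_H
  have h2 : 0 ≤ Real.log k := Real.log_natCast_nonneg k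
  refine Real.log_le_log (by positivity) ?_
  nlinarith [mul_nonneg (by linarith : 0 ≤ M.size) h2]

lemma three_le_log_size (M : MDP S A) (hH : 1 ≤ M.H) : 3 ≤ Real.log (32 * M.size) := by
  have := M.three_le_logH hH 0
  rwa [logH, pow_zero, mul_one] at this

/-- As c_{1,k} grows like √k, θ decays like 1 / √k; rounding k down to a power of two costs a factor
2. A scale can therefore be too large in finitely many episodes only, with a bound that is
independent of their number. -/
lemma Setup.theta_sq_mul_le (hs : Setup μ I M σ V Vα K c₁ c₂ Λ δ) (k : ℕ) :
    M.theta K V c₁ Λ δ (Nat.log 2 k) ^ 2 * k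
      ≤ 8 * (M.ell (2 ^ Nat.log 2 k) δ ^ 2 / Λ (2 ^ Nat.log 2 k))
        * (Fintype.card S * Fintype.card A * Real.log (K * M.H)) / (c₁ ^ 2 * V ^ 2) := by
  have h1 := hs.c₁_pos
  have h2 := hs.V_pos
  have h3 := hs.three_le_Λ (k := 2 ^ Nat.log 2 k) Nat.one_le_two_pow
  have h4 := hs.log_pos
  have h5 : (0 : ℝ) < Fintype.card S := by exact_mod_cast Fintype.card_pos
  have h6 : (0 : ℝ) < Fintype.card A := by exact_mod_cast Fintype.card_pos
  have h7 : (k : ℝ) ≤ 2 * 2 ^ Nat.log 2 k := by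
    have := Nat.lt_pow_succ_log_self (b := 2) (by norm_num) k
    rw [pow_succ, mul_comm] at this
    exact_mod_cast this.le
  rw [theta, eqoC1, div_pow, mul_pow, mul_pow, mul_pow, Real.sq_sqrt (by positivity)]
  push_cast
  have h8 : (0 : ℝ) < 2 ^ Nat.log 2 k := by positivity
  have h9 : 0 < Λ (2 ^ Nat.log 2 k) := by linarith
  set Λ' := Λ (2 ^ Nat.log 2 k)
  set p := (2 : ℝ) ^ Nat.log 2 k
  set B := (Fintype.card S * Fintype.card A * Real.log (K * M.H) : ℝ)
  have hB : 0 < B := by positivity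
  calc 2 ^ 2 * M.ell (2 ^ Nat.log 2 k) δ ^ 2 / (c₁ ^ 2 * V ^ 2 * (p * Λ' / B)) * k
      ≤ 2 ^ 2 * M.ell (2 ^ Nat.log 2 k) δ ^ 2 / (c₁ ^ 2 * V ^ 2 * (p * Λ' / B)) * (2 * p) := by
        gcongr
    _ = _ := by field_simp; ring

/-- The factor `ℓ² S A log (K H) / (c₁² log (32 H S A))`. -/
noncomputable def MDP.scaleFactor (M : MDP S A) (K : ℕ) (c₁ δ : ℝ) : ℝ :=
  M.ell K δ ^ 2 / (c₁ ^ 2 * Real.log (32 * M.size))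
    * (Fintype.card S * Fintype.card A * Real.log (K * M.H))

lemma Setup.scaleFactor_nonneg (hs : Setup μ I M σ V Vα K c₁ c₂ Λ δ) :
    0 ≤ M.scaleFactor K c₁ δ := by
  have h1 := hs.log_pos
  have h2 := three_le_log_size M hs.one_le_H
  rw [scaleFactor]; positivity

lemma Setup.theta_sq_mul_le_scaleFactor (hs : Setup μ I M σ V Vα K c₁ c₂ Λ δ) {k : ℕ}
    (hk : k ∈ Set.Icc 1 K) :
    M.theta K V c₁ Λ δ (Nat.log 2 k) ^ 2 * k ≤ 8 * M.scaleFactor K c₁ δ / V ^ 2 := by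
  refine (hs.theta_sq_mul_le k).trans ?_
  have h1 := hs.c₁_pos
  have h2 := hs.V_pos
  have h3 := hs.log_size_le_Λ (k := 2 ^ Nat.log 2 k) Nat.one_le_two_pow
  have h4 := hs.log_pos
  have h5 := three_le_log_size M hs.one_le_H
  have h6 := hs.ell_mono (j := 2 ^ Nat.log 2 k) Nat.one_le_two_pow
    ((two_pow_log_le hk.1).trans hk.2)
  have h7 := M.three_le_ell hs.one_le_H (k := 2 ^ Nat.log 2 k) hs.δ_pos hs.δ_le
  calc _ ≤ 8 * (M.ell K δ ^ 2 / Real.log (32 * M.size))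
        * (Fintype.card S * Fintype.card A * Real.log (K * M.H)) / (c₁ ^ 2 * V ^ 2) := by gcongr
    _ = _ := by rw [scaleFactor]; field_simp

lemma Setup.ell_le (hs : Setup μ I M σ V Vα K c₁ c₂ Λ δ) {k : ℕ} (hk : 1 ≤ k) :
    M.ell k δ ≤ Λ k + Real.log (1 / δ) := by
  have h1 := M.one_le_size hs.one_le_H
  have h2 : 0 ≤ Real.log k := Real.log_natCast_nonneg k
  have h3 := hs.δ_pos
  rw [ell, div_eq_mul_one_div, Real.log_mul (by positivity) (by positivity)]
  gcongr
  exact hs.le_Λ k hk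

/-- From ℓ ≤ Λ + log (1/δ), one factor Λ of ℓ² cancels against the Λ in c_1², which leaves a single
Λ_K under the root. -/
lemma Setup.theta_le (hs : Setup μ I M σ V Vα K c₁ c₂ Λ δ) {k : ℕ} (hk : k ∈ Set.Icc 1 K) :
    M.theta K V c₁ Λ δ (Nat.log 2 k)
      ≤ 3 / (c₁ * V) * (1 + Real.log (1 / δ) / Real.log (32 * M.size))
        * √(Fintype.card S * Fintype.card A * Λ K * Real.log (K * M.H)) * (1 / √k) := by
  have h1 := hs.c₁_pos
  have h2 := hs.V_pos
  have h3 := hs.log_size_le_Λ (k := 2 ^ Nat.log 2 k) Nat.one_le_two_pow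
  have h4 := hs.log_pos
  have h5 := three_le_log_size M hs.one_le_H
  have h6 := hs.ell_le (k := 2 ^ Nat.log 2 k) Nat.one_le_two_pow
  have h7 := M.three_le_ell hs.one_le_H (k := 2 ^ Nat.log 2 k) hs.δ_pos hs.δ_le
  have h8 := hs.Λ_mono (2 ^ Nat.log 2 k) K Nat.one_le_two_pow
    ((two_pow_log_le hk.1).trans hk.2)
  have hδ := hs.δ_pos
  have hD : 0 ≤ Real.log (1 / δ) :=
    Real.log_nonneg (by rw [le_div_iff₀ hδ]; linarith [hs.δ_le])
  have hk0 : (0 : ℝ) < k := by exact_mod_cast (show 1 ≤ k from hk.1)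
  have h9 := hs.theta_sq_mul_le k
  set θ := M.theta K V c₁ Λ δ (Nat.log 2 k)
  set L := M.ell (2 ^ Nat.log 2 k) δ
  set Λ' := Λ (2 ^ Nat.log 2 k)
  set D := Real.log (1 / δ)
  set Λ₀ := Real.log (32 * M.size)
  have hΛ' : 0 < Λ' := by linarith
  have hΛK : 0 < Λ K := by linarith
  have h10 : L ^ 2 / Λ' ≤ Λ K * (1 + D / Λ₀) ^ 2 := by
    calc L ^ 2 / Λ' ≤ (Λ' + D) ^ 2 / Λ' := by gcongr
      _ = Λ' * (1 + D / Λ') ^ 2 := by field_simp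
      _ ≤ _ := by gcongr
  rw [mul_one_div, le_div_iff₀ (Real.sqrt_pos.2 hk0)]
  refine abs_le_of_sq_le_sq' ?_ (by positivity) |>.2
  rw [mul_pow, Real.sq_sqrt hk0.le, mul_pow, Real.sq_sqrt (by positivity), mul_pow, div_pow]
  refine h9.trans ?_
  calc _ ≤ 8 * (Λ K * (1 + D / Λ₀) ^ 2)
        * (Fintype.card S * Fintype.card A * Real.log (K * M.H)) / (c₁ ^ 2 * V ^ 2) := by gcongr
    _ ≤ 9 * (Λ K * (1 + D / Λ₀) ^ 2)
        * (Fintype.card S * Fintype.card A * Real.log (K * M.H)) / (c₁ ^ 2 * V ^ 2) := by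
        gcongr; norm_num
    _ = _ := by rw [mul_pow]; ring

end Scales

end EQO

namespace EQO

lemma log_thirtyTwo_mul_le {y : ℝ} (hy : 2 ≤ y) : Real.log (32 * y) ≤ 6 * Real.log y := by
  have h1 : Real.log (y ^ 6) = 6 * Real.log y := by rw [Real.log_pow]; norm_num
  rw [← h1]
  refine Real.log_le_log (by positivity) ?_
  have : (2 : ℝ) ^ 5 ≤ y ^ 5 := by gcongr
  nlinarith

/-! ### The total regret. -/

section Total

open MDP

variable {Ω S A : Type*} [Fintype S] [Fintype A] [Nonempty S] [Nonempty A] [MeasurableSpace Ω]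
  {μ : Measure Ω} [IsProbabilityMeasure μ] {I : Interaction Ω S A} {M : MDP S A}
  {σ : ℕ → S → A → ℝ} {V Vα : ℝ} {K : ℕ} {c₁ c₂ : ℝ} {Λ : ℕ → ℝ} {δ : ℝ}

lemma half_lt_log (h : 2 ≤ K * M.H) : 1 / 2 < Real.log (K * M.H) := by
  have h1 : (2 : ℝ) ≤ K * M.H := by exact_mod_cast h
  have h2 := Real.log_le_log (by norm_num) h1
  linarith [Real.log_two_gt_d9]

lemma two_le_size_mul (h : 2 ≤ K * M.H) : 2 ≤ M.size * K := by
  have h1 : (2 : ℝ) ≤ K * M.H := by exact_mod_cast h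
  have hS : (1 : ℝ) ≤ Fintype.card S := by exact_mod_cast Fintype.card_pos
  have hA : (1 : ℝ) ≤ Fintype.card A := by exact_mod_cast Fintype.card_pos
  have hSA : (1 : ℝ) ≤ Fintype.card S * Fintype.card A := by nlinarith
  rw [size]
  nlinarith

lemma Setup.hoeffdingC2_sq_le (hs : Setup μ I M σ V Vα K c₁ c₂ Λ δ) :
    M.hoeffdingC2 V c₂ K ^ 2 ≤ 6 * (c₂ ^ 2 * V ^ 2 * Real.log (M.size * K)) := by
  have h1 := two_le_size_mul hs.two_le
  have h2 := log_thirtyTwo_mul_le h1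
  have h3 : 0 ≤ Real.log (32 * (M.size * K)) := Real.log_nonneg (by linarith)
  rw [hoeffdingC2, mul_pow, mul_pow, mul_assoc 32, Real.sq_sqrt h3]
  calc c₂ ^ 2 * V ^ 2 * Real.log (32 * (M.size * K))
      ≤ c₂ ^ 2 * V ^ 2 * (6 * Real.log (M.size * K)) := by gcongr
    _ = _ := by ring

lemma Setup.regret_le_V (hs : Setup μ I M σ V Vα K c₁ c₂ Λ δ) (π : Policy S A) (s : S) :
    M.Vstar 1 s - M.V π 1 s ≤ V := by
  have h1 := hs.bounded.Vstar_le hs.V_pos.le le_rfl s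
  have h2 := hs.bounded.V_nonneg π le_rfl s
  linarith

lemma Setup.measure_not_good_or_le (hs : Setup μ I M σ V Vα K c₁ c₂ Λ δ) {E : Set Ω} {X : Ω → ℝ}
    {x : ℝ} (hE : μ E ≤ ENNReal.ofReal (Real.exp (-Real.log (8 / δ))))
    (hX : ∀ᵐ ω ∂μ, Good I M σ V Vα K c₁ c₂ Λ δ (firstBlock c₂ δ) ω → ω ∉ E → X ω ≤ x) :
    μ {ω | x < X ω} ≤ ENNReal.ofReal δ := by
  have hδ := hs.δ_pos
  have h1 := measure_not_good_le hs
  rw [Real.exp_neg, Real.exp_log (by positivity), inv_div] at hE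
  refine (measure_mono_ae ?_).trans ((measure_union_le _ _).trans ((add_le_add h1 hE).trans ?_))
  · filter_upwards [hX] with ω hω hlt
    by_contra hc
    have hc' : ¬ (¬ Good I M σ V Vα K c₁ c₂ Λ δ (firstBlock c₂ δ) ω ∨ ω ∈ E) := hc
    rw [not_or, not_not] at hc'
    exact absurd (hω hc'.1 hc'.2) (not_le.2 hlt)
  · rw [← ENNReal.ofReal_add (by positivity) (by positivity)]
    exact ENNReal.ofReal_le_ofReal (by linarith)

lemma ae_forall_state_mem {S₀ : Set S} (hS₀ : ∀ k, 1 ≤ k → ∀ᵐ ω ∂μ, I.state k 1 ω ∈ S₀) :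
    ∀ᵐ ω ∂μ, ∀ k, 1 ≤ k → I.state k 1 ω ∈ S₀ := by
  rw [ae_all_iff]; intro k
  by_cases hk : 1 ≤ k
  · filter_upwards [hS₀ k hk] with ω hω _ using hω
  · exact ae_of_all _ fun ω h => absurd h hk

lemma Setup.log_eight_div_le (hs : Setup μ I M σ V Vα K c₁ c₂ Λ δ) :
    Real.log (8 / δ) ≤ M.ell K δ := by
  have hδ := hs.δ_pos
  refine le_trans (Real.log_le_log (by positivity) ?_) (M.log_le_ell hs.one_le_H hs.δ_pos)
  gcongr; norm_num

lemma Setup.lower_order_le (hs : Setup μ I M σ V Vα K c₁ c₂ Λ δ) :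
    V ≤ V * Fintype.card S ^ 2 * Fintype.card A * Real.log (K * M.H) * M.ell K δ ∧
    V * (Fintype.card S * Fintype.card A * Real.log (K * M.H))
      ≤ V * Fintype.card S ^ 2 * Fintype.card A * Real.log (K * M.H) * M.ell K δ ∧
    V * Real.log (8 / δ)
      ≤ 2 * (V * Fintype.card S ^ 2 * Fintype.card A * Real.log (K * M.H) * M.ell K δ) := by
  have hV := hs.V_pos
  have hell := M.three_le_ell hs.one_le_H (k := K) hs.δ_pos hs.δ_le
  have hlog := half_lt_log hs.two_le
  have hS : (1 : ℝ) ≤ Fintype.card S := by exact_mod_cast Fintype.card_pos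
  have hA : (1 : ℝ) ≤ Fintype.card A := by exact_mod_cast Fintype.card_pos
  set Y := V * Fintype.card S ^ 2 * Fintype.card A * Real.log (K * M.H) * M.ell K δ with hY
  have hVell : V * M.ell K δ ≤ 2 * Y := by
    have : 1 ≤ (Fintype.card S : ℝ) ^ 2 * Fintype.card A * (2 * Real.log (K * M.H)) :=
      one_le_mul_of_one_le_of_one_le
        (one_le_mul_of_one_le_of_one_le (one_le_pow₀ hS) hA) (by linarith)
    calc V * M.ell K δ = V * M.ell K δ * 1 := (mul_one _).symm
      _ ≤ V * M.ell K δ * ((Fintype.card S : ℝ) ^ 2 * Fintype.card A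
          * (2 * Real.log (K * M.H))) := by gcongr
      _ = _ := by rw [hY]; ring
  refine ⟨by nlinarith, ?_, (mul_le_mul_of_nonneg_left hs.log_eight_div_le hV.le).trans hVell⟩
  have : 1 ≤ Fintype.card S * M.ell K δ := one_le_mul_of_one_le_of_one_le hS (by linarith)
  calc _ = V * (Fintype.card S * Fintype.card A * Real.log (K * M.H)) * 1 := (mul_one _).symm
    _ ≤ V * (Fintype.card S * Fintype.card A * Real.log (K * M.H))
        * (Fintype.card S * M.ell K δ) := by gcongr
    _ = _ := by rw [hY]; ring

lemma log_one_div_nonneg (hδ : 0 < δ) (hδ1 : δ ≤ 1) : 0 ≤ Real.log (1 / δ) :=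
  Real.log_nonneg (by rw [le_div_iff₀ hδ]; linarith)

lemma Setup.mul_two_pow_firstBlock_le (hs : Setup μ I M σ V Vα K c₁ c₂ Λ δ) :
    V * 2 ^ firstBlock c₂ δ
      ≤ V * Real.exp (20000 * (1 / c₂ ^ 2 * Real.log (1 / δ))) + V := by
  have hV := hs.V_pos
  have hl := log_one_div_nonneg hs.δ_pos hs.δ_le
  have h1 := two_pow_firstBlock_le (c₂ := c₂) hs.δ_pos hs.δ_le
  have h2 : Real.exp (80 * (1 / c₂ ^ 2 * Real.log (1 / δ)))
      ≤ Real.exp (20000 * (1 / c₂ ^ 2 * Real.log (1 / δ))) := by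
    gcongr; norm_num
  calc _ ≤ V * (Real.exp (20000 * (1 / c₂ ^ 2 * Real.log (1 / δ))) + 1) := by
        gcongr; linarith
    _ = _ := by ring

variable (M σ V Vα K c₁ c₂ δ) in
/-- The regret bound for effective gaps with constant `C`. -/
noncomputable def effectiveGapBound (S₀ : Set S) (g : ℕ → S → A → ℝ) (C : ℝ) : ℝ :=
  V * Real.exp (C * (1 / c₂ ^ 2 * Real.log (1 / δ)))
    + C * ∑ s, ∑ a, c₂ ^ 2 * V ^ 2 * Real.log (M.size * K) / (⨅ h : Set.Icc 1 M.H, g h s a)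
    + C * ((M.Wstar σ ^ 2 / (M.vGap S₀ * V ^ 2) + max (M.Wdiff σ) (Vα ^ 2) / V)
        * (M.ell K δ ^ 2 / (c₁ ^ 2 * Real.log (32 * M.size)))
        * (Fintype.card S * Fintype.card A * Real.log (K * M.H)))
    + C * (V * Fintype.card S ^ 2 * Fintype.card A * Real.log (K * M.H) * M.ell K δ)

variable (M V K c₁ c₂ δ) in
/-- The regret bound in terms of the gaps with constant `C`. -/
noncomputable def gapBound (C : ℝ) : ℝ :=
  V * Real.exp (C * (1 / c₂ ^ 2 * Real.log (1 / δ)))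
    + C * ∑ s, ∑ a, c₂ ^ 2 * V ^ 2 * Real.log (M.size * K) / max (M.gapSA s a) (M.gapMin / M.H)
    + C * (V ^ 2 * Fintype.card S * Fintype.card A * Real.log (K * M.H)
          * M.ell K δ ^ 2 / (c₁ ^ 2 * M.gapMin * Real.log (32 * M.size))
        + V * Fintype.card S ^ 2 * Fintype.card A * Real.log (K * M.H) * M.ell K δ)

variable (M V K c₁ c₂ Λ δ) in
/-- The worst-case regret bound with constant `C`. -/
noncomputable def worstCaseBound (C : ℝ) : ℝ :=
  V * Real.exp (C * (1 / c₂ ^ 2 * Real.log (1 / δ)))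
    + C * ((Real.log (1 / δ) / (c₁ * Real.log (32 * M.size)) + 1 / c₁ + c₁)
          * V * √(K * Fintype.card S * Fintype.card A * Λ K * Real.log (K * M.H))
        + V * Fintype.card S ^ 2 * Fintype.card A * M.ell K δ * Real.log (2 * K * M.H))

/-- The regret of an episode on the concentration event, for effective gaps. -/
lemma Good.regret_le_ite (hs : Setup μ I M σ V Vα K c₁ c₂ Λ δ) {i₀ : ℕ} {ω : Ω}
    (hg : Good I M σ V Vα K c₁ c₂ Λ δ i₀ ω) {k : ℕ} (hk : k ∈ Set.Icc 1 K) {S₀ : Set S}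
    {g : ℕ → S → A → ℝ} (hgap : M.IsEffectiveGap S₀ g) {T : ℝ}
    (hT : T = 8 * M.scaleFactor K c₁ δ / V ^ 2) {s : S} (hs₀ : s ∈ S₀) :
    M.Vstar 1 s - M.V (I.policy k ω) 1 s
      ≤ (if (k : ℝ) < 2 ^ i₀ then V else 0)
        + (if (k : ℝ) < 25 / 16 * T * Vα ^ 2 then V else 0)
        + (if (k : ℝ) < 64 * T * M.Wdiff σ then V else 0)
        + (if M.vGap S₀ < 16 * √T * M.Wstar σ / √(k : ℝ) then 16 * √T * M.Wstar σ / √(k : ℝ) else 0)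
        + I.costVal M (fun s a N =>
          max (16 * M.hoeffdingC2 V c₂ K / √N - ⨅ h : Set.Icc 1 M.H, g h s a) 0
            + 256 * Fintype.card S * V * M.ell K δ / N) (8 * V) k ω M.H 1 s := by
  have hV := hs.V_pos
  have hell := M.three_le_ell hs.one_le_H (k := K) hs.δ_pos hs.δ_le
  have hW := M.Wstar_nonneg σ hs.one_le_H
  have hWd := M.Wdiff_nonneg σ hs.one_le_H
  have hc2 := hs.hoeffdingC2_nonneg K
  have hk0 : (0 : ℝ) < k := by exact_mod_cast (show 1 ≤ k from hk.1)
  have hθ := hs.theta_pos (Nat.log 2 k)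
  have hθk := hs.theta_sq_mul_le_scaleFactor hk
  rw [← hT] at hθk
  have hR := hs.regret_le_V (I.policy k ω) s
  have hvV := vGap_le (S₀ := S₀) hs.bounded hV.le
  have hθW : M.theta K V c₁ Λ δ (Nat.log 2 k) * M.Wstar σ ≤ √T * M.Wstar σ / √(k : ℝ) := by
    have : M.theta K V c₁ Λ δ (Nat.log 2 k) ≤ √T / √(k : ℝ) := by
      rw [le_div_iff₀ (Real.sqrt_pos.2 hk0)]
      refine Real.le_sqrt_of_sq_le ?_
      rw [mul_pow, Real.sq_sqrt hk0.le]; exact hθk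
    calc _ ≤ √T / √(k : ℝ) * M.Wstar σ := by gcongr
      _ = _ := by ring
  have heg := hg.regret_le_of_isEffectiveGap hs hk (S₀ := S₀) (g := g) (s := s)
    (e := if M.vGap S₀ < 16 * √T * M.Wstar σ / √(k : ℝ) then 16 * √T * M.Wstar σ / √(k : ℝ) else 0)
  set a := √T * M.Wstar σ / √(k : ℝ) with ha
  have ha0 : 0 ≤ a := by positivity
  have ha16 : 16 * √T * M.Wstar σ / √(k : ℝ) = 16 * a := by rw [ha]; ring
  rw [ha16] at heg ⊢
  set U := I.costVal M (fun s a N =>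
          max (16 * M.hoeffdingC2 V c₂ K / √N - ⨅ h : Set.Icc 1 M.H, g h s a) 0
            + 256 * Fintype.card S * V * M.ell K δ / N) (8 * V) k ω M.H 1 s
  have hU : 0 ≤ U := M.clipVal_nonneg (by positivity) (fun s a =>
    Interaction.cost_nonneg (by positivity) (fun s a N hN => by positivity) k ω s a) _ _ _
  set θ := M.theta K V c₁ Λ δ (Nat.log 2 k)
  have i1 : 0 ≤ (if (k : ℝ) < 2 ^ i₀ then V else 0) := by split_ifs <;> positivity
  have i2 : 0 ≤ (if (k : ℝ) < 25 / 16 * T * Vα ^ 2 then V else 0) := by split_ifs <;> positivity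
  have i3 : 0 ≤ (if (k : ℝ) < 64 * T * M.Wdiff σ then V else 0) := by split_ifs <;> positivity
  have i4 : 0 ≤ (if M.vGap S₀ < 16 * a then 16 * a else 0) := by split_ifs <;> positivity
  by_cases hi : i₀ ≤ Nat.log 2 k
  swap
  · have : (k : ℝ) < 2 ^ i₀ := by
      exact_mod_cast Nat.lt_pow_of_log_lt (by norm_num) (not_le.1 hi)
    rw [if_pos this]; linarith
  -- Each way in which the scale can be invalid confines k to an initial range, where the regret is
  -- bounded by V.
  by_cases h1 : 5 / 4 * θ * Vα ≤ 1
  swap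
  · have : (k : ℝ) < 25 / 16 * T * Vα ^ 2 := by
      have h2 : 1 < (5 / 4 * θ * Vα) ^ 2 := one_lt_pow₀ (not_le.1 h1) (by norm_num)
      calc (k : ℝ) = k * 1 := (mul_one _).symm
        _ < k * (5 / 4 * θ * Vα) ^ 2 := by gcongr
        _ = 25 / 16 * (θ ^ 2 * k) * Vα ^ 2 := by ring
        _ ≤ _ := by gcongr
    rw [if_pos this]; linarith
  by_cases h2 : θ ^ 2 * M.Wdiff σ ≤ 1 / 64
  swap
  · have : (k : ℝ) < 64 * T * M.Wdiff σ := by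
      have h3 := not_le.1 h2
      calc (k : ℝ) = 64 * k * (1 / 64) := by ring
        _ < 64 * k * (θ ^ 2 * M.Wdiff σ) := by gcongr
        _ = 64 * (θ ^ 2 * k) * M.Wdiff σ := by ring
        _ ≤ _ := by gcongr
    rw [if_pos this]; linarith
  -- Here 16 θ W^* > V bounds both v_gap and the regret, so these episodes are covered by the term
  -- for a large quasi-optimism error.
  by_cases h3 : θ * M.Wstar σ ≤ V / 16
  swap
  · have : M.vGap S₀ < 16 * a := by linarith
    rw [if_pos this]; linarith
  have h4 := heg hi ⟨h1, h2, h3⟩ hgap i4 (fun h => by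
    have : M.vGap S₀ < 16 * a := by nlinarith
    rw [if_pos this]; linarith) hs₀
  linarith

lemma Setup.measure_regret_gt_le_of_isEffectiveGap (hs : Setup μ I M σ V Vα K c₁ c₂ Λ δ)
    {S₀ : Set S} (hS₀ : ∀ k, 1 ≤ k → ∀ᵐ ω ∂μ, I.state k 1 ω ∈ S₀) {g : ℕ → S → A → ℝ}
    (hgap : M.IsEffectiveGap S₀ g) (hv : 0 < M.vGap S₀) :
    μ {ω | effectiveGapBound M σ V Vα K c₁ c₂ δ S₀ g 20000 < I.regret M K ω}
      ≤ ENNReal.ofReal δ := by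
  have hV := hs.V_pos
  have hH := hs.one_le_H
  have hell := M.three_le_ell hs.one_le_H (k := K) hs.δ_pos hs.δ_le
  have hc2 := hs.hoeffdingC2_nonneg K
  have hW := M.Wstar_nonneg σ hs.one_le_H
  have hWd := M.Wdiff_nonneg σ hs.one_le_H
  have hδ := hs.δ_pos
  have hl : 0 ≤ Real.log (1 / δ) := log_one_div_nonneg hδ hs.δ_le
  have hlog := half_lt_log hs.two_le
  have hS : (1 : ℝ) ≤ Fintype.card S := by exact_mod_cast Fintype.card_pos
  have hA : (1 : ℝ) ≤ Fintype.card A := by exact_mod_cast Fintype.card_pos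
  have hne : Nonempty (Set.Icc 1 M.H) := ⟨⟨1, le_rfl, hH⟩⟩
  have hg0 : ∀ s a, 0 < ⨅ h : Set.Icc 1 M.H, g h s a := fun s a => by
    obtain ⟨h, hh⟩ := exists_eq_ciInf_of_finite (f := fun h : Set.Icc 1 M.H => g h s a)
    rw [← hh]; exact hgap.1 h h.2 s a
  set φ : S → A → ℝ → ℝ := fun s a N =>
    max (16 * M.hoeffdingC2 V c₂ K / √N - ⨅ h : Set.Icc 1 M.H, g h s a) 0
      + 256 * Fintype.card S * V * M.ell K δ / N with hφ
  have hU := Interaction.measure_sum_costVal_gt_le (φ := φ) hs.follows hH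
    (by positivity : 0 < 8 * V) (fun s a => by fun_prop)
    (fun s a N hN => by simp only [hφ]; positivity)
    (fun s a N N' hN hNN => by simp only [hφ]; gcongr) hs.two_le (Real.log (8 / δ))
  refine hs.measure_not_good_or_le hU ?_
  have hst := ae_forall_state_mem hS₀
  filter_upwards [hst] with ω hω hgood hnU
  simp only [not_lt] at hnU
  obtain ⟨T, hT⟩ : ∃ T, T = 8 * M.scaleFactor K c₁ δ / V ^ 2 := ⟨_, rfl⟩
  have hZ := hs.scaleFactor_nonneg
  have hT0 : 0 ≤ T := by rw [hT]; positivity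
  -- summation over the episodes
  have hsum : I.regret M K ω ≤ V * 2 ^ firstBlock c₂ δ + V * (25 / 16 * T * Vα ^ 2)
      + V * (64 * T * M.Wdiff σ) + 2 * (16 * √T * M.Wstar σ) ^ 2 / M.vGap S₀
      + ∑ k ∈ Finset.Icc 1 K, I.costVal M φ (8 * V) k ω M.H 1 (I.state k 1 ω) := by
    have h1 : I.regret M K ω ≤ _ := Finset.sum_le_sum fun k hk =>
      hgood.regret_le_ite hs (Finset.mem_Icc.1 hk) hgap hT (hω k (Finset.mem_Icc.1 hk).1)
    refine h1.trans ?_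
    simp only [Finset.sum_add_distrib]
    gcongr
    · exact sum_Icc_ite_lt_le K (by positivity) hV.le
    · exact sum_Icc_ite_lt_le K (by positivity) hV.le
    · exact sum_Icc_ite_lt_le K (by positivity) hV.le
    · exact sum_Icc_ite_div_sqrt_le K (by positivity) hv
  -- the costs
  have hcost : ∑ s, ∑ a, ∑ n ∈ Finset.range (K * M.H), φ s a (((n : ℝ) + 1) / 2)
      ≤ 6144 * ∑ s, ∑ a, c₂ ^ 2 * V ^ 2 * Real.log (M.size * K) / (⨅ h : Set.Icc 1 M.H, g h s a)
        + 1280 * (V * Fintype.card S ^ 2 * Fintype.card A * Real.log (K * M.H) * M.ell K δ) := by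
    have h1 : ∀ s a, ∑ n ∈ Finset.range (K * M.H), φ s a (((n : ℝ) + 1) / 2)
        ≤ 6144 * (c₂ ^ 2 * V ^ 2 * Real.log (M.size * K) / (⨅ h : Set.Icc 1 M.H, g h s a))
          + 1280 * (Fintype.card S * V * M.ell K δ * Real.log (K * M.H)) := by
      intro s a
      simp only [hφ]
      rw [Finset.sum_add_distrib]
      have h2 := sum_range_max_le (K * M.H) (a := 16 * M.hoeffdingC2 V c₂ K) (by positivity)
        (hg0 s a)
      have h3 := sum_range_div_half_le hs.two_le
        (b := 256 * Fintype.card S * V * M.ell K δ) (by positivity)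
      push_cast at h3
      -- The constant is 4 · 16² · 6, with the 6 from `hoeffdingC2_sq_le`.
      have h4 : 4 * (16 * M.hoeffdingC2 V c₂ K) ^ 2 / (⨅ h : Set.Icc 1 M.H, g h s a)
          ≤ 6144 * (c₂ ^ 2 * V ^ 2 * Real.log (M.size * K)
            / (⨅ h : Set.Icc 1 M.H, g h s a)) := by
        rw [← mul_div_assoc]
        refine div_le_div_of_nonneg_right ?_ (hg0 s a).le
        linarith [hs.hoeffdingC2_sq_le]
      linarith
    refine (Finset.sum_le_sum fun s _ => Finset.sum_le_sum fun a _ => h1 s a).trans (le_of_eq ?_)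
    simp only [Finset.sum_add_distrib, ← Finset.mul_sum, Finset.sum_const, Finset.card_univ,
      nsmul_eq_mul]
    ring
  -- comparison of the terms
  set Y := V * Fintype.card S ^ 2 * Fintype.card A * Real.log (K * M.H) * M.ell K δ with hY
  set G := ∑ s, ∑ a, c₂ ^ 2 * V ^ 2 * Real.log (M.size * K) / (⨅ h : Set.Icc 1 M.H, g h s a)
  have hG : 0 ≤ G := Finset.sum_nonneg fun s _ => Finset.sum_nonneg fun a _ =>
    div_nonneg (mul_nonneg (by positivity) (Real.log_nonneg (by linarith [two_le_size_mul hs.two_le])))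
      (hg0 s a).le
  obtain ⟨hVY, hSA, hV8⟩ := hs.lower_order_le
  have hexp := hs.mul_two_pow_firstBlock_le
  rw [← hY] at hVY hSA hV8
  set m := max (M.Wdiff σ) (Vα ^ 2)
  have hm1 : M.Wdiff σ ≤ m := le_max_left _ _
  have hm2 : Vα ^ 2 ≤ m := le_max_right _ _
  set Z := M.scaleFactor K c₁ δ with hZdef
  have hscale : V * (25 / 16 * T * Vα ^ 2) + V * (64 * T * M.Wdiff σ)
      + 2 * (16 * √T * M.Wstar σ) ^ 2 / M.vGap S₀
      ≤ 20000 * ((M.Wstar σ ^ 2 / (M.vGap S₀ * V ^ 2) + m / V) * Z) := by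
    have h1 : V * (25 / 16 * T * Vα ^ 2) + V * (64 * T * M.Wdiff σ) ≤ 600 * (m / V * Z) := by
      calc _ ≤ V * (25 / 16 * T * m) + V * (64 * T * m) := by gcongr
        _ = 524.5 * (m / V * Z) := by rw [hT]; field_simp; ring
        _ ≤ _ := by gcongr; norm_num
    have h2 : 2 * (16 * √T * M.Wstar σ) ^ 2 / M.vGap S₀
        = 4096 * (M.Wstar σ ^ 2 / (M.vGap S₀ * V ^ 2) * Z) := by
      rw [mul_pow, mul_pow, Real.sq_sqrt hT0, hT]; field_simp; ring
    have h3 : 0 ≤ M.Wstar σ ^ 2 / (M.vGap S₀ * V ^ 2) * Z := by positivity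
    have h4 : 0 ≤ m / V * Z := mul_nonneg (div_nonneg (hWd.trans hm1) hV.le) hZ
    rw [h2]; linarith
  have hfin : effectiveGapBound M σ V Vα K c₁ c₂ δ S₀ g 20000
      = V * Real.exp (20000 * (1 / c₂ ^ 2 * Real.log (1 / δ))) + 20000 * G
        + 20000 * ((M.Wstar σ ^ 2 / (M.vGap S₀ * V ^ 2) + m / V) * Z) + 20000 * Y := by
    rw [effectiveGapBound, hZdef, scaleFactor, ← mul_assoc (M.Wstar σ ^ 2 / _ + m / V)]
  rw [hfin]
  linarith

/-- With W^* ≤ 2 V² and Vα ≤ V, every violation of validity forces θ V to exceed an absolute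
constant above 1/32, so the θ term alone dominates the trivial bound V. -/
lemma Setup.regret_le_worst (hs : Setup μ I M σ V Vα K c₁ c₂ Λ δ) {i₀ : ℕ} {ω : Ω}
    (hg : Good I M σ V Vα K c₁ c₂ Λ δ i₀ ω) {k : ℕ} (hk : k ∈ Set.Icc 1 K)
    (hW2 : M.Wstar σ ≤ 2 * V ^ 2) (s : S) :
    M.Vstar 1 s - M.V (I.policy k ω) 1 s
      ≤ (if (k : ℝ) < 2 ^ i₀ then V else 0)
        + 32 * M.theta K V c₁ Λ δ (Nat.log 2 k) * V ^ 2
        + I.costVal M (fun _ _ N => (4 * M.eqoC1 K V c₁ Λ K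
          + 64 * Fintype.card S * V * M.ell K δ) / N) (2 * V) k ω M.H 1 s := by
  have hV := hs.V_pos
  have hell := M.three_le_ell hs.one_le_H (k := K) hs.δ_pos hs.δ_le
  have hWd := M.Wdiff_le_Wstar σ hs.one_le_H
  have hc1 := hs.eqoC1_pos hs.one_le_K
  have hθ := hs.theta_pos (Nat.log 2 k)
  have hR := hs.regret_le_V (I.policy k ω) s
  have hα := hs.Vα_le
  have hvalid := hg.regret_le hs hk (s := s)
  set U := I.costVal M (fun _ _ N => (4 * M.eqoC1 K V c₁ Λ K
          + 64 * Fintype.card S * V * M.ell K δ) / N) (2 * V) k ω M.H 1 s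
  have hU : 0 ≤ U := M.clipVal_nonneg (by positivity) (fun s a =>
    Interaction.cost_nonneg (by positivity) (fun s a N hN => by positivity) k ω s a) _ _ _
  set θ := M.theta K V c₁ Λ δ (Nat.log 2 k)
  have i1 : 0 ≤ (if (k : ℝ) < 2 ^ i₀ then V else 0) := by split_ifs <;> positivity
  have i2 : 0 ≤ 32 * θ * V ^ 2 := by positivity
  have hθW := mul_le_mul_of_nonneg_left hW2 hθ.le
  by_cases hi : i₀ ≤ Nat.log 2 k
  swap
  · have : (k : ℝ) < 2 ^ i₀ := by
      exact_mod_cast Nat.lt_pow_of_log_lt (by norm_num) (not_le.1 hi)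
    rw [if_pos this]; linarith
  by_cases h1 : 5 / 4 * θ * Vα ≤ 1
  swap
  · have h2 : V * 1 ≤ V * (5 / 4 * θ * V) := by
      refine mul_le_mul_of_nonneg_left ((not_le.1 h1).le.trans ?_) hV.le
      gcongr
    nlinarith
  by_cases h2 : θ ^ 2 * M.Wdiff σ ≤ 1 / 64
  swap
  · have h3 : 1 / 64 < θ ^ 2 * (2 * V ^ 2) :=
      (not_le.1 h2).trans_le (mul_le_mul_of_nonneg_left (hWd.trans hW2) (sq_nonneg _))
    have h4 : 1 < 16 * (θ * V) := by
      by_contra hc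
      have h5 : θ * V ≤ 1 / 16 := by linarith
      have h6 : (θ * V) ^ 2 ≤ (1 / 16) ^ 2 := by gcongr
      nlinarith
    nlinarith
  by_cases h3 : θ * M.Wstar σ ≤ V / 16
  swap
  · have := not_le.1 h3
    linarith
  have h4 := hvalid hi ⟨h1, h2, h3⟩
  linarith

lemma Setup.measure_regret_gt_le_worst (hs : Setup μ I M σ V Vα K c₁ c₂ Λ δ)
    (hW2 : M.Wstar σ ≤ 2 * V ^ 2) :
    μ {ω | worstCaseBound M V K c₁ c₂ Λ δ 20000 < I.regret M K ω} ≤ ENNReal.ofReal δ := by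
  have hV := hs.V_pos
  have hH := hs.one_le_H
  have hc₁ := hs.c₁_pos
  have hell := M.three_le_ell hs.one_le_H (k := K) hs.δ_pos hs.δ_le
  have hc1 := hs.eqoC1_pos hs.one_le_K
  have hδ := hs.δ_pos
  have hl : 0 ≤ Real.log (1 / δ) := log_one_div_nonneg hδ hs.δ_le
  have hlog := half_lt_log hs.two_le
  have hS : (1 : ℝ) ≤ Fintype.card S := by exact_mod_cast Fintype.card_pos
  have hA : (1 : ℝ) ≤ Fintype.card A := by exact_mod_cast Fintype.card_pos
  have hΛ := hs.three_le_Λ hs.one_le_K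
  have hΛ₀ := three_le_log_size M hH
  set φ : S → A → ℝ → ℝ := fun _ _ N => (4 * M.eqoC1 K V c₁ Λ K
          + 64 * Fintype.card S * V * M.ell K δ) / N with hφ
  have hU := Interaction.measure_sum_costVal_gt_le (φ := φ) hs.follows hH
    (by positivity : 0 < 2 * V) (fun s a => by fun_prop)
    (fun s a N hN => by simp only [hφ]; positivity)
    (fun s a N N' hN hNN => by simp only [hφ]; gcongr) hs.two_le (Real.log (8 / δ))
  refine hs.measure_not_good_or_le hU (ae_of_all _ fun ω hgood hnU => ?_)
  simp only [Set.mem_ofPred_eq, not_lt] at hnU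
  set D := 1 + Real.log (1 / δ) / Real.log (32 * M.size) with hD
  have hD0 : 0 ≤ D := by positivity
  set R := √(K * Fintype.card S * Fintype.card A * Λ K * Real.log (K * M.H)) with hRdef
  have hsum : I.regret M K ω ≤ V * 2 ^ firstBlock c₂ δ + 192 * (D / c₁ * V * R)
      + ∑ k ∈ Finset.Icc 1 K, I.costVal M φ (2 * V) k ω M.H 1 (I.state k 1 ω) := by
    have h1 : I.regret M K ω ≤ _ := Finset.sum_le_sum fun k hk =>
      hs.regret_le_worst hgood (Finset.mem_Icc.1 hk) hW2 (I.state k 1 ω)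
    refine h1.trans ?_
    simp only [Finset.sum_add_distrib]
    gcongr
    · exact sum_Icc_ite_lt_le K (by positivity) hV.le
    · calc ∑ k ∈ Finset.Icc 1 K, 32 * M.theta K V c₁ Λ δ (Nat.log 2 k) * V ^ 2
          ≤ ∑ k ∈ Finset.Icc 1 K, 32 * (3 / (c₁ * V) * D
            * √(Fintype.card S * Fintype.card A * Λ K * Real.log (K * M.H)) * (1 / √k)) * V ^ 2 := by
            gcongr with k hk
            exact hs.theta_le (Finset.mem_Icc.1 hk)
        _ = 96 * V * D / c₁ * √(Fintype.card S * Fintype.card A * Λ K * Real.log (K * M.H))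
            * ∑ k ∈ Finset.Icc 1 K, 1 / √(k : ℝ) := by
            rw [Finset.mul_sum]
            refine Finset.sum_congr rfl fun k _ => ?_
            field_simp; ring
        _ ≤ 96 * V * D / c₁ * √(Fintype.card S * Fintype.card A * Λ K * Real.log (K * M.H))
            * (2 * √K) := by
            gcongr
            exact sum_Icc_inv_sqrt_le K
        _ = _ := by
            have : R = √(Fintype.card S * Fintype.card A * Λ K * Real.log (K * M.H)) * √K := by
              rw [← Real.sqrt_mul (by positivity), hRdef]; congr 1; ring
            rw [this]; ring
  set Y := V * Fintype.card S ^ 2 * Fintype.card A * Real.log (K * M.H) * M.ell K δ with hY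
  -- The normalization of c_{1,k} is chosen for this: summed over pairs and counts, the bonus c_1 /
  -- N is of the same order √K as the sum of the errors θ V².
  have hcR : Fintype.card S * Fintype.card A * Real.log (K * M.H) * M.eqoC1 K V c₁ Λ K
      = c₁ * V * R := by
    set B := (Fintype.card S * Fintype.card A * Real.log (K * M.H) : ℝ) with hB
    have hB0 : 0 < B := by positivity
    have h1 : R = B * √(K * Λ K / B) := by
      rw [hRdef, show (K * Fintype.card S * Fintype.card A * Λ K * Real.log (K * M.H) : ℝ)
        = B ^ 2 * (K * Λ K / B) by rw [hB]; field_simp, Real.sqrt_mul (by positivity),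
        Real.sqrt_sq hB0.le]
    rw [h1, eqoC1, ← hB]; ring
  have hcost : ∑ s, ∑ a, ∑ n ∈ Finset.range (K * M.H), φ s a (((n : ℝ) + 1) / 2)
      ≤ 20 * (c₁ * V * R) + 320 * Y := by
    have h1 : ∀ (s : S) (a : A), ∑ n ∈ Finset.range (K * M.H), φ s a (((n : ℝ) + 1) / 2)
        ≤ 5 * (4 * M.eqoC1 K V c₁ Λ K + 64 * Fintype.card S * V * M.ell K δ)
          * Real.log (K * M.H) := by
      intro s a
      have h3 := sum_range_div_half_le hs.two_le
        (b := 4 * M.eqoC1 K V c₁ Λ K + 64 * Fintype.card S * V * M.ell K δ) (by positivity)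
      push_cast at h3
      exact h3
    refine (Finset.sum_le_sum fun s _ => Finset.sum_le_sum fun a _ => h1 s a).trans (le_of_eq ?_)
    simp only [Finset.sum_const, Finset.card_univ, nsmul_eq_mul]
    rw [← hcR, hY]
    ring
  obtain ⟨hVY, hSA, hV8⟩ := hs.lower_order_le
  have hexp := hs.mul_two_pow_firstBlock_le
  rw [← hY] at hVY hSA hV8
  have hY2 : Y ≤ V * Fintype.card S ^ 2 * Fintype.card A * M.ell K δ
      * Real.log (2 * K * M.H) := by
    have hKH : (2 : ℝ) ≤ K * M.H := by exact_mod_cast hs.two_le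
    have h1 : Real.log (K * M.H) ≤ Real.log (2 * K * M.H) :=
      Real.log_le_log (by linarith) (by linarith)
    calc Y = V * Fintype.card S ^ 2 * Fintype.card A * M.ell K δ * Real.log (K * M.H) := by
          rw [hY]; ring
      _ ≤ _ := by gcongr
  have h1 : 0 ≤ D / c₁ * V * R := by positivity
  have h2 : 0 ≤ c₁ * V * R := by positivity
  have hfin : (Real.log (1 / δ) / (c₁ * Real.log (32 * M.size)) + 1 / c₁ + c₁) * V * R
      = D / c₁ * V * R + c₁ * V * R := by
    rw [hD]; field_simp; ring
  rw [worstCaseBound, hfin]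
  linarith

end Total

end EQO

namespace EQO

/-! ### Comparison of the bounds and the conclusion. -/

section Bounds

open MDP

variable {Ω S A : Type*} [Fintype S] [Fintype A] [Nonempty S] [Nonempty A] {M : MDP S A}
  {σ : ℕ → S → A → ℝ} {V Vα : ℝ} {K : ℕ} {c₁ c₂ : ℝ} {Λ : ℕ → ℝ} {δ : ℝ} {S₀ : Set S}
  {g : ℕ → S → A → ℝ} {C C' : ℝ}

lemma one_le_H_of_two_le (h : 2 ≤ K * M.H) : 1 ≤ M.H := by
  by_contra hc
  have : M.H = 0 := by omega
  simp [this] at h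

lemma effectiveGapBound_mono (h2 : 2 ≤ K * M.H) (hV : 0 ≤ V) (hδ : 0 < δ) (hδ1 : δ ≤ 1)
    (hg : M.IsEffectiveGap S₀ g) (hC : C ≤ C') :
    effectiveGapBound M σ V Vα K c₁ c₂ δ S₀ g C
      ≤ effectiveGapBound M σ V Vα K c₁ c₂ δ S₀ g C' := by
  have hH := one_le_H_of_two_le h2
  have hl := log_one_div_nonneg hδ hδ1
  have hell := M.three_le_ell hH (k := K) hδ hδ1
  have hlog := half_lt_log h2
  have hΛ := three_le_log_size M hH
  have hv := vGap_nonneg (M := M) (S₀ := S₀)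
  have hsz : 0 ≤ Real.log (M.size * K) := Real.log_nonneg (by linarith [two_le_size_mul h2])
  have hm : 0 ≤ max (M.Wdiff σ) (Vα ^ 2) := le_max_of_le_right (sq_nonneg _)
  have hi : ∀ s a, 0 ≤ ⨅ h : Set.Icc 1 M.H, g h s a := fun s a =>
    Real.iInf_nonneg fun h => (hg.1 h h.2 s a).le
  rw [effectiveGapBound, effectiveGapBound]
  gcongr
  exact Finset.sum_nonneg fun s _ => Finset.sum_nonneg fun a _ =>
    div_nonneg (by positivity) (hi s a)

lemma effectiveGapBound_nonneg (h2 : 2 ≤ K * M.H) (hV : 0 ≤ V) (hδ : 0 < δ) (hδ1 : δ ≤ 1)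
    (hg : M.IsEffectiveGap S₀ g) (hC : 0 ≤ C) :
    0 ≤ effectiveGapBound M σ V Vα K c₁ c₂ δ S₀ g C := by
  refine le_trans ?_ (effectiveGapBound_mono h2 hV hδ hδ1 hg hC)
  simpa [effectiveGapBound] using hV

lemma gapBound_nonneg (h2 : 2 ≤ K * M.H) (hV : 0 ≤ V) (hδ : 0 < δ) (hδ1 : δ ≤ 1) (hC : 0 ≤ C) :
    0 ≤ gapBound M V K c₁ c₂ δ C := by
  have hH := one_le_H_of_two_le h2
  have hell := M.three_le_ell hH (k := K) hδ hδ1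
  have hlog := half_lt_log h2
  have hΛ := three_le_log_size M hH
  have hv := gapMin_nonneg (M := M)
  have hsz : 0 ≤ Real.log (M.size * K) := Real.log_nonneg (by linarith [two_le_size_mul h2])
  have hi : ∀ s a, 0 ≤ max (M.gapSA s a) (M.gapMin / M.H) := fun s a =>
    le_max_of_le_right (by positivity)
  have hG : 0 ≤ ∑ s, ∑ a, c₂ ^ 2 * V ^ 2 * Real.log (M.size * K)
      / max (M.gapSA s a) (M.gapMin / M.H) :=
    Finset.sum_nonneg fun s _ => Finset.sum_nonneg fun a _ => div_nonneg (by positivity) (hi s a)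
  rw [gapBound]
  positivity

lemma worstCaseBound_mono (h2 : 2 ≤ K * M.H) (hV : 0 ≤ V) (hc₁ : 0 < c₁) (hδ : 0 < δ)
    (hδ1 : δ ≤ 1) (hC : C ≤ C') :
    worstCaseBound M V K c₁ c₂ Λ δ C ≤ worstCaseBound M V K c₁ c₂ Λ δ C' := by
  have hH := one_le_H_of_two_le h2
  have hl := log_one_div_nonneg hδ hδ1
  have hell := M.three_le_ell hH (k := K) hδ hδ1
  have hΛ := three_le_log_size M hH
  have hKH : (2 : ℝ) ≤ K * M.H := by exact_mod_cast h2
  have hlog : 0 ≤ Real.log (2 * K * M.H) := Real.log_nonneg (by linarith)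
  rw [worstCaseBound, worstCaseBound]
  gcongr

lemma worstCaseBound_nonneg (h2 : 2 ≤ K * M.H) (hV : 0 ≤ V) (hc₁ : 0 < c₁) (hδ : 0 < δ)
    (hδ1 : δ ≤ 1) (hC : 0 ≤ C) : 0 ≤ worstCaseBound M V K c₁ c₂ Λ δ C := by
  refine le_trans ?_ (worstCaseBound_mono h2 hV hc₁ hδ hδ1 hC)
  simpa [worstCaseBound] using hV

/-- The gaps, bounded below by `gapMin / H`, are effective gaps; the resulting bound. -/
lemma effectiveGapBound_le_gapBound (h2 : 2 ≤ K * M.H) (hB : M.Bounded V) (hV : 0 < V)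
    (hc₁ : 0 < c₁) (hδ : 0 < δ) (hδ1 : δ ≤ 1) (hv : 0 < M.vGap S₀) (hW : M.Wstar σ ≤ 2 * V ^ 2)
    (hα0 : 0 ≤ Vα) (hα : Vα ≤ V) (hC : 0 ≤ C) :
    effectiveGapBound M σ V Vα K c₁ c₂ δ S₀
      (fun h s a => max (M.gap h s a) (M.gapMin / M.H) / 2) C
        ≤ gapBound M V K c₁ c₂ δ (6 * C) := by
  have hH := one_le_H_of_two_le h2
  have hH0 : (0 : ℝ) < M.H := by exact_mod_cast hH
  have hl := log_one_div_nonneg hδ hδ1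
  have hell := M.three_le_ell hH (k := K) hδ hδ1
  have hlog := half_lt_log h2
  have hΛ := three_le_log_size M hH
  have hgm := gapMin_pos_of_vGap_pos hv
  have hgv := gapMin_le_vGap hv
  have hvV := vGap_le (S₀ := S₀) hB hV.le
  have hsz : 0 ≤ Real.log (M.size * K) := Real.log_nonneg (by linarith [two_le_size_mul h2])
  have hW0 := M.Wstar_nonneg σ hH
  have hWd := M.Wdiff_le_Wstar σ hH
  have hsum : ∑ s, ∑ a, c₂ ^ 2 * V ^ 2 * Real.log (M.size * K)
        / (⨅ h : Set.Icc 1 M.H, max (M.gap h s a) (M.gapMin / M.H) / 2)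
      ≤ 6 * ∑ s, ∑ a, c₂ ^ 2 * V ^ 2 * Real.log (M.size * K)
        / max (M.gapSA s a) (M.gapMin / M.H) := by
    simp only [Finset.mul_sum]
    refine Finset.sum_le_sum fun s _ => Finset.sum_le_sum fun a _ => ?_
    have h3 := max_gapSA_le_iInf hH (M.gapMin / M.H) s a
    have h4 : 0 < max (M.gapSA s a) (M.gapMin / M.H) := lt_max_of_lt_right (by positivity)
    calc _ ≤ c₂ ^ 2 * V ^ 2 * Real.log (M.size * K)
          / (max (M.gapSA s a) (M.gapMin / M.H) / 2) := by gcongr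
      _ = 2 * (c₂ ^ 2 * V ^ 2 * Real.log (M.size * K)
          / max (M.gapSA s a) (M.gapMin / M.H)) := by field_simp
      _ ≤ _ := by gcongr; norm_num
  -- The 6 is 4 + 2: (2 V²)² / V² from the first term, where `gapMin` ≤ v_gap, and 2 V from the
  -- second, where `gapMin` ≤ v_gap ≤ V.
  have hcoef : M.Wstar σ ^ 2 / (M.vGap S₀ * V ^ 2) + max (M.Wdiff σ) (Vα ^ 2) / V
      ≤ 6 * (V ^ 2 / M.gapMin) := by
    have h3 : M.Wstar σ ^ 2 / (M.vGap S₀ * V ^ 2) ≤ 4 * (V ^ 2 / M.gapMin) := by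
      calc _ ≤ (2 * V ^ 2) ^ 2 / (M.gapMin * V ^ 2) := by gcongr
        _ = _ := by field_simp; ring
    have h4 : max (M.Wdiff σ) (Vα ^ 2) / V ≤ 2 * (V ^ 2 / M.gapMin) := by
      have h5 : max (M.Wdiff σ) (Vα ^ 2) ≤ 2 * V ^ 2 := max_le (hWd.trans hW) (by nlinarith)
      calc _ ≤ 2 * V ^ 2 / V := by gcongr
        _ = 2 * (V ^ 2 / V) := by ring
        _ ≤ _ := by gcongr; linarith
    linarith
  have hY : 0 ≤ V * Fintype.card S ^ 2 * Fintype.card A * Real.log (K * M.H) * M.ell K δ := by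
    positivity
  rw [effectiveGapBound, gapBound]
  have e1 : V * Real.exp (C * (1 / c₂ ^ 2 * Real.log (1 / δ)))
      ≤ V * Real.exp (6 * C * (1 / c₂ ^ 2 * Real.log (1 / δ))) := by
    gcongr; linarith
  have e2 := mul_le_mul_of_nonneg_left hsum hC
  have e3 : C * ((M.Wstar σ ^ 2 / (M.vGap S₀ * V ^ 2) + max (M.Wdiff σ) (Vα ^ 2) / V)
        * (M.ell K δ ^ 2 / (c₁ ^ 2 * Real.log (32 * M.size)))
        * (Fintype.card S * Fintype.card A * Real.log (K * M.H)))
      ≤ 6 * C * (V ^ 2 * Fintype.card S * Fintype.card A * Real.log (K * M.H)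
          * M.ell K δ ^ 2 / (c₁ ^ 2 * M.gapMin * Real.log (32 * M.size))) := by
    calc _ ≤ C * ((6 * (V ^ 2 / M.gapMin))
        * (M.ell K δ ^ 2 / (c₁ ^ 2 * Real.log (32 * M.size)))
        * (Fintype.card S * Fintype.card A * Real.log (K * M.H))) := by gcongr
      _ = _ := by field_simp
  have e4 := mul_nonneg hC hY
  linarith

lemma upperQuantile_le [MeasurableSpace Ω] {μ : Measure Ω} {X : Ω → ℝ} {x : ℝ}
    (h : μ {ω | x < X ω} ≤ ENNReal.ofReal δ) : upperQuantile μ X δ ≤ x :=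
  sInf_le ⟨x, h, rfl⟩

lemma upperQuantile_le_of_ae_nonpos [MeasurableSpace Ω] {μ : Measure Ω} {X : Ω → ℝ} {x : ℝ}
    (hX : ∀ᵐ ω ∂μ, X ω ≤ 0) (hx : 0 ≤ x) : upperQuantile μ X δ ≤ x := by
  refine upperQuantile_le ((le_of_eq ?_).trans zero_le)
  have : ∀ᵐ ω ∂μ, ¬ x < X ω := by filter_upwards [hX] with ω hω using not_lt.2 (hω.trans hx)
  simpa [ae_iff] using this

end Bounds

end EQO

theorem corollary2 :
    ∃ C : ℝ, 0 < C ∧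
      ∀ (S A Ω : Type*) [Fintype S] [Nonempty S] [Fintype A] [Nonempty A] [MeasurableSpace Ω]
        (μ : Measure Ω) [IsProbabilityMeasure μ]
        (M : EQO.MDP S A) (S₀ : Set S) (σ : ℕ → S → A → ℝ) (Vmax Vα : ℝ)
        (K : ℕ) (c₁ c₂ : ℝ) (Λ : ℕ → ℝ) (I : EQO.Interaction Ω S A) (δ : ℝ),
        2 ≤ K * M.H → 0 < c₁ → 2 ≤ c₂ →
        -- the logarithmic factor in `c_{1,k}`
        (∀ j k, 1 ≤ j → j ≤ k → Λ j ≤ Λ k) →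
        (∀ k : ℕ, 1 ≤ k → Real.log (32 * M.size * (1 + Real.log k)) ≤ Λ k) →
        (∀ k : ℕ, 1 ≤ k → Λ k ≤ Real.log (32 * M.size * (k : ℝ) ^ 2)) →
        -- the standing assumptions
        M.Bounded Vmax →
        I.Follows μ M →
        (∀ k, 1 ≤ k → ∀ᵐ ω ∂μ, I.state k 1 ω ∈ S₀) →
        EQO.SubExponential I μ M σ Vα →
        M.sigmaMax σ Vα Vmax ^ 2 ≤ 2 * Vmax ^ 2 →
        I.RunsEQOPlus M.H Vmax (M.eqoC1 K Vmax c₁ Λ) (M.hoeffdingC2 Vmax c₂) →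
        0 < δ → δ ≤ 1 →
        -- instance-dependent bound for effective gaps
        (∀ g : ℕ → S → A → ℝ, M.IsEffectiveGap S₀ g →
          EQO.upperQuantile μ (I.regret M K) δ ≤
            ((Vmax * Real.exp (C * (1 / c₂ ^ 2 * Real.log (1 / δ)))
              + C * ∑ s, ∑ a, c₂ ^ 2 * Vmax ^ 2 * Real.log (M.size * K)
                  / (⨅ h : Set.Icc 1 M.H, g h s a)
              + C * ((M.Wstar σ ^ 2 / (M.vGap S₀ * Vmax ^ 2) + max (M.Wdiff σ) (Vα ^ 2) / Vmax)
                  * (M.ell K δ ^ 2 / (c₁ ^ 2 * Real.log (32 * M.size)))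
                  * (Fintype.card S * Fintype.card A * Real.log (K * M.H)))
              + C * (Vmax * Fintype.card S ^ 2 * Fintype.card A * Real.log (K * M.H)
                  * M.ell K δ) : ℝ) : EReal)) ∧
        (M.Wstar σ ≤ 2 * Vmax ^ 2 → Vα ≤ 2 * Vmax →
          -- instance-dependent bound
          EQO.upperQuantile μ (I.regret M K) δ ≤
            ((Vmax * Real.exp (C * (1 / c₂ ^ 2 * Real.log (1 / δ)))
              + C * ∑ s, ∑ a, c₂ ^ 2 * Vmax ^ 2 * Real.log (M.size * K)
                  / max (M.gapSA s a) (M.gapMin / M.H)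
              + C * (Vmax ^ 2 * Fintype.card S * Fintype.card A * Real.log (K * M.H)
                    * M.ell K δ ^ 2 / (c₁ ^ 2 * M.gapMin * Real.log (32 * M.size))
                  + Vmax * Fintype.card S ^ 2 * Fintype.card A * Real.log (K * M.H)
                    * M.ell K δ) : ℝ) : EReal) ∧
          -- worst-case bound
          EQO.upperQuantile μ (I.regret M K) δ ≤
            ((Vmax * Real.exp (C * (1 / c₂ ^ 2 * Real.log (1 / δ)))
              + C * ((Real.log (1 / δ) / (c₁ * Real.log (32 * M.size)) + 1 / c₁ + c₁)
                    * Vmax * √(K * Fintype.card S * Fintype.card A * Λ K * Real.log (K * M.H))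
                  + Vmax * Fintype.card S ^ 2 * Fintype.card A * M.ell K δ
                    * Real.log (2 * K * M.H)) : ℝ) : EReal)) := by
  -- The constant 20000 serves the effective-gap and worst-case bounds; the factor 6 is lost in
  -- passing from effective gaps to gaps.
  refine ⟨6 * 20000, by norm_num, ?_⟩
  intro S A Ω _ _ _ _ _ μ _ M S₀ σ V Vα K c₁ c₂ Λ I δ h2 hc₁ hc₂ hΛm hΛl _ hB hF hS₀ hE hσ hR hδ hδ1
  change (∀ g, M.IsEffectiveGap S₀ g → EQO.upperQuantile μ (I.regret M K) δ
      ≤ (EQO.effectiveGapBound M σ V Vα K c₁ c₂ δ S₀ g (6 * 20000) : EReal)) ∧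
    (M.Wstar σ ≤ 2 * V ^ 2 → Vα ≤ 2 * V → EQO.upperQuantile μ (I.regret M K) δ
      ≤ (EQO.gapBound M V K c₁ c₂ δ (6 * 20000) : EReal) ∧
      EQO.upperQuantile μ (I.regret M K) δ
        ≤ (EQO.worstCaseBound M V K c₁ c₂ Λ δ (6 * 20000) : EReal))
  have hH := EQO.one_le_H_of_two_le h2
  have hV : 0 ≤ V := by
    have := hB 1 ⟨le_rfl, hH⟩ (Classical.arbitrary S) fun _ _ => Classical.arbitrary A
    exact this.1.trans this.2
  have hst := EQO.ae_forall_state_mem hS₀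
  have hgapZero : M.vGap S₀ = 0 → ∀ᵐ ω ∂μ, I.regret M K ω ≤ 0 := fun hv => by
    filter_upwards [hst] with ω hω
    exact Finset.sum_nonpos fun k hk =>
      (EQO.MDP.regret_eq_zero_of_vGap_eq_zero hv _ (hω k (Finset.mem_Icc.1 hk).1)).le
  -- If Vmax = 0, all values vanish and so does the regret; this case is separate because the
  -- potentials divide by Vmax.
  rcases hV.eq_or_lt with hV0 | hV0
  · have h0 : ∀ᵐ ω ∂μ, I.regret M K ω ≤ 0 := ae_of_all _ fun ω => Finset.sum_nonpos fun k hk => by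
      have h3 := hB.Vstar_le hV le_rfl (I.state k 1 ω)
      have h4 := hB.V_nonneg (I.policy k ω) le_rfl (I.state k 1 ω)
      linarith
    exact ⟨fun g hg => EQO.upperQuantile_le_of_ae_nonpos h0
        (EQO.effectiveGapBound_nonneg h2 hV hδ hδ1 hg (by norm_num)),
      fun _ _ => ⟨EQO.upperQuantile_le_of_ae_nonpos h0
        (EQO.gapBound_nonneg h2 hV hδ hδ1 (by norm_num)),
        EQO.upperQuantile_le_of_ae_nonpos h0
          (EQO.worstCaseBound_nonneg h2 hV hc₁ hδ hδ1 (by norm_num))⟩⟩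
  have hs : EQO.Setup μ I M σ V Vα K c₁ c₂ Λ δ :=
    ⟨h2, hc₁, hc₂, hΛm, hΛl, hB, hF, hE, hσ, hR, hδ, hδ1, hV0⟩
  have hv := EQO.MDP.vGap_nonneg (M := M) (S₀ := S₀)
  refine ⟨fun g hg => ?_, fun hW _ => ⟨?_, ?_⟩⟩
  · rcases hv.eq_or_lt with hv0 | hv0
    · exact EQO.upperQuantile_le_of_ae_nonpos (hgapZero hv0.symm)
        (EQO.effectiveGapBound_nonneg h2 hV hδ hδ1 hg (by norm_num))
    · refine (EQO.upperQuantile_le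
        (hs.measure_regret_gt_le_of_isEffectiveGap hS₀ hg hv0)).trans ?_
      exact EReal.coe_le_coe_iff.2 (EQO.effectiveGapBound_mono h2 hV hδ hδ1 hg (by norm_num))
  · rcases hv.eq_or_lt with hv0 | hv0
    · exact EQO.upperQuantile_le_of_ae_nonpos (hgapZero hv0.symm)
        (EQO.gapBound_nonneg h2 hV hδ hδ1 (by norm_num))
    · refine (EQO.upperQuantile_le (hs.measure_regret_gt_le_of_isEffectiveGap hS₀
        (EQO.MDP.isEffectiveGap_max hH (EQO.MDP.gapMin_pos_of_vGap_pos hv0)) hv0)).trans ?_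
      exact EReal.coe_le_coe_iff.2 (EQO.effectiveGapBound_le_gapBound h2 hB hV0 hc₁ hδ hδ1 hv0 hW
        hs.Vα_nonneg hs.Vα_le (by norm_num))
  · refine (EQO.upperQuantile_le (hs.measure_regret_gt_le_worst hW)).trans ?_
    exact EReal.coe_le_coe_iff.2 (EQO.worstCaseBound_mono h2 hV hc₁ hδ hδ1 (by norm_num))
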